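/- Let $n,m\ge 2$; write $x=(x_1,{}'x)\in\mathbb R^n$ with ${}'x=(x_2,\dots,x_n)$, and $y=(y',y_m)\in\mathbb R^m$ with $y'=(y_1,\dots,y_{m-1})$. Let $\alpha_1,M,\nu>0$. Then there is a constant $\delta_*=\delta_*(\alpha_1,M,n,m,\nu)>0$ with the following property. Let $0<\varepsilon_0<\frac{\alpha_1}{4m}$, $$0<\gamma<\min\Bigl\{\tfrac12,\ \tfrac43\bigl(M(Mm^2\varepsilon_0^{-1}+m^2+m(m+1))\bigr)^{-1/2}\Bigr\},$$ $\alpha_0>0$ with $\gamma+\alpha_0<1$, and $\delta>\delta_*$. Put $\eta_0=\frac12\min\{\alpha_0,\gamma\}$, $s=x_1+\eta_0$, $\beta_0=n+2+Mm\bigl((1+3\sqrt{2\gamma})m+1\bigr)$. Then there is $\lambda_*>0$, depending on $\delta$ and on the fixed parameters $n,m,\alpha_1,M,\nu,\varepsilon_0,\gamma,\alpha_0$ only, such that the following holds. Let ${}'x^0=(x^0_2,\dots,x^0_n)\in\mathbb R^{n-1}$, $y'^0=(y^0_1,\dots,y^0_{m-1})\in\mathbb R^{m-1}$, and $$\psi=\delta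 x_1+\tfrac12\sum_{i=2}^n(x_i-x_i^0)^2+\tfrac12\sum_{j=1}^{m-1}(y_j-y_j^0)^2+\tfrac12y_m^2+\alpha_0,\qquad \chi=\exp(\lambda\psi^{-\nu}),$$ $$\Omega_\gamma=\{(x,y):\ x_1>0,\ 0<\psi-\alpha_0<\gamma\}.$$ Let $D\subset\mathbb R^n$ and $G'\subset\mathbb R^{m-1}$ be open and let $a_{ij}=a_{ij}(x,y')\in C^2(\overline{D\times G'})$, $1\le i,j\le m$, satisfy $\|a_{ij}\|_{C^2}\le M$ (the largest of the suprema of the absolute values of the partial derivatives of order at most two) and $$-\sum_{i,j=1}^m\frac{\partial a_{ij}}{\partial x_1}\xi^i\xi^j\ge\alpha_1|\xi|^2\qquad\text{for all }\xi\in\mathbb R^m\text{ and }(x,y')\in D\times G'.$$ Let $\tilde a_{ij}(x,y)=a_{ij}\bigl(\tfrac12(x_1+\eta_0)^2,{}'x,y'\bigr)$, assume that $\bigl(\tfrac12(x_1+\eta_0)^2,{}'x,y'\bigr)\in D\times G'$ for all $(x,y)\in\Omega_\gamma$, and put $$L_0\varphi=s^{-1}\varphi_{x_1x_1}+s\Bigl(\sum_{i=2}^n\varphi_{x_ix_i}-\sum_{i,j=1}^m\tilde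 a_{ij}\varphi_{y_iy_j}\Bigr).$$ Then for all $\varphi\in C^2(\overline{\Omega_\gamma})$ and all $\lambda>\lambda_*$, at every point of $\Omega_\gamma$, $$\psi^{\nu+1}(L_0\varphi)^2\chi^2-2\lambda\nu\beta_0\,\varphi\,s\,(L_0\varphi)\chi^2\ \ge\ 2\lambda\nu\delta s^{-3}\varphi_{x_1}^2\chi^2+2\lambda\nu s^2|\nabla_{'x}\varphi|^2\chi^2+2\lambda\nu s|\nabla_y\varphi|^2\chi^2+\lambda^3\nu^4\delta^4\psi^{-2\nu-3}\varphi^2\chi^2+D(\varphi).$$ Here $D(\varphi)=D_1(\chi\varphi)+D_2(\chi\varphi)+2\lambda\nu\beta_0D_3(\varphi)$ is the following divergence. Let $A_{ij}=\frac12(\tilde a_{ij}+\tilde a_{ji})$, and write $(\cdot)_{x_1}$, $(\cdot)_{x_r}$, $(\cdot)_{y_k}$ for partial derivatives; sums over $r,i'$ run over $2,\dots,n$, sums over $i,j,k$ over $1,\dots,m$. For functions $\vartheta,\omega$ put $$\langle\vartheta,\omega\rangle=\sum_{i,j}A_{ij}\vartheta_{y_i}\omega_{y_j},\quad (\vartheta,\omega)'=\sum_{i'}\vartheta_{x_{i'}}\omega_{x_{i'}},\quad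 (A\vartheta)_k=\sum_iA_{ik}\vartheta_{y_i},$$ $$\phi_1=\lambda^2\nu^2\psi^{-2\nu-2}-\lambda\nu(\nu+1)\psi^{-\nu-2},$$ $$\phi_2=\lambda^2\nu^2\psi^{-2\nu-2}(\psi,\psi)'-\lambda\nu\bigl((\nu+1)\psi^{-\nu-2}(\psi,\psi)'-(n-1)\psi^{-\nu-1}\bigr),$$ $$\phi_3=\lambda^2\nu^2\psi^{-2\nu-2}\langle\psi,\psi\rangle-\lambda\nu\Bigl((\nu+1)\psi^{-\nu-2}\langle\psi,\psi\rangle-\psi^{-\nu-1}\sum_iA_{ii}\Bigr),$$ $$\Phi=\delta^2\phi_1+s^2(\phi_2-\phi_3).$$ Then $$\begin{aligned}D_1(\vartheta)=2\lambda\nu\Bigl\{&\Bigl[\delta s^{-2}\vartheta_{x_1}^2-\delta(\vartheta,\vartheta)'+\delta\langle\vartheta,\vartheta\rangle+\delta^3s^{-2}\phi_1\vartheta^2+\delta(\phi_2-\phi_3)\vartheta^2+2(\psi,\vartheta)'\vartheta_{x_1}-2\langle\psi,\vartheta\rangle\vartheta_{x_1}\Bigr]_{x_1}\\ +\sum_r&\Bigl[2\delta\vartheta_{x_1}\vartheta_{x_r}-\psi_{x_r}\vartheta_{x_1}^2+2s^2(\psi,\vartheta)'\vartheta_{x_r}-s^2\psi_{x_r}(\vartheta,\vartheta)'+s^2\psi_{x_r}\langle\vartheta,\vartheta\rangle+\psi_{x_r}\Phi\vartheta^2-2s^2\langle\psi,\vartheta\rangle\vartheta_{x_r}\Bigr]_{x_r}\\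 +\sum_k&\Bigl[-2\delta(A\vartheta)_k\vartheta_{x_1}-2s^2(\psi,\vartheta)'(A\vartheta)_k+(A\psi)_k\vartheta_{x_1}^2+s^2(A\psi)_k(\vartheta,\vartheta)'+2s^2\langle\psi,\vartheta\rangle(A\vartheta)_k-s^2(A\psi)_k\langle\vartheta,\vartheta\rangle-(A\psi)_k\Phi\vartheta^2\Bigr]_{y_k}\Bigr\},\end{aligned}$$ $$D_2(\vartheta)=-2\lambda^2\nu^2\delta^2\bigl[s^{-3}\psi^{-\nu-1}\vartheta^2\bigr]_{x_1}+2\lambda^2\nu^2(\beta_0-1)\sum_r\bigl[s^2\psi_{x_r}\psi^{-\nu-1}\vartheta^2\bigr]_{x_r}-\lambda^2\nu^2\delta\alpha_1\sum_k\bigl[s\,\psi_{y_k}\psi^{-\nu-1}\vartheta^2\bigr]_{y_k},$$ $$\begin{aligned}D_3(\varphi)=&-\bigl[(\varphi\varphi_{x_1}+\lambda\nu\delta\psi^{-\nu-1}\varphi^2)\chi^2\bigr]_{x_1}-\sum_r\bigl[(\varphi\varphi_{x_r}+\lambda\nu\psi_{x_r}\psi^{-\nu-1}\varphi^2)\chi^2s^2\bigr]_{x_r}\\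 &+\sum_k\Bigl[\sum_j\Bigl(A_{kj}(\varphi_{y_j}\varphi+\lambda\nu\psi_{y_j}\psi^{-\nu-1}\varphi^2)-\tfrac12(A_{kj})_{y_j}\varphi^2\Bigr)\chi^2s^2\Bigr]_{y_k}.\end{aligned}$$ -/

import Mathlib

namespace UltraCarleman

open Finset

/-! ### Points, partial derivatives, `C²` up to the boundary -/

/-- Points `(x, y)` with `x ∈ ℝⁿ`, `y ∈ ℝᵐ`. -/
abbrev Pt (n m : ℕ) : Type := (Fin n → ℝ) × (Fin m → ℝ)

/-- The partial derivative `∂f/∂x_i`. -/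
noncomputable def dx {n m : ℕ} (i : Fin n) (f : Pt n m → ℝ) (z : Pt n m) : ℝ :=
  fderiv ℝ f z (Pi.single i 1, 0)

/-- The partial derivative `∂f/∂y_j`. -/
noncomputable def dy {n m : ℕ} (j : Fin m) (f : Pt n m → ℝ) (z : Pt n m) : ℝ :=
  fderiv ℝ f z (0, Pi.single j 1)

/-- The divergence of the vector field with `x`-components `F` and `y`-components `G`. -/
noncomputable def divergence {n m : ℕ} (F : Fin n → Pt n m → ℝ) (G : Fin m → Pt n m → ℝ)
    (z : Pt n m) : ℝ :=
  ∑ i, dx i (F i) z + ∑ j, dy j (G j) z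

/-- `f ∈ C²(closure U)` for an open set `U`: `f` is of class `C²` in `U` and its derivatives of
order at most two extend continuously to the closure of `U`. -/
def IsC2Closure {n m : ℕ} (U : Set (Pt n m)) (f : Pt n m → ℝ) : Prop :=
  ContDiffOn ℝ 2 f U ∧
    ∀ k : ℕ, k ≤ 2 → ∃ g : Pt n m → ContinuousMultilinearMap ℝ (fun _ : Fin k => Pt n m) ℝ,
      ContinuousOn g (closure U) ∧ Set.EqOn g (iteratedFDeriv ℝ k f) U

/-- `‖f‖_{C²(closure U)} ≤ M`, the norm being the largest of the suprema of the absolute values of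
the partial derivatives of order at most two (suprema over `U` and over its closure agree). -/
def C2NormLE {n m : ℕ} (U : Set (Pt n m)) (f : Pt n m → ℝ) (M : ℝ) : Prop :=
  ∀ z ∈ U, |f z| ≤ M ∧ (∀ i, |dx i f z| ≤ M) ∧ (∀ j, |dy j f z| ≤ M) ∧
    (∀ i i', |dx i (dx i' f) z| ≤ M) ∧ (∀ i j, |dx i (dy j f) z| ≤ M) ∧
    (∀ j j', |dy j (dy j' f) z| ≤ M)

/-! ### Domain and weight

Throughout `n = p + 1` and `m = q + 1`.  The coordinate `x₁` is `x 0`, the coordinates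
`x₂, …, xₙ` are `x i.succ` with `i : Fin p`, the coordinates `y₁, …, y_{m-1}` are `y j.castSucc`
with `j : Fin q` (so that `y' = Fin.init y`), and `y_m` is `y (Fin.last q)`. -/

/-- The parameters of the domain and of the weight.  The centre is `x⁰ = (0, x₀)`,
`y⁰ = (y₀, 0)`. -/
structure Params (p q : ℕ) where
  γ : ℝ
  α₀ : ℝ
  δ : ℝ
  ν : ℝ
  x₀ : Fin p → ℝ
  y₀ : Fin q → ℝ

variable {p q : ℕ}

/-- `δ x₁ + ½ ∑_{i ≥ 2} (x_i - x_i⁰)² + ½ ∑_{j ≤ m-1} (y_j - y_j⁰)² + ½ y_m²`. -/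
noncomputable def Params.psi₀ (P : Params p q) (z : Pt (p + 1) (q + 1)) : ℝ :=
  P.δ * z.1 0 + 1 / 2 * ∑ i : Fin p, (z.1 i.succ - P.x₀ i) ^ 2
    + 1 / 2 * ∑ j : Fin q, (z.2 j.castSucc - P.y₀ j) ^ 2 + 1 / 2 * z.2 (Fin.last q) ^ 2

/-- The domain `Ω_γ`. -/
def Params.omega (P : Params p q) : Set (Pt (p + 1) (q + 1)) :=
  {z | 0 < z.1 0 ∧ 0 < P.psi₀ z ∧ P.psi₀ z < P.γ}

/-- The function `ψ`. -/
noncomputable def Params.psi (P : Params p q) (z : Pt (p + 1) (q + 1)) : ℝ :=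
  P.psi₀ z + P.α₀

/-- The weight `χ = exp (λ ψ^{-ν})`. -/
noncomputable def Params.chi (P : Params p q) (lam : ℝ) (z : Pt (p + 1) (q + 1)) : ℝ :=
  Real.exp (lam * P.psi z ^ (-P.ν))

/-- `η₀`, defined by `2 η₀ = min {α₀, γ}`. -/
noncomputable def Params.eta₀ (P : Params p q) : ℝ := min P.α₀ P.γ / 2

/-- `x₁ + η₀`. -/
noncomputable def Params.s (P : Params p q) (z : Pt (p + 1) (q + 1)) : ℝ := z.1 0 + P.eta₀

/-! ### The operator -/

/-- The map `(x, y) ↦ ((½ (x₁ + η₀)², x₂, …, xₙ), y')`, from the variables in which `Ω_γ` and `L₀`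
are written to the original ones, on which the coefficients `a_ij` depend. -/
noncomputable def Params.orig (P : Params p q) (z : Pt (p + 1) (q + 1)) : Pt (p + 1) q :=
  (Function.update z.1 0 (1 / 2 * P.s z ^ 2), Fin.init z.2)

/-- The coefficients in the new variables,
`ã_ij (x, y) = a_ij (½ (x₁ + η₀)², x₂, …, xₙ, y')`. -/
noncomputable def Params.tilde (P : Params p q)
    (a : Fin (q + 1) → Fin (q + 1) → Pt (p + 1) q → ℝ)
    (i j : Fin (q + 1)) (z : Pt (p + 1) (q + 1)) : ℝ :=
  a i j (P.orig z)

/-- `L₀ φ = (x₁+η₀)⁻¹ φ_{x₁x₁} + (x₁+η₀) (∑_{i ≥ 2} φ_{x_i x_i} - ∑_{i,j} A_ij φ_{y_i y_j})`. -/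
noncomputable def Params.L₀ (P : Params p q)
    (A : Fin (q + 1) → Fin (q + 1) → Pt (p + 1) (q + 1) → ℝ)
    (φ : Pt (p + 1) (q + 1) → ℝ) (z : Pt (p + 1) (q + 1)) : ℝ :=
  (P.s z)⁻¹ * dx 0 (dx 0 φ) z
    + P.s z * (∑ i : Fin p, dx i.succ (dx i.succ φ) z
        - ∑ i, ∑ j, A i j z * dy i (dy j φ) z)

/-- `β₀ = n + 2 + M m ((1 + 3 √(2γ)) m + 1)`. -/
noncomputable def beta₀ (n m : ℕ) (M γ : ℝ) : ℝ :=
  n + 2 + M * m * ((1 + 3 * √(2 * γ)) * m + 1)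

/-! ### The divergence term -/

/-- The symmetric part `½ (A_ij + A_ji)`; it equals `A` when `A` is symmetric. -/
noncomputable def symPart (A : Fin (q + 1) → Fin (q + 1) → Pt (p + 1) (q + 1) → ℝ)
    (i j : Fin (q + 1)) (z : Pt (p + 1) (q + 1)) : ℝ :=
  (A i j z + A j i z) / 2

section Flux

variable (P : Params p q) (A : Fin (q + 1) → Fin (q + 1) → Pt (p + 1) (q + 1) → ℝ) (lam : ℝ)

/-- `φ₁ = λ²ν²ψ^{-2ν-2} - λν(ν+1)ψ^{-ν-2}`. -/
noncomputable def phi₁ (z : Pt (p + 1) (q + 1)) : ℝ :=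
  lam ^ 2 * P.ν ^ 2 * P.psi z ^ (-2 * P.ν - 2)
    - lam * P.ν * (P.ν + 1) * P.psi z ^ (-P.ν - 2)

/-- `φ₂`, the coefficient of `ϑ` in `χ Δ_{'x} (χ⁻¹ ϑ)`. -/
noncomputable def phi₂ (z : Pt (p + 1) (q + 1)) : ℝ :=
  lam ^ 2 * P.ν ^ 2 * (P.psi z ^ (-2 * P.ν - 2) * ∑ i : Fin p, dx i.succ P.psi z ^ 2)
    - lam * P.ν * ((P.ν + 1) * P.psi z ^ (-P.ν - 2) * (∑ i : Fin p, dx i.succ P.psi z ^ 2)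
        - p * P.psi z ^ (-P.ν - 1))

/-- `φ₃`, the coefficient of `ϑ` in `χ ∑ A_ij ∂_{y_i} ∂_{y_j} (χ⁻¹ ϑ)`. -/
noncomputable def phi₃ (z : Pt (p + 1) (q + 1)) : ℝ :=
  lam ^ 2 * P.ν ^ 2 * (P.psi z ^ (-2 * P.ν - 2)
      * ∑ i, ∑ j, A i j z * dy i P.psi z * dy j P.psi z)
    - lam * P.ν * ((P.ν + 1) * P.psi z ^ (-P.ν - 2)
          * (∑ i, ∑ j, A i j z * dy i P.psi z * dy j P.psi z)
        - P.psi z ^ (-P.ν - 1) * ∑ i, A i i z)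

/-- `Φ = δ² φ₁ + (x₁+η₀)² (φ₂ - φ₃)`. -/
noncomputable def bigPhi (z : Pt (p + 1) (q + 1)) : ℝ :=
  P.δ ^ 2 * phi₁ P lam z + P.s z ^ 2 * (phi₂ P lam z - phi₃ P A lam z)

/-- The `x`-components of the vector field whose divergence is `D₁(ϑ)`. -/
noncomputable def flux₁x (θ : Pt (p + 1) (q + 1) → ℝ) :
    Fin (p + 1) → Pt (p + 1) (q + 1) → ℝ :=
  Fin.cons
    (fun z =>
      2 * lam * P.ν * P.δ * (P.s z ^ 2)⁻¹ * dx 0 θ z ^ 2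
      - 2 * lam * P.ν * P.δ * ∑ i : Fin p, dx i.succ θ z ^ 2
      + 2 * lam * P.ν * P.δ * ∑ i, ∑ j, A i j z * dy i θ z * dy j θ z
      + 2 * lam * P.ν * P.δ ^ 3 * (P.s z ^ 2)⁻¹ * phi₁ P lam z * θ z ^ 2
      + 2 * lam * P.ν * P.δ * phi₂ P lam z * θ z ^ 2
      - 2 * lam * P.ν * P.δ * phi₃ P A lam z * θ z ^ 2
      + 4 * lam * P.ν * (∑ i : Fin p, dx i.succ P.psi z * dx i.succ θ z) * dx 0 θ z
      - 4 * lam * P.ν * (∑ i, ∑ j, A i j z * dy i P.psi z * dy j θ z) * dx 0 θ z)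
    (fun r z =>
      4 * lam * P.ν * P.δ * dx 0 θ z * dx r.succ θ z
      - 2 * lam * P.ν * dx r.succ P.psi z * dx 0 θ z ^ 2
      + 4 * lam * P.ν * P.s z ^ 2 * (∑ i : Fin p, dx i.succ P.psi z * dx i.succ θ z)
          * dx r.succ θ z
      - 2 * lam * P.ν * P.s z ^ 2 * dx r.succ P.psi z * ∑ i : Fin p, dx i.succ θ z ^ 2
      + 2 * lam * P.ν * P.s z ^ 2 * dx r.succ P.psi z
          * ∑ i, ∑ j, A i j z * dy i θ z * dy j θ z
      + 2 * lam * P.ν * dx r.succ P.psi z * bigPhi P A lam z * θ z ^ 2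
      - 4 * lam * P.ν * P.s z ^ 2 * (∑ i, ∑ j, A i j z * dy i P.psi z * dy j θ z)
          * dx r.succ θ z)

/-- The `y`-components of the vector field whose divergence is `D₁(ϑ)`. -/
noncomputable def flux₁y (θ : Pt (p + 1) (q + 1) → ℝ) (k : Fin (q + 1))
    (z : Pt (p + 1) (q + 1)) : ℝ :=
  -4 * lam * P.ν * P.δ * (∑ i, A i k z * dy i θ z) * dx 0 θ z
  - 4 * lam * P.ν * P.s z ^ 2 * (∑ i : Fin p, dx i.succ P.psi z * dx i.succ θ z)
      * ∑ i, A i k z * dy i θ z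
  + 2 * lam * P.ν * (∑ i, A i k z * dy i P.psi z) * dx 0 θ z ^ 2
  + 2 * lam * P.ν * P.s z ^ 2 * (∑ i, A i k z * dy i P.psi z)
      * ∑ i : Fin p, dx i.succ θ z ^ 2
  + 4 * lam * P.ν * P.s z ^ 2 * (∑ i, ∑ j, A i j z * dy i P.psi z * dy j θ z)
      * ∑ i, A i k z * dy i θ z
  - 2 * lam * P.ν * P.s z ^ 2 * (∑ i, A i k z * dy i P.psi z)
      * ∑ i, ∑ j, A i j z * dy i θ z * dy j θ z
  - 2 * lam * P.ν * (∑ i, A i k z * dy i P.psi z) * bigPhi P A lam z * θ z ^ 2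

/-- `D₁(ϑ)`. -/
noncomputable def D₁ (θ : Pt (p + 1) (q + 1) → ℝ) (z : Pt (p + 1) (q + 1)) : ℝ :=
  divergence (flux₁x P A lam θ) (flux₁y P A lam θ) z

/-- `D₂(ϑ)`, with `ϑ = χ φ`. -/
noncomputable def D₂ (α₁ β : ℝ) (θ : Pt (p + 1) (q + 1) → ℝ) (z : Pt (p + 1) (q + 1)) : ℝ :=
  divergence
    (Fin.cons
      (fun w => -2 * lam ^ 2 * P.ν ^ 2 * P.δ ^ 2
        * ((P.s w ^ 3)⁻¹ * P.psi w ^ (-P.ν - 1) * θ w ^ 2))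
      (fun (r : Fin p) w => 2 * lam ^ 2 * P.ν ^ 2 * P.s w ^ 2 * (β - 1)
        * (dx r.succ P.psi w * P.psi w ^ (-P.ν - 1) * θ w ^ 2)))
    (fun k w => -lam ^ 2 * P.ν ^ 2 * P.δ * α₁
        * (P.s w * dy k P.psi w * P.psi w ^ (-P.ν - 1) * θ w ^ 2))
    z

/-- `D₃(φ)`. -/
noncomputable def D₃ (φ : Pt (p + 1) (q + 1) → ℝ) (z : Pt (p + 1) (q + 1)) : ℝ :=
  divergence
    (Fin.cons
      (fun w => -((φ w * dx 0 φ w + lam * P.ν * P.δ * P.psi w ^ (-P.ν - 1) * φ w ^ 2)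
        * P.chi lam w ^ 2))
      (fun (r : Fin p) w => -((φ w * dx r.succ φ w
          + lam * P.ν * dx r.succ P.psi w * P.psi w ^ (-P.ν - 1) * φ w ^ 2)
        * P.chi lam w ^ 2 * P.s w ^ 2)))
    (fun k w => (∑ j, (A k j w * (dy j φ w * φ w
          + lam * P.ν * dy j P.psi w * P.psi w ^ (-P.ν - 1) * φ w ^ 2)
          - 1 / 2 * dy j (A k j) w * φ w ^ 2))
        * P.chi lam w ^ 2 * P.s w ^ 2)
    z

/-- The divergence term `D(φ) = D₁(χφ) + D₂(χφ) + 2λνβ₀ D₃(φ)`, in which only the symmetric part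
of the coefficients enters. -/
noncomputable def divTerm (α₁ β : ℝ) (φ : Pt (p + 1) (q + 1) → ℝ) (z : Pt (p + 1) (q + 1)) : ℝ :=
  D₁ P (symPart A) lam (fun w => P.chi lam w * φ w) z
    + D₂ P lam α₁ β (fun w => P.chi lam w * φ w) z
    + 2 * lam * P.ν * β * D₃ P (symPart A) lam φ z

end Flux

end UltraCarleman

open UltraCarleman

/-!
Since the Hessian of `φ` is symmetric, the coefficients may be replaced by their symmetric part `A`.
Write `θ = χ φ` and let `C` be the matrix of the principal part of `s L₀`. Conjugation by `χ` turns
`s L₀ φ` into `2 λ ν ψ^{-ν-1} ⟨C ∇ψ, ∇θ⟩` plus a second-order operator plus lower-order terms, and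
the square of the sum is at least twice the product of the first summand with the others. By the
energy identity with the multiplier `s⁻² ⟨C ∇ψ, ∇θ⟩`, this product is a divergence plus a quadratic
form in `∇θ` plus a potential times `θ²`.

The form is positive in `∇_y θ` because `-δ ∂A/∂x₁ ≥ δ α₁ s` outweighs everything else for large
`δ`; as `s` is at most a multiple of `γ`, the mixed terms with `θ_{x₁}` are absorbed for small `γ`.
The form is not positive in `∇_{'x} θ`, which the multiple of `β₀ φ s L₀ φ` repairs. The part of the
potential that is cubic in `λ` is bounded below by a multiple of `δ⁴ s⁻²`, and it dominates the
parts of lower degree for large `λ`.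
-/

namespace UltraCarleman

open scoped Matrix Matrix.Norms.Elementwise

variable {p q : ℕ}

/-! ### Directional derivatives and divergence identities -/

section Partials

variable {E : Type*} [NormedAddCommGroup E] [NormedSpace ℝ E]
  {F : Type*} [NormedAddCommGroup F] [NormedSpace ℝ F] {ι κ : Type*} {e : κ → E} {z : E}

/-- `f` is differentiable at `z`, with derivative `f' K` in the direction `e K`. For real `f` and
coordinate directions `e`, the family `f'` is the gradient of `f`. -/
structure HasPartials (e : κ → E) (f : E → F) (f' : κ → F) (z : E) : Prop where
  differentiableAt : DifferentiableAt ℝ f z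
  fderiv_apply : ∀ K, fderiv ℝ f z (e K) = f' K

namespace HasPartials

theorem of_hasFDerivAt {f : E → F} {f' : κ → F} {L : E →L[ℝ] F} (hf : HasFDerivAt f L z)
    (hL : ∀ K, L (e K) = f' K) : HasPartials e f f' z :=
  ⟨hf.differentiableAt, fun K => by rw [hf.fderiv, hL]⟩

theorem of_differentiableAt {f : E → F} (e : κ → E) (hf : DifferentiableAt ℝ f z) :
    HasPartials e f (fun K => fderiv ℝ f z (e K)) z :=
  ⟨hf, fun _ => rfl⟩

theorem congr_partials {f : E → F} {f' g' : κ → F} (hf : HasPartials e f f' z)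
    (h : ∀ K, f' K = g' K) : HasPartials e f g' z :=
  ⟨hf.differentiableAt, fun K => (hf.fderiv_apply K).trans (h K)⟩

theorem const (c : F) : HasPartials e (fun _ => c) (fun _ => 0) z :=
  of_hasFDerivAt (hasFDerivAt_const c z) fun _ => rfl

theorem pi_iff [Fintype ι] {V : E → ι → ℝ} {V' : κ → ι → ℝ} :
    HasPartials e V V' z ↔ ∀ i, HasPartials e (fun w => V w i) (fun K => V' K i) z := by
  constructor
  · intro h i
    refine of_hasFDerivAt (hasFDerivAt_pi'.mp h.differentiableAt.hasFDerivAt i) fun K => ?_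
    rw [← h.fderiv_apply]; rfl
  · intro h
    refine of_hasFDerivAt (hasFDerivAt_pi.mpr fun i => (h i).differentiableAt.hasFDerivAt)
      fun K => funext fun i => (h i).fderiv_apply K

theorem prodMk {G : Type*} [NormedAddCommGroup G] [NormedSpace ℝ G] {f : E → F} {f' : κ → F}
    {g : E → G} {g' : κ → G} (hf : HasPartials e f f' z) (hg : HasPartials e g g' z) :
    HasPartials e (fun w => (f w, g w)) (fun K => (f' K, g' K)) z :=
  of_hasFDerivAt (hf.differentiableAt.hasFDerivAt.prodMk hg.differentiableAt.hasFDerivAt)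
    fun K => Prod.ext (hf.fderiv_apply K) (hg.fderiv_apply K)

theorem fderiv_comp {f : E → F} {f' : κ → F} (hf : HasPartials e f f' z) {b : F → ℝ}
    (hb : DifferentiableAt ℝ b (f z)) (K : κ) :
    fderiv ℝ (fun w => b (f w)) z (e K) = fderiv ℝ b (f z) (f' K) := by
  rw [← hf.fderiv_apply]
  exact DFunLike.congr_fun (hb.hasFDerivAt.comp z hf.differentiableAt.hasFDerivAt).fderiv (e K)

theorem matrix_iff [Fintype ι] {C : E → Matrix ι ι ℝ} {C' : κ → Matrix ι ι ℝ} :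
    HasPartials e C C' z
      ↔ ∀ i j, HasPartials e (fun w => C w i j) (fun K => C' K i j) z := by
  constructor
  · intro h i
    refine pi_iff.mp (of_hasFDerivAt (hasFDerivAt_pi'.mp h.differentiableAt.hasFDerivAt i)
      fun K => ?_)
    rw [← h.fderiv_apply]; rfl
  · intro h
    have hi := fun i => pi_iff.mpr (h i)
    exact of_hasFDerivAt (hasFDerivAt_pi.mpr fun i => (hi i).differentiableAt.hasFDerivAt)
      fun K => funext fun i => (hi i).fderiv_apply K

section Algebra

variable {f g : E → F} {f' g' : κ → F} {c : E → ℝ} {c' : κ → ℝ}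

theorem add (hf : HasPartials e f f' z) (hg : HasPartials e g g' z) :
    HasPartials e (fun w => f w + g w) (fun K => f' K + g' K) z :=
  of_hasFDerivAt (hf.differentiableAt.hasFDerivAt.add hg.differentiableAt.hasFDerivAt) fun K => by
    simp [hf.fderiv_apply, hg.fderiv_apply]

theorem sub (hf : HasPartials e f f' z) (hg : HasPartials e g g' z) :
    HasPartials e (fun w => f w - g w) (fun K => f' K - g' K) z :=
  of_hasFDerivAt (hf.differentiableAt.hasFDerivAt.sub hg.differentiableAt.hasFDerivAt) fun K => by
    simp [hf.fderiv_apply, hg.fderiv_apply]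

theorem neg (hf : HasPartials e f f' z) : HasPartials e (fun w => -f w) (fun K => -f' K) z :=
  of_hasFDerivAt hf.differentiableAt.hasFDerivAt.neg fun K => by simp [hf.fderiv_apply]

theorem smul (hc : HasPartials e c c' z) (hf : HasPartials e f f' z) :
    HasPartials e (fun w => c w • f w) (fun K => c' K • f z + c z • f' K) z :=
  of_hasFDerivAt (hc.differentiableAt.hasFDerivAt.smul hf.differentiableAt.hasFDerivAt)
    fun K => by simp [hf.fderiv_apply, hc.fderiv_apply, add_comm]

theorem sum [Fintype ι] {G : ι → E → F} {G' : ι → κ → F}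
    (hG : ∀ k, HasPartials e (G k) (G' k) z) :
    HasPartials e (fun w => ∑ k, G k w) (fun K => ∑ k, G' k K) z :=
  of_hasFDerivAt (HasFDerivAt.fun_sum fun k _ => (hG k).differentiableAt.hasFDerivAt) fun K => by
    simp [(hG _).fderiv_apply]

end Algebra

section Real

variable {f g : E → ℝ} {f' g' : κ → ℝ}

theorem mul (hf : HasPartials e f f' z) (hg : HasPartials e g g' z) :
    HasPartials e (fun w => f w * g w) (fun K => f' K * g z + f z * g' K) z :=
  hf.smul hg

theorem comp (hf : HasPartials e f f' z) {u : ℝ → ℝ} {u' : ℝ} (hu : HasDerivAt u u' (f z)) :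
    HasPartials e (fun w => u (f w)) (fun K => u' * f' K) z :=
  of_hasFDerivAt (hu.comp_hasFDerivAt z hf.differentiableAt.hasFDerivAt) fun K => by
    simp [hf.fderiv_apply]

theorem sq (hf : HasPartials e f f' z) :
    HasPartials e (fun w => f w ^ 2) (fun K => 2 * f z * f' K) z :=
  hf.comp (by simpa using hasDerivAt_pow 2 (f z))

end Real

section Matrix

variable [Fintype ι] {C : E → Matrix ι ι ℝ} {C' : κ → Matrix ι ι ℝ} {g h : E → ι → ℝ}
  {g' h' : κ → ι → ℝ}

theorem dotProduct (hg : HasPartials e g g' z) (hh : HasPartials e h h' z) :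
    HasPartials e (fun w => g w ⬝ᵥ h w) (fun K => g' K ⬝ᵥ h z + g z ⬝ᵥ h' K) z :=
  (sum fun i => (pi_iff.mp hg i).mul (pi_iff.mp hh i)).congr_partials fun _ =>
    Finset.sum_add_distrib

theorem mulVec (hC : HasPartials e C C' z) (hh : HasPartials e h h' z) :
    HasPartials e (fun w => C w *ᵥ h w) (fun K => C' K *ᵥ h z + C z *ᵥ h' K) z :=
  pi_iff.mpr fun i => (pi_iff.mpr fun j => matrix_iff.mp hC i j).dotProduct hh

end Matrix

end HasPartials

end Partials

section Divergence

variable {E : Type*} [NormedAddCommGroup E] [NormedSpace ℝ E] {ι : Type*} [Fintype ι]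
  {e : ι → E} {z : E}

/-- The divergence `∑ K, ∂(V K) / ∂(e K)` of the vector field with components `V K` in the
directions `e K`. -/
noncomputable def divAlong (e : ι → E) (V : E → ι → ℝ) (z : E) : ℝ :=
  ∑ K, fderiv ℝ (fun w => V w K) z (e K)

variable {σ θ φ Φ χ ρ : E → ℝ} {σ' Φ' : ι → ℝ} {ρ' : ℝ} {V W c g h u : E → ι → ℝ}
  {V' W' c' g' h' u' : ι → ι → ℝ} {C : E → Matrix ι ι ℝ} {C' : ι → Matrix ι ι ℝ}

theorem HasPartials.divAlong_eq (hV : HasPartials e V V' z) : divAlong e V z = ∑ K, V' K K :=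
  Finset.sum_congr rfl fun K _ => (pi_iff.mp hV K).fderiv_apply K

theorem divAlong_congr (h : V =ᶠ[nhds z] W) : divAlong e V z = divAlong e W z :=
  Finset.sum_congr rfl fun K _ => by
    rw [Filter.EventuallyEq.fderiv_eq (h.mono fun _ hw => congrFun hw K)]

theorem divAlong_sub (hV : HasPartials e V V' z) (hW : HasPartials e W W' z) :
    divAlong e (fun w => V w - W w) z = divAlong e V z - divAlong e W z := by
  rw [(hV.sub hW).divAlong_eq, hV.divAlong_eq, hW.divAlong_eq, ← Finset.sum_sub_distrib]
  rfl

theorem divAlong_add (hV : HasPartials e V V' z) (hW : HasPartials e W W' z) :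
    divAlong e (fun w => V w + W w) z = divAlong e V z + divAlong e W z := by
  rw [(hV.add hW).divAlong_eq, hV.divAlong_eq, hW.divAlong_eq, ← Finset.sum_add_distrib]
  rfl

theorem divAlong_smul (hσ : HasPartials e σ σ' z) (hV : HasPartials e V V' z) :
    divAlong e (fun w => σ w • V w) z = (∑ K, σ' K * V z K) + σ z * divAlong e V z := by
  rw [(hσ.smul hV).divAlong_eq, hV.divAlong_eq, Finset.mul_sum,
    ← Finset.sum_add_distrib]
  rfl

theorem divAlong_mulVec (hC : HasPartials e C C' z) (hh : HasPartials e h h' z) :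
    divAlong e (fun w => C w *ᵥ h w) z = ∑ K, (C' K *ᵥ h z) K + ∑ K, (C z *ᵥ h' K) K := by
  rw [(hC.mulVec hh).divAlong_eq, ← Finset.sum_add_distrib]
  rfl

theorem divAlong_neg (V : E → ι → ℝ) (z : E) : divAlong e (fun w => -V w) z = -divAlong e V z := by
  simp only [divAlong, Pi.neg_apply, fderiv_fun_neg, neg_apply, Finset.sum_neg_distrib]

theorem dotProduct_mulVec_comm {D : Matrix ι ι ℝ} (hD : D.IsSymm) (v w : ι → ℝ) :
    v ⬝ᵥ D *ᵥ w = w ⬝ᵥ D *ᵥ v := by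
  rw [Matrix.dotProduct_mulVec, ← Matrix.mulVec_transpose, hD.eq, dotProduct_comm]

/-- The flux `2 ⟨C g, h⟩ C h - (⟨C h, h⟩ - Ψ) C g`. With `h = ∇θ` it is the vector field along which
the product of `div (C ∇θ)` and the multiplier `2 ⟨C g, ∇θ⟩` is integrated by parts. -/
noncomputable def energyFlux (C : Matrix ι ι ℝ) (g h : ι → ℝ) (Ψ : ℝ) : ι → ℝ :=
  (2 * (g ⬝ᵥ C *ᵥ h)) • C *ᵥ h - (h ⬝ᵥ C *ᵥ h - Ψ) • C *ᵥ g

theorem HasPartials.energyFlux {Ψ : E → ℝ} {Ψ' : ι → ℝ} (hC : HasPartials e C C' z)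
    (hg : HasPartials e g g' z) (hh : HasPartials e h h' z) (hΨ : HasPartials e Ψ Ψ' z) :
    ∃ V', HasPartials e (fun w => energyFlux (C w) (g w) (h w) (Ψ w)) V' z :=
  ⟨_, (((HasPartials.const 2).mul (hg.dotProduct (hC.mulVec hh))).smul (hC.mulVec hh)).sub
    (((hh.dotProduct (hC.mulVec hh)).sub hΨ).smul (hC.mulVec hg))⟩

theorem sum_dotProduct_mulVec_mul_mulVec {D : Matrix ι ι ℝ} (hD : D.IsSymm) {H : ι → ι → ℝ}
    (hH : ∀ i j, H i j = H j i) (v w : ι → ℝ) :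
    ∑ K, (v ⬝ᵥ D *ᵥ H K) * (D *ᵥ w) K = ∑ K, (w ⬝ᵥ D *ᵥ H K) * (D *ᵥ v) K := by
  have hflip : ∀ x K, x ⬝ᵥ D *ᵥ H K = ∑ L, (D *ᵥ x) L * H K L := fun x K => by
    rw [dotProduct_mulVec_comm hD, dotProduct_comm]; rfl
  simp only [hflip, Finset.sum_mul]
  rw [Finset.sum_comm]
  exact Finset.sum_congr rfl fun K _ => Finset.sum_congr rfl fun L _ => by rw [hH]; ring

theorem divAlong_energyFlux (hC : HasPartials e C C' z) (hg : HasPartials e g g' z)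
    (hh : HasPartials e h h' z) (hΦ : HasPartials e Φ Φ' z)
    (hθ : HasPartials e θ (h z) z) (hCs : (C z).IsSymm) (hhs : ∀ i j, h' i j = h' j i) :
    divAlong e (fun w => energyFlux (C w) (g w) (h w) (Φ w * θ w ^ 2)) z
      = 2 * (g z ⬝ᵥ C z *ᵥ h z)
            * ((∑ K, (C z *ᵥ h' K) K) + Φ z * θ z + ∑ K, (C' K *ᵥ h z) K)
        + 2 * ∑ K, (g z ⬝ᵥ C' K *ᵥ h z) * (C z *ᵥ h z) K
        + 2 * ∑ K, (g' K ⬝ᵥ C z *ᵥ h z) * (C z *ᵥ h z) K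
        - divAlong e (fun w => C w *ᵥ g w) z * (h z ⬝ᵥ C z *ᵥ h z - Φ z * θ z ^ 2)
        - (∑ K, (h z ⬝ᵥ C' K *ᵥ h z) * (C z *ᵥ g z) K)
        + (∑ K, Φ' K * (C z *ᵥ g z) K) * θ z ^ 2 := by
  have hCh := hC.mulVec hh
  have hN := (HasPartials.const 2).mul (hg.dotProduct hCh)
  have hS := (hh.dotProduct hCh).sub (hΦ.mul hθ.sq)
  simp only [energyFlux]
  rw [divAlong_sub (hN.smul hCh) (hS.smul (hC.mulVec hg)), divAlong_smul hN hCh,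
    divAlong_smul hS (hC.mulVec hg), divAlong_mulVec hC hh]
  have hcancel := sum_dotProduct_mulVec_mul_mulVec hCs hhs (g z) (h z)
  have hθ_flux : ∑ K, h z K * (C z *ᵥ g z) K = g z ⬝ᵥ C z *ᵥ h z :=
    dotProduct_mulVec_comm hCs _ _
  have hgrad_N : ∑ K, (0 * (g z ⬝ᵥ C z *ᵥ h z)
        + 2 * (g' K ⬝ᵥ C z *ᵥ h z + g z ⬝ᵥ (C' K *ᵥ h z + C z *ᵥ h' K))) * (C z *ᵥ h z) K
      = 2 * (∑ K, (g' K ⬝ᵥ C z *ᵥ h z) * (C z *ᵥ h z) K)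
        + 2 * (∑ K, (g z ⬝ᵥ C' K *ᵥ h z) * (C z *ᵥ h z) K)
        + 2 * ∑ K, (g z ⬝ᵥ C z *ᵥ h' K) * (C z *ᵥ h z) K := by
    simp only [Finset.mul_sum, ← Finset.sum_add_distrib, dotProduct_add]
    exact Finset.sum_congr rfl fun K _ => by ring
  have hgrad_S : ∑ K, (h' K ⬝ᵥ C z *ᵥ h z + h z ⬝ᵥ (C' K *ᵥ h z + C z *ᵥ h' K)
        - (Φ' K * θ z ^ 2 + Φ z * (2 * θ z * h z K))) * (C z *ᵥ g z) K
      = 2 * (∑ K, (h z ⬝ᵥ C z *ᵥ h' K) * (C z *ᵥ g z) K)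
        + (∑ K, (h z ⬝ᵥ C' K *ᵥ h z) * (C z *ᵥ g z) K)
        - (∑ K, Φ' K * (C z *ᵥ g z) K) * θ z ^ 2
        - 2 * Φ z * θ z * ∑ K, h z K * (C z *ᵥ g z) K := by
    simp only [Finset.mul_sum, Finset.sum_mul, ← Finset.sum_add_distrib,
      ← Finset.sum_sub_distrib, dotProduct_add]
    exact Finset.sum_congr rfl fun K _ => by
      rw [dotProduct_mulVec_comm hCs (h' K)]; ring
  rw [hgrad_N, hgrad_S, hcancel, hθ_flux]
  ring

theorem divAlong_smul_sq (hV : HasPartials e V V' z) (hθ : HasPartials e θ (h z) z)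
    (hρ : HasPartials e ρ (fun K => ρ' * g z K) z) :
    divAlong e (fun w => (ρ w * θ w ^ 2) • V w) z
      = (ρ z * divAlong e V z + ρ' * (g z ⬝ᵥ V z)) * θ z ^ 2
        + 2 * ρ z * θ z * (h z ⬝ᵥ V z) := by
  rw [divAlong_smul (hρ.mul hθ.sq) hV]
  simp only [dotProduct, Finset.mul_sum, Finset.sum_mul, add_mul, Finset.sum_add_distrib]
  have hρ_term : ∑ K, ρ' * g z K * θ z ^ 2 * V z K = ∑ K, ρ' * (g z K * V z K) * θ z ^ 2 :=
    Finset.sum_congr rfl fun K _ => by ring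
  have hθ_term : ∑ K, ρ z * (2 * θ z * h z K) * V z K
      = ∑ K, 2 * ρ z * θ z * (h z K * V z K) := Finset.sum_congr rfl fun K _ => by ring
  rw [hρ_term, hθ_term]
  ring

/-- The flux `χ² (φ C u + ρ φ² C g - ½ φ² c)`. With `u = ∇φ`, `∇χ = -ρ χ g` and `c` the row
divergences of `C`, it is the vector field along which the product of `div (C ∇φ) - ⟨c, ∇φ⟩` and the
multiplier `φ χ²` is integrated by parts. -/
noncomputable def multiplierFlux (C : Matrix ι ι ℝ) (c g u : ι → ℝ) (ρ φ χ : ℝ) : ι → ℝ :=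
  χ ^ 2 • (φ • C *ᵥ u + (ρ * φ ^ 2) • C *ᵥ g - (1 / 2 * φ ^ 2) • c)

theorem divAlong_multiplierFlux (hC : HasPartials e C C' z) (hc : HasPartials e c c' z)
    (hg : HasPartials e g g' z) (hu : HasPartials e u u' z) (hφ : HasPartials e φ (u z) z)
    (hχ : HasPartials e χ (fun K => -(ρ z * χ z * g z K)) z)
    (hρ : HasPartials e ρ (fun K => ρ' * g z K) z) (hCs : (C z).IsSymm)
    (hcC : c z ⬝ᵥ u z = ∑ K, (C' K *ᵥ u z) K) :
    divAlong e (fun w => multiplierFlux (C w) (c w) (g w) (u w) (ρ w) (φ w) (χ w)) z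
      = χ z ^ 2 * (φ z * (∑ K, (C z *ᵥ u' K) K) + u z ⬝ᵥ C z *ᵥ u z)
        + (χ z * φ z) ^ 2 * (-(1 / 2) * divAlong e c z + ρ z * (g z ⬝ᵥ c z)
          + ρ z * divAlong e (fun w => C w *ᵥ g w) z
          + (ρ' - 2 * ρ z ^ 2) * (g z ⬝ᵥ C z *ᵥ g z)) := by
  have hCu := hC.mulVec hu
  have hCg := hC.mulVec hg
  have hρφ := hρ.mul hφ.sq
  have hφ2 := (HasPartials.const (1 / 2 : ℝ)).mul hφ.sq
  have hflux := ((hφ.smul hCu).add (hρφ.smul hCg)).sub (hφ2.smul hc)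
  simp only [multiplierFlux]
  rw [divAlong_smul hχ.sq hflux, divAlong_sub ((hφ.smul hCu).add (hρφ.smul hCg)) (hφ2.smul hc),
    divAlong_add (hφ.smul hCu) (hρφ.smul hCg), divAlong_smul hφ hCu, divAlong_smul hρφ hCg,
    divAlong_smul hφ2 hc, divAlong_mulVec hC hu, ← hcC]
  have hgrad_χ : ∑ K, 2 * χ z * -(ρ z * χ z * g z K)
        * (φ z • C z *ᵥ u z + (ρ z * φ z ^ 2) • C z *ᵥ g z - (1 / 2 * φ z ^ 2) • c z) K
      = -2 * ρ z * χ z ^ 2 * (φ z * (g z ⬝ᵥ C z *ᵥ u z) + ρ z * φ z ^ 2 * (g z ⬝ᵥ C z *ᵥ g z)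
          - 1 / 2 * φ z ^ 2 * (g z ⬝ᵥ c z)) := by
    simp only [dotProduct, Finset.mul_sum, ← Finset.sum_add_distrib, ← Finset.sum_sub_distrib]
    exact Finset.sum_congr rfl fun K _ => by
      simp only [Pi.add_apply, Pi.sub_apply, Pi.smul_apply, smul_eq_mul]; ring
  have hgrad_φ : ∑ K, u z K * (C z *ᵥ u z) K = u z ⬝ᵥ C z *ᵥ u z := rfl
  have hgrad_ρφ : ∑ K, (ρ' * g z K * φ z ^ 2 + ρ z * (2 * φ z * u z K)) * (C z *ᵥ g z) K
      = ρ' * φ z ^ 2 * (g z ⬝ᵥ C z *ᵥ g z) + 2 * ρ z * φ z * (g z ⬝ᵥ C z *ᵥ u z) := by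
    rw [dotProduct_mulVec_comm hCs (g z) (u z)]
    simp only [dotProduct, Finset.mul_sum, ← Finset.sum_add_distrib]
    exact Finset.sum_congr rfl fun K _ => by ring
  have hgrad_φ2 : ∑ K, (0 * φ z ^ 2 + 1 / 2 * (2 * φ z * u z K)) * c z K
      = φ z * (c z ⬝ᵥ u z) := by
    simp only [dotProduct, Finset.mul_sum]
    exact Finset.sum_congr rfl fun K _ => by ring
  rw [hgrad_χ, hgrad_φ, hgrad_ρφ, hgrad_φ2]
  ring

end Divergence

/-! ### Coordinates and the weight -/

section Block

/-- The index set of the coordinates `x₁, …, xₙ, y₁, …, y_m` of `ℝⁿ × ℝᵐ`. -/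
abbrev Idx (p q : ℕ) : Type := Fin (p + 1) ⊕ Fin (q + 1)

/-- The coordinate directions of `ℝⁿ × ℝᵐ`. -/
def dir : Idx p q → Pt (p + 1) (q + 1) :=
  Sum.elim (fun i => (Pi.single i 1, 0)) (fun j => (0, Pi.single j 1))

theorem forall_idx {C : Idx p q → Prop} (zero : C (.inl 0)) (succ : ∀ r : Fin p, C (.inl r.succ))
    (inr : ∀ k, C (.inr k)) (K : Idx p q) : C K :=
  K.rec (Fin.cases zero succ) inr

theorem sum_idx (f : Idx p q → ℝ) :
    ∑ K, f K = f (.inl 0) + ∑ r : Fin p, f (.inl r.succ) + ∑ k, f (.inr k) := by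
  rw [Fintype.sum_sum_type, Fin.sum_univ_succ]

theorem divergence_eq_divAlong (F : Fin (p + 1) → Pt (p + 1) (q + 1) → ℝ)
    (G : Fin (q + 1) → Pt (p + 1) (q + 1) → ℝ) (z : Pt (p + 1) (q + 1)) :
    divergence F G z = divAlong dir (fun w K => Sum.elim F G K w) z := by
  rw [divAlong, Fintype.sum_sum_type]; rfl

/-- The vector of `ℝⁿ × ℝᵐ` with components `a`, `x`, `y` in `ℝ × ℝⁿ⁻¹ × ℝᵐ`. -/
def vec (a : ℝ) (x : Fin p → ℝ) (y : Fin (q + 1) → ℝ) : Idx p q → ℝ :=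
  Sum.elim (Fin.cons a x) y

section Vec

variable (a b : ℝ) (x u : Fin p → ℝ) (y v : Fin (q + 1) → ℝ)

@[simp] theorem vec_zero : vec a x y (.inl 0) = a := rfl

@[simp] theorem vec_succ (r : Fin p) : vec a x y (.inl r.succ) = x r := rfl

@[simp] theorem vec_inr (k : Fin (q + 1)) : vec a x y (.inr k) = y k := rfl

theorem vec_dotProduct_vec : vec a x y ⬝ᵥ vec b u v = a * b + x ⬝ᵥ u + y ⬝ᵥ v :=
  sum_idx _

end Vec

/-- The block diagonal matrix with blocks `a`, `b I` and `B` acting on `ℝ × ℝⁿ⁻¹ × ℝᵐ`. -/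
def blockMatrix (a b : ℝ) (B : Matrix (Fin (q + 1)) (Fin (q + 1)) ℝ) :
    Matrix (Idx p q) (Idx p q) ℝ :=
  Matrix.fromBlocks (Matrix.diagonal (Fin.cons a fun _ => b)) 0 0 B

theorem blockMatrix_mulVec_vec (a b : ℝ) (B : Matrix (Fin (q + 1)) (Fin (q + 1)) ℝ) (ξ : ℝ)
    (u : Fin p → ℝ) (v : Fin (q + 1) → ℝ) :
    blockMatrix a b B *ᵥ vec ξ u v = vec (a * ξ) (b • u) (B *ᵥ v) := by
  simp only [blockMatrix, vec, Matrix.fromBlocks_mulVec, Matrix.zero_mulVec, add_zero, zero_add]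
  congr 1
  exact funext (Fin.cases (by simp [Matrix.mulVec_diagonal]) (by simp [Matrix.mulVec_diagonal]))

theorem blockMatrix_isSymm {a b : ℝ} {B : Matrix (Fin (q + 1)) (Fin (q + 1)) ℝ} (hB : B.IsSymm) :
    (blockMatrix a b B : Matrix (Idx p q) (Idx p q) ℝ).IsSymm :=
  Matrix.IsSymm.fromBlocks (Matrix.isSymm_diagonal _) Matrix.transpose_zero hB

variable {z : Pt (p + 1) (q + 1)}

theorem HasPartials.vec {κ : Type*} {e : κ → Pt (p + 1) (q + 1)} {a : Pt (p + 1) (q + 1) → ℝ}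
    {x : Pt (p + 1) (q + 1) → Fin p → ℝ} {y : Pt (p + 1) (q + 1) → Fin (q + 1) → ℝ} {a' : κ → ℝ}
    {x' : κ → Fin p → ℝ} {y' : κ → Fin (q + 1) → ℝ} (ha : HasPartials e a a' z)
    (hx : HasPartials e x x' z) (hy : HasPartials e y y' z) :
    HasPartials e (fun w => UltraCarleman.vec (a w) (x w) (y w))
      (fun K => UltraCarleman.vec (a' K) (x' K) (y' K)) z :=
  pi_iff.mpr (forall_idx ha (pi_iff.mp hx) (pi_iff.mp hy))

theorem HasPartials.blockMatrix {κ : Type*} {e : κ → Pt (p + 1) (q + 1)}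
    {a b : Pt (p + 1) (q + 1) → ℝ} {B : Pt (p + 1) (q + 1) → Matrix (Fin (q + 1)) (Fin (q + 1)) ℝ}
    {a' b' : κ → ℝ} {B' : κ → Matrix (Fin (q + 1)) (Fin (q + 1)) ℝ}
    (ha : HasPartials e a a' z) (hb : HasPartials e b b' z) (hB : HasPartials e B B' z) :
    HasPartials e (fun w => (UltraCarleman.blockMatrix (a w) (b w) (B w) :
        Matrix (Idx p q) (Idx p q) ℝ))
      (fun K => UltraCarleman.blockMatrix (a' K) (b' K) (B' K)) z := by
  rw [matrix_iff]
  rintro (i | i) (j | j)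
  · rcases eq_or_ne i j with rfl | hij
    · simp only [UltraCarleman.blockMatrix, Matrix.fromBlocks_apply₁₁, Matrix.diagonal_apply_eq]
      exact Fin.cases ha (fun _ => hb) i
    · simp only [UltraCarleman.blockMatrix, Matrix.fromBlocks_apply₁₁,
        Matrix.diagonal_apply_ne _ hij]
      exact const 0
  · exact const 0
  · exact const 0
  · exact matrix_iff.mp hB i j

theorem hasPartials_fst :
    HasPartials dir (Prod.fst : Pt (p + 1) (q + 1) → _) (fun K => (dir K).1) z :=
  .of_hasFDerivAt hasFDerivAt_fst fun _ => rfl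

theorem hasPartials_snd :
    HasPartials dir (Prod.snd : Pt (p + 1) (q + 1) → _) (fun K => (dir K).2) z :=
  .of_hasFDerivAt hasFDerivAt_snd fun _ => rfl

end Block

section Partials

variable {z : Pt (p + 1) (q + 1)}

/-- The partial derivatives of `θ`, i.e. its gradient. -/
noncomputable def gradient (θ : Pt (p + 1) (q + 1) → ℝ) (z : Pt (p + 1) (q + 1)) : Idx p q → ℝ :=
  fun K => fderiv ℝ θ z (dir K)

/-- The second partial derivatives of `θ`; row `K` is the gradient of `∂θ` differentiated in the
direction `K`. -/
noncomputable def hessian (θ : Pt (p + 1) (q + 1) → ℝ) (z : Pt (p + 1) (q + 1)) :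
    Idx p q → Idx p q → ℝ :=
  fun K L => fderiv ℝ (fun w => gradient θ w L) z (dir K)

theorem gradient_eq_vec (θ : Pt (p + 1) (q + 1) → ℝ) (z : Pt (p + 1) (q + 1)) :
    gradient θ z = vec (dx 0 θ z) (fun r => dx r.succ θ z) (fun k => dy k θ z) :=
  funext (forall_idx rfl (fun _ => rfl) fun _ => rfl)

theorem hasPartials_gradient {θ : Pt (p + 1) (q + 1) → ℝ} (hθ : DifferentiableAt ℝ θ z) :
    HasPartials dir θ (gradient θ z) z :=
  .of_differentiableAt dir hθ

theorem differentiableAt_fderiv_apply {E : Type*} [NormedAddCommGroup E] [NormedSpace ℝ E]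
    {f : E → ℝ} {z : E} (hf : ContDiffAt ℝ 2 f z) (d : E) :
    DifferentiableAt ℝ (fun w => fderiv ℝ f w d) z :=
  ((hf.fderiv_right (m := 1) (by norm_num)).differentiableAt one_ne_zero).clm_apply
    (differentiableAt_const d)

theorem hasPartials_hessian {θ : Pt (p + 1) (q + 1) → ℝ} (hθ : ContDiffAt ℝ 2 θ z) :
    HasPartials dir (gradient θ) (hessian θ z) z :=
  HasPartials.pi_iff.mpr fun _ => .of_differentiableAt dir (differentiableAt_fderiv_apply hθ _)

theorem fderiv_fderiv_comm {E : Type*} [NormedAddCommGroup E] [NormedSpace ℝ E] {θ : E → ℝ}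
    {z : E} (hθ : ContDiffAt ℝ 2 θ z) (u v : E) :
    fderiv ℝ (fun w => fderiv ℝ θ w u) z v = fderiv ℝ (fun w => fderiv ℝ θ w v) z u := by
  have hd := (hθ.fderiv_right (m := 1) (by norm_num)).differentiableAt (by norm_num)
  rw [fderiv_clm_apply hd (differentiableAt_const _),
    fderiv_clm_apply hd (differentiableAt_const _)]
  simpa using (hθ.isSymmSndFDerivAt (by simp)).eq v u

theorem hessian_comm {θ : Pt (p + 1) (q + 1) → ℝ} (hθ : ContDiffAt ℝ 2 θ z) (K L : Idx p q) :
    hessian θ z K L = hessian θ z L K :=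
  fderiv_fderiv_comm hθ _ _

/-- The values at `z` of the coefficients, as a matrix. -/
def coeffMatrix (A : Fin (q + 1) → Fin (q + 1) → Pt (p + 1) (q + 1) → ℝ)
    (z : Pt (p + 1) (q + 1)) : Matrix (Fin (q + 1)) (Fin (q + 1)) ℝ :=
  Matrix.of fun i j => A i j z

/-- The partial derivatives at `z` of the coefficients, one matrix for each direction. -/
noncomputable def coeffPartials (A : Fin (q + 1) → Fin (q + 1) → Pt (p + 1) (q + 1) → ℝ)
    (z : Pt (p + 1) (q + 1)) (K : Idx p q) : Matrix (Fin (q + 1)) (Fin (q + 1)) ℝ :=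
  Matrix.of fun i j => fderiv ℝ (A i j) z (dir K)

variable {A : Fin (q + 1) → Fin (q + 1) → Pt (p + 1) (q + 1) → ℝ}

theorem hasPartials_coeffMatrix (hA : ∀ i j, DifferentiableAt ℝ (A i j) z) :
    HasPartials dir (coeffMatrix A) (coeffPartials A z) z :=
  HasPartials.matrix_iff.mpr fun i j => .of_differentiableAt dir (hA i j)

theorem coeffMatrix_isSymm (hA : ∀ i j, A i j = A j i) (z : Pt (p + 1) (q + 1)) :
    (coeffMatrix A z).IsSymm :=
  Matrix.IsSymm.ext fun i j => congrFun (hA j i) z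

theorem dotProduct_coeffMatrix_mulVec (g h : Fin (q + 1) → ℝ) :
    ∑ i, ∑ j, A i j z * g i * h j = g ⬝ᵥ coeffMatrix A z *ᵥ h := by
  simp only [dotProduct, Matrix.mulVec, Finset.mul_sum, coeffMatrix, Matrix.of_apply]
  exact Finset.sum_congr rfl fun i _ => Finset.sum_congr rfl fun j _ => by ring

end Partials

section Weight

/-- The gradient of `ψ` in the variables `x₂, …, xₙ`. -/
def Params.gradX (P : Params p q) (z : Pt (p + 1) (q + 1)) : Fin p → ℝ :=
  fun r => z.1 r.succ - P.x₀ r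

/-- The gradient of `ψ` in the variables `y₁, …, y_m`. -/
def Params.gradY (P : Params p q) (z : Pt (p + 1) (q + 1)) : Fin (q + 1) → ℝ :=
  z.2 - Fin.snoc P.y₀ 0

/-- The gradient of `ψ`. -/
def Params.grad (P : Params p q) (z : Pt (p + 1) (q + 1)) : Idx p q → ℝ :=
  vec P.δ (P.gradX z) (P.gradY z)

/-- The Hessian of `ψ`; it is constant. -/
def hessPsi (K : Idx p q) : Idx p q → ℝ :=
  vec 0 (fun r => (dir K).1 r.succ) (dir K).2

theorem hessPsi_zero : (hessPsi (.inl 0) : Idx p q → ℝ) = vec 0 0 0 := by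
  simp [hessPsi, dir, Pi.zero_def]

theorem hessPsi_succ (r : Fin p) :
    (hessPsi (.inl r.succ) : Idx p q → ℝ) = vec 0 (Pi.single r 1) 0 := by
  refine congrArg (fun x => vec 0 x 0) (funext fun r' => ?_)
  simp [dir, Pi.single_apply]

theorem hessPsi_inr (k : Fin (q + 1)) :
    (hessPsi (.inr k) : Idx p q → ℝ) = vec 0 0 (Pi.single k 1) := rfl

variable (P : Params p q) (z : Pt (p + 1) (q + 1))

theorem Params.psi_eq :
    P.psi z = P.δ * z.1 0 + 1 / 2 * (P.gradX z ⬝ᵥ P.gradX z + P.gradY z ⬝ᵥ P.gradY z)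
      + P.α₀ := by
  simp only [Params.psi, Params.psi₀, Params.gradX, Params.gradY, dotProduct,
    Fin.sum_univ_castSucc, Pi.sub_apply, Fin.snoc_castSucc, Fin.snoc_last, sub_zero, sq]
  ring

theorem Params.hasPartials_gradX :
    HasPartials dir P.gradX (fun K r => (dir K).1 r.succ) z :=
  HasPartials.pi_iff.mpr fun r =>
    ((HasPartials.pi_iff.mp hasPartials_fst r.succ).sub (.const (P.x₀ r))).congr_partials
      fun _ => sub_zero _

theorem Params.hasPartials_gradY : HasPartials dir P.gradY (fun K => (dir K).2) z :=
  (hasPartials_snd.sub (.const (Fin.snoc P.y₀ 0))).congr_partials fun _ => sub_zero _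

theorem Params.hasPartials_grad : HasPartials dir P.grad hessPsi z :=
  (HasPartials.const P.δ).vec (P.hasPartials_gradX z) (P.hasPartials_gradY z)

theorem Params.hasPartials_psi : HasPartials dir P.psi (P.grad z) z := by
  rw [funext P.psi_eq]
  have hX := P.hasPartials_gradX z
  have hY := P.hasPartials_gradY z
  have hψ := (((HasPartials.const P.δ).mul (HasPartials.pi_iff.mp (hasPartials_fst (z := z)) 0)).add
    ((HasPartials.const (1 / 2)).mul ((hX.dotProduct hX).add (hY.dotProduct hY)))).add
    (HasPartials.const P.α₀)
  refine hψ.congr_partials (forall_idx ?_ (fun r => ?_) fun k => ?_)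
  · simp [Params.grad, dir, dotProduct]
  · simp [Params.grad, dir, dotProduct, Pi.single_apply]; ring
  · simp [Params.grad, dir, dotProduct, Pi.single_apply]; ring

theorem Params.dx_succ_psi (r : Fin p) : dx r.succ P.psi z = P.gradX z r :=
  (P.hasPartials_psi z).fderiv_apply (.inl r.succ)

theorem Params.dy_psi (k : Fin (q + 1)) : dy k P.psi z = P.gradY z k :=
  (P.hasPartials_psi z).fderiv_apply (.inr k)

theorem Params.hasPartials_s : HasPartials dir P.s (vec 1 0 0) z := by
  refine ((HasPartials.pi_iff.mp (hasPartials_fst (z := z)) 0).add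
    (.const P.eta₀)).congr_partials (forall_idx ?_ (fun r => ?_) fun k => ?_) <;> simp [dir]

/-- The function `λ ν ψ^{-ν-1}`, so that `∇χ = -λ ν ψ^{-ν-1} χ ∇ψ`. -/
noncomputable def Params.slope (lam : ℝ) (z : Pt (p + 1) (q + 1)) : ℝ :=
  lam * P.ν * P.psi z ^ (-P.ν - 1)

variable {P} {z} {lam : ℝ}

theorem eventually_psi_pos (h : 0 < P.psi z) : ∀ᶠ v in nhds z, 0 < P.psi v :=
  (P.hasPartials_psi z).differentiableAt.continuousAt.eventually_const_lt h

theorem eventually_s_pos (h : 0 < P.s z) : ∀ᶠ v in nhds z, 0 < P.s v :=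
  (P.hasPartials_s z).differentiableAt.continuousAt.eventually_const_lt h

theorem Params.hasPartials_slope (h : 0 < P.psi z) :
    HasPartials dir (P.slope lam)
      (fun K => -(P.ν + 1) * P.slope lam z / P.psi z * P.grad z K) z := by
  have hslope := (P.hasPartials_psi z).comp
    ((Real.hasDerivAt_rpow_const (p := -P.ν - 1) (Or.inl h.ne')).const_mul (lam * P.ν))
  refine hslope.congr_partials fun K => ?_
  rw [Real.rpow_sub_one h.ne', Params.slope]; ring

theorem Params.hasPartials_chi (h : 0 < P.psi z) :
    HasPartials dir (P.chi lam) (fun K => -(P.slope lam z * P.chi lam z * P.grad z K)) z := by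
  have hchi := (P.hasPartials_psi z).comp
    (((Real.hasDerivAt_rpow_const (p := -P.ν) (Or.inl h.ne')).const_mul lam).exp)
  refine hchi.congr_partials fun K => ?_
  rw [Params.slope, Params.chi]; ring

theorem phi₁_eq (h : 0 < P.psi z) :
    phi₁ P lam z = P.slope lam z ^ 2 - (P.ν + 1) * P.slope lam z / P.psi z := by
  rw [phi₁, Params.slope,
    show -2 * P.ν - 2 = (-P.ν - 1) * (2 : ℕ) by push_cast; ring, Real.rpow_mul_natCast h.le,
    show -P.ν - 2 = -P.ν - 1 - 1 by ring, Real.rpow_sub_one h.ne' (-P.ν - 1)]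
  ring

end Weight

/-! ### The principal part -/

section PrincipalPart

/-- The derivative along `(0, -f, B g)` of a function with gradient `c`; up to the factor `-s²` this
is the part tangential to `x₁ = const` of the derivative along the principal part of `s L₀` applied
to `(η, f, g)`. -/
def tangential (B : Matrix (Fin (q + 1)) (Fin (q + 1)) ℝ) (f : Fin p → ℝ) (g : Fin (q + 1) → ℝ)
    (c : Idx p q → ℝ) : ℝ :=
  (∑ k, c (.inr k) * (B *ᵥ g) k) - ∑ r, c (.inl r.succ) * f r

/-- The divergences of the rows of the coefficient matrix. -/
noncomputable def rowDiv (A : Fin (q + 1) → Fin (q + 1) → Pt (p + 1) (q + 1) → ℝ)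
    (z : Pt (p + 1) (q + 1)) : Fin (q + 1) → ℝ :=
  fun k => ∑ j, dy j (A k j) z

theorem eq_vec (h : Idx p q → ℝ) :
    h = vec (h (.inl 0)) (fun r => h (.inl r.succ)) (fun k => h (.inr k)) :=
  funext (forall_idx rfl (fun _ => rfl) fun _ => rfl)

theorem sum_hessPsi_dotProduct_mul (a b : ℝ) (x u : Fin p → ℝ) (y v : Fin (q + 1) → ℝ) :
    ∑ K, (hessPsi K ⬝ᵥ vec a x y) * vec b u v K = x ⬝ᵥ u + y ⬝ᵥ v := by
  simp only [sum_idx, hessPsi_zero, hessPsi_succ, hessPsi_inr, vec_dotProduct_vec, vec_zero,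
    vec_succ, vec_inr, zero_dotProduct, single_one_dotProduct, zero_mul, zero_add, add_zero]
  rfl

variable (P : Params p q) (A : Fin (q + 1) → Fin (q + 1) → Pt (p + 1) (q + 1) → ℝ)
  (z : Pt (p + 1) (q + 1))

/-- The coefficient matrix of the principal part of `s L₀`. -/
noncomputable def Params.prin : Matrix (Idx p q) (Idx p q) ℝ :=
  blockMatrix 1 (P.s z ^ 2) (-(P.s z ^ 2 • coeffMatrix A z))

/-- The partial derivatives of `Params.prin`. -/
noncomputable def Params.prinPartials (K : Idx p q) : Matrix (Idx p q) (Idx p q) ℝ :=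
  blockMatrix 0 (2 * P.s z * vec 1 0 0 K)
    (-((2 * P.s z * vec 1 0 0 K) • coeffMatrix A z + P.s z ^ 2 • coeffPartials A z K))

variable {A z}

theorem Params.hasPartials_prin (hA : ∀ i j, DifferentiableAt ℝ (A i j) z) :
    HasPartials dir (P.prin A) (P.prinPartials A z) z :=
  (HasPartials.const 1).blockMatrix (P.hasPartials_s z).sq
    ((P.hasPartials_s z).sq.smul (hasPartials_coeffMatrix hA)).neg

theorem Params.prin_isSymm (hAs : ∀ i j, A i j = A j i) : (P.prin A z).IsSymm :=
  blockMatrix_isSymm ((coeffMatrix_isSymm hAs z).smul _).neg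

variable (A z) (a ξ η t : ℝ) (x u f : Fin p → ℝ) (y v g : Fin (q + 1) → ℝ)

theorem Params.prin_mulVec_vec :
    P.prin A z *ᵥ vec ξ u v
      = vec ξ (P.s z ^ 2 • u) (-(P.s z ^ 2 • coeffMatrix A z *ᵥ v)) := by
  rw [Params.prin, blockMatrix_mulVec_vec, one_mul, Matrix.neg_mulVec, Matrix.smul_mulVec]

theorem Params.vec_dotProduct_prin_mulVec_vec :
    vec a x y ⬝ᵥ P.prin A z *ᵥ vec ξ u v
      = a * ξ + P.s z ^ 2 * (x ⬝ᵥ u - y ⬝ᵥ coeffMatrix A z *ᵥ v) := by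
  rw [Params.prin_mulVec_vec, vec_dotProduct_vec, dotProduct_smul, dotProduct_neg,
    dotProduct_smul, smul_eq_mul, smul_eq_mul]
  ring

theorem Params.vec_dotProduct_prinPartials_mulVec_vec (K : Idx p q) :
    vec a x y ⬝ᵥ P.prinPartials A z K *ᵥ vec ξ u v
      = 2 * P.s z * vec 1 0 0 K * (x ⬝ᵥ u - y ⬝ᵥ coeffMatrix A z *ᵥ v)
        - P.s z ^ 2 * (y ⬝ᵥ coeffPartials A z K *ᵥ v) := by
  rw [Params.prinPartials, blockMatrix_mulVec_vec, vec_dotProduct_vec]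
  simp only [Matrix.neg_mulVec, Matrix.add_mulVec, Matrix.smul_mulVec, dotProduct_neg,
    dotProduct_add, dotProduct_smul, smul_eq_mul]
  ring

theorem Params.sum_sub_mul_prin_mulVec (c : Idx p q → ℝ) :
    ∑ K, (2 * P.s z * vec 1 0 0 K * t - P.s z ^ 2 * c K) * (P.prin A z *ᵥ vec η f g) K
      = (2 * P.s z * t - P.s z ^ 2 * c (.inl 0)) * η
        + P.s z ^ 4 * tangential (coeffMatrix A z) f g c := by
  have hx : ∑ r : Fin p, (2 * P.s z * 0 * t - P.s z ^ 2 * c (.inl r.succ)) * (P.s z ^ 2 * f r)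
      = -(P.s z ^ 4 * ∑ r : Fin p, c (.inl r.succ) * f r) := by
    rw [Finset.mul_sum, ← Finset.sum_neg_distrib]
    exact Finset.sum_congr rfl fun r _ => by ring
  have hy : ∑ k, (2 * P.s z * 0 * t - P.s z ^ 2 * c (.inr k))
        * -(P.s z ^ 2 * (coeffMatrix A z *ᵥ g) k)
      = P.s z ^ 4 * ∑ k, c (.inr k) * (coeffMatrix A z *ᵥ g) k := by
    rw [Finset.mul_sum]
    exact Finset.sum_congr rfl fun k _ => by ring
  simp only [Params.prin_mulVec_vec, sum_idx, vec_zero, vec_succ, vec_inr, tangential,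
    Pi.smul_apply, Pi.neg_apply, Pi.zero_apply, smul_eq_mul, hx, hy]
  ring

theorem Params.sum_hessPsi_dotProduct_prin_mul_prin :
    ∑ K, (hessPsi K ⬝ᵥ P.prin A z *ᵥ vec ξ u v) * (P.prin A z *ᵥ vec ξ u v) K
      = P.s z ^ 4
        * (u ⬝ᵥ u + (coeffMatrix A z *ᵥ v) ⬝ᵥ (coeffMatrix A z *ᵥ v)) := by
  simp only [Params.prin_mulVec_vec, sum_hessPsi_dotProduct_mul, neg_dotProduct_neg,
    smul_dotProduct, dotProduct_smul, smul_eq_mul]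
  ring

variable {A z} in
theorem Params.sum_prinPartials_mulVec (hAs : ∀ i j, A i j = A j i) :
    ∑ K, (P.prinPartials A z K *ᵥ vec ξ u v) K = -(P.s z ^ 2 * (v ⬝ᵥ rowDiv A z)) := by
  have hrow : ∑ k, (coeffPartials A z (.inr k) *ᵥ v) k = v ⬝ᵥ rowDiv A z := by
    simp only [dotProduct, Matrix.mulVec, rowDiv, Finset.mul_sum]
    rw [Finset.sum_comm]
    exact Finset.sum_congr rfl fun j _ => Finset.sum_congr rfl fun k _ => by
      rw [hAs j k, mul_comm]; rfl
  simp only [Params.prinPartials, blockMatrix_mulVec_vec, sum_idx, vec_zero, vec_succ, vec_inr,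
    Matrix.neg_mulVec, Matrix.add_mulVec, Matrix.smul_mulVec, Pi.neg_apply, Pi.add_apply,
    Pi.smul_apply, Pi.zero_apply, smul_eq_mul, zero_mul, mul_zero, zero_add,
    Finset.sum_const_zero, Finset.sum_neg_distrib, ← Finset.mul_sum, hrow]

theorem Params.sum_prin_mulVec_hessPsi :
    ∑ K, (P.prin A z *ᵥ hessPsi K) K = P.s z ^ 2 * (p - (coeffMatrix A z).trace) := by
  simp only [sum_idx, hessPsi_zero, hessPsi_succ, hessPsi_inr, Params.prin_mulVec_vec, vec_zero,
    vec_succ, vec_inr, Pi.neg_apply, Pi.smul_apply, Pi.single_eq_same, Matrix.mulVec_single_one,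
    Matrix.col_apply, smul_eq_mul, mul_one, Finset.sum_const, Finset.card_univ, Fintype.card_fin,
    nsmul_eq_mul, Finset.sum_neg_distrib, ← Finset.mul_sum, Matrix.trace, Matrix.diag_apply]
  ring

variable {z} in
theorem Params.sum_prin_mulVec_hessian (hs : 0 < P.s z) (φ : Pt (p + 1) (q + 1) → ℝ) :
    ∑ K, (P.prin A z *ᵥ hessian φ z K) K = P.s z * P.L₀ A φ z := by
  have hrow (K : Idx p q) := eq_vec (hessian φ z K)
  rw [Finset.sum_congr rfl fun K _ => by rw [hrow K, Params.prin_mulVec_vec]]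
  simp only [sum_idx, vec_zero, vec_succ, vec_inr, Pi.neg_apply, Pi.smul_apply, smul_eq_mul,
    Finset.sum_neg_distrib, ← Finset.mul_sum, Params.L₀]
  change dx 0 (dx 0 φ) z + P.s z ^ 2 * ∑ r : Fin p, dx r.succ (dx r.succ φ) z
    + -(P.s z ^ 2 * ∑ k, ∑ j, A k j z * dy k (dy j φ) z) = _
  field_simp
  ring

/-- The divergence of `A ∇_y ψ`. -/
noncomputable def Params.divCoeffGrad : ℝ :=
  (coeffMatrix A z).trace + P.gradY z ⬝ᵥ rowDiv A z

variable {A z} in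
theorem Params.divAlong_prin_grad (hA : ∀ i j, DifferentiableAt ℝ (A i j) z)
    (hAs : ∀ i j, A i j = A j i) :
    divAlong dir (fun w => P.prin A w *ᵥ P.grad w) z
      = P.s z ^ 2 * (p - P.divCoeffGrad A z) := by
  rw [divAlong_mulVec (P.hasPartials_prin hA) (P.hasPartials_grad z), Params.grad,
    P.sum_prinPartials_mulVec _ _ _ hAs, P.sum_prin_mulVec_hessPsi, Params.divCoeffGrad]
  ring

end PrincipalPart

/-! ### The energy identity -/

section EnergyIdentity

variable (P : Params p q) (A : Fin (q + 1) → Fin (q + 1) → Pt (p + 1) (q + 1) → ℝ)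
  (lam : ℝ) (z : Pt (p + 1) (q + 1))

/-- The principal symbol of `s L₀` at `∇ψ`. -/
noncomputable def Params.symbol : ℝ :=
  P.δ ^ 2 + P.s z ^ 2 * (P.gradX z ⬝ᵥ P.gradX z - P.gradY z ⬝ᵥ coeffMatrix A z *ᵥ P.gradY z)

/-- The derivative of `Params.symbol` along the principal part of `s L₀` applied to `∇ψ`. -/
noncomputable def Params.symbolDeriv : ℝ :=
  2 * P.s z ^ 4 * (P.gradX z ⬝ᵥ P.gradX z
      + (coeffMatrix A z *ᵥ P.gradY z) ⬝ᵥ (coeffMatrix A z *ᵥ P.gradY z))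
    + (2 * P.s z * (P.gradX z ⬝ᵥ P.gradX z - P.gradY z ⬝ᵥ coeffMatrix A z *ᵥ P.gradY z)
      - P.s z ^ 2 * (P.gradY z ⬝ᵥ coeffPartials A z (.inl 0) *ᵥ P.gradY z)) * P.δ
    + P.s z ^ 4 * tangential (coeffMatrix A z) (P.gradX z) (P.gradY z)
      (fun K => P.gradY z ⬝ᵥ coeffPartials A z K *ᵥ P.gradY z)

/-- The derivative of `s² (n - 1 - tr A)` along the principal part of `s L₀` applied to `∇ψ`. -/
noncomputable def Params.traceDeriv : ℝ :=
  (2 * P.s z * (p - (coeffMatrix A z).trace)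
      - P.s z ^ 2 * (coeffPartials A z (.inl 0)).trace) * P.δ
    + P.s z ^ 4 * tangential (coeffMatrix A z) (P.gradX z) (P.gradY z)
      (fun K => (coeffPartials A z K).trace)

/-- The quadratic form in the gradient `(ξ, u, v)` left over by the energy identity. -/
noncomputable def Params.gradForm (ξ : ℝ) (u : Fin p → ℝ) (v : Fin (q + 1) → ℝ) : ℝ :=
  2 * P.δ * (P.s z ^ 3)⁻¹ * ξ ^ 2
    + 2 * ξ * (P.gradY z ⬝ᵥ coeffPartials A z (.inl 0) *ᵥ v)
    - P.δ * (v ⬝ᵥ coeffPartials A z (.inl 0) *ᵥ v)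
    + 2 * (P.δ * ξ + P.s z ^ 2 * (P.gradX z ⬝ᵥ u - P.gradY z ⬝ᵥ coeffMatrix A z *ᵥ v))
      * (v ⬝ᵥ rowDiv A z)
    - 2 * P.s z ^ 2 * tangential (coeffMatrix A z) u v
      (fun K => P.gradY z ⬝ᵥ coeffPartials A z K *ᵥ v)
    - 2 * P.s z ^ 2 * (u ⬝ᵥ u + (coeffMatrix A z *ᵥ v) ⬝ᵥ (coeffMatrix A z *ᵥ v))
    + (p - P.divCoeffGrad A z)
      * (ξ ^ 2 + P.s z ^ 2 * (u ⬝ᵥ u - v ⬝ᵥ coeffMatrix A z *ᵥ v))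
    + P.s z ^ 2 * tangential (coeffMatrix A z) (P.gradX z) (P.gradY z)
      (fun K => v ⬝ᵥ coeffPartials A z K *ᵥ v)

/-- The coefficient of `θ²` left over by the energy identity. -/
noncomputable def Params.potForm : ℝ :=
  -((-2 * P.δ * (P.s z ^ 3)⁻¹ + p - P.divCoeffGrad A z) * bigPhi P A lam z
    + (P.s z ^ 2)⁻¹ * ((-2 * (P.ν + 1) * P.slope lam z ^ 2 / P.psi z
        + (P.ν + 1) * (P.ν + 2) * P.slope lam z / P.psi z ^ 2) * P.symbol A z ^ 2
      + phi₁ P lam z * P.symbolDeriv A z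
      - (P.ν + 1) * P.slope lam z / P.psi z
        * (P.s z ^ 2 * (p - (coeffMatrix A z).trace)) * P.symbol A z
      + P.slope lam z * P.traceDeriv A z))

theorem Params.grad_dotProduct_prin_mulVec_grad :
    P.grad z ⬝ᵥ P.prin A z *ᵥ P.grad z = P.symbol A z := by
  rw [Params.grad, Params.vec_dotProduct_prin_mulVec_vec, ← sq, Params.symbol]

theorem bigPhi_eq :
    bigPhi P A lam z = phi₁ P lam z * P.symbol A z
      + P.slope lam z * (P.s z ^ 2 * (p - (coeffMatrix A z).trace)) := by
  simp only [bigPhi, phi₂, phi₃, P.dx_succ_psi, P.dy_psi, dotProduct_coeffMatrix_mulVec,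
    Params.symbol, phi₁, Params.slope, sq (P.gradX z _), Matrix.trace, Matrix.diag_apply,
    coeffMatrix, Matrix.of_apply]
  simp only [dotProduct]
  ring

variable {P A lam z}

theorem hasPartials_phi₁ (hψ : 0 < P.psi z) :
    HasPartials dir (phi₁ P lam) (fun K =>
      (-2 * (P.ν + 1) * P.slope lam z ^ 2 / P.psi z
        + (P.ν + 1) * (P.ν + 2) * P.slope lam z / P.psi z ^ 2) * P.grad z K) z := by
  have hpow (a c : ℝ) : HasDerivAt (fun x : ℝ => c * x ^ a) (c * (a * P.psi z ^ (a - 1)))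
      (P.psi z) := (Real.hasDerivAt_rpow_const (Or.inl hψ.ne')).const_mul c
  refine ((P.hasPartials_psi z).comp ((hpow (-2 * P.ν - 2) (lam ^ 2 * P.ν ^ 2)).sub
    (hpow (-P.ν - 2) (lam * P.ν * (P.ν + 1))))).congr_partials fun K => ?_
  have hsq : P.psi z ^ (-2 * P.ν - 2) = (P.psi z ^ (-P.ν - 1)) ^ 2 := by
    rw [← Real.rpow_mul_natCast hψ.le]; push_cast; ring_nf
  have hsub : P.psi z ^ (-P.ν - 2) = P.psi z ^ (-P.ν - 1) / P.psi z := by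
    rw [← Real.rpow_sub_one hψ.ne']; ring_nf
  rw [Real.rpow_sub_one hψ.ne', Real.rpow_sub_one hψ.ne', hsq, hsub, Params.slope]
  field_simp
  ring

/-- The partial derivatives of `Params.symbol`. -/
noncomputable def Params.symbolPartials (P : Params p q)
    (A : Fin (q + 1) → Fin (q + 1) → Pt (p + 1) (q + 1) → ℝ) (z : Pt (p + 1) (q + 1))
    (K : Idx p q) : ℝ :=
  2 * (hessPsi K ⬝ᵥ P.prin A z *ᵥ P.grad z) + P.grad z ⬝ᵥ P.prinPartials A z K *ᵥ P.grad z

theorem Params.hasPartials_symbol (hA : ∀ i j, DifferentiableAt ℝ (A i j) z)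
    (hAs : ∀ i j, A i j = A j i) : HasPartials dir (P.symbol A) (P.symbolPartials A z) z := by
  simp only [funext fun w => (P.grad_dotProduct_prin_mulVec_grad A w).symm]
  have hg := P.hasPartials_grad z
  refine (hg.dotProduct ((P.hasPartials_prin hA).mulVec hg)).congr_partials fun K => ?_
  rw [dotProduct_add, dotProduct_mulVec_comm (P.prin_isSymm hAs) (P.grad z) (hessPsi K),
    Params.symbolPartials]
  ring

theorem Params.hasPartials_trace (hA : ∀ i j, DifferentiableAt ℝ (A i j) z) :
    HasPartials dir (fun w => P.s w ^ 2 * (p - (coeffMatrix A w).trace))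
      (fun K => 2 * P.s z * vec 1 0 0 K * (p - (coeffMatrix A z).trace)
        - P.s z ^ 2 * (coeffPartials A z K).trace) z := by
  have htrace : HasPartials dir (fun w => (coeffMatrix A w).trace)
      (fun K => (coeffPartials A z K).trace) z :=
    .sum fun k => HasPartials.matrix_iff.mp (hasPartials_coeffMatrix hA) k k
  exact ((P.hasPartials_s z).sq.mul ((HasPartials.const (p : ℝ)).sub htrace)).congr_partials
    fun K => by ring

theorem Params.sum_symbolPartials_mul_prin_mulVec_grad :
    ∑ K, P.symbolPartials A z K * (P.prin A z *ᵥ P.grad z) K = P.symbolDeriv A z := by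
  simp only [Params.symbolPartials, add_mul, Finset.sum_add_distrib, mul_assoc, Params.grad,
    ← Finset.mul_sum, P.sum_hessPsi_dotProduct_prin_mul_prin]
  simp only [Params.vec_dotProduct_prinPartials_mulVec_vec, Params.sum_sub_mul_prin_mulVec,
    Params.symbolDeriv]
  ring

theorem exists_hasPartials_bigPhi (hψ : 0 < P.psi z) (hA : ∀ i j, DifferentiableAt ℝ (A i j) z)
    (hAs : ∀ i j, A i j = A j i) :
    ∃ Φ' : Idx p q → ℝ, HasPartials dir (bigPhi P A lam) Φ' z ∧
      ∑ K, Φ' K * (P.prin A z *ᵥ P.grad z) K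
        = (-2 * (P.ν + 1) * P.slope lam z ^ 2 / P.psi z
            + (P.ν + 1) * (P.ν + 2) * P.slope lam z / P.psi z ^ 2) * P.symbol A z ^ 2
          + phi₁ P lam z * P.symbolDeriv A z
          - (P.ν + 1) * P.slope lam z / P.psi z
            * (P.s z ^ 2 * (p - (coeffMatrix A z).trace)) * P.symbol A z
          + P.slope lam z * P.traceDeriv A z := by
  rw [funext (bigPhi_eq P A lam)]
  refine ⟨_, ((hasPartials_phi₁ hψ).mul (Params.hasPartials_symbol hA hAs)).add
    ((Params.hasPartials_slope hψ).mul (Params.hasPartials_trace hA)), ?_⟩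
  have hgrad : ∑ K, P.grad z K * (P.prin A z *ᵥ P.grad z) K = P.symbol A z :=
    P.grad_dotProduct_prin_mulVec_grad A z
  have htrace : ∑ K, (2 * P.s z * vec 1 0 0 K * (p - (coeffMatrix A z).trace)
        - P.s z ^ 2 * (coeffPartials A z K).trace) * (P.prin A z *ᵥ P.grad z) K
      = P.traceDeriv A z := by
    rw [Params.grad, P.sum_sub_mul_prin_mulVec, Params.traceDeriv]
  trans ((-2 * (P.ν + 1) * P.slope lam z ^ 2 / P.psi z
        + (P.ν + 1) * (P.ν + 2) * P.slope lam z / P.psi z ^ 2) * P.symbol A z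
      - (P.ν + 1) * P.slope lam z / P.psi z * (P.s z ^ 2 * (p - (coeffMatrix A z).trace)))
        * (∑ K, P.grad z K * (P.prin A z *ᵥ P.grad z) K)
    + phi₁ P lam z * (∑ K, P.symbolPartials A z K * (P.prin A z *ᵥ P.grad z) K)
    + P.slope lam z * ∑ K, (2 * P.s z * vec 1 0 0 K * (p - (coeffMatrix A z).trace)
        - P.s z ^ 2 * (coeffPartials A z K).trace) * (P.prin A z *ᵥ P.grad z) K
  · simp only [Finset.mul_sum, ← Finset.sum_add_distrib]
    exact Finset.sum_congr rfl fun K _ => by ring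
  · rw [hgrad, Params.sum_symbolPartials_mul_prin_mulVec_grad, htrace]
    ring

theorem flux₁_eq {v : Pt (p + 1) (q + 1)} (hs : 0 < P.s v) (hAs : ∀ i j, A i j = A j i)
    (θ : Pt (p + 1) (q + 1) → ℝ) :
    (fun K => Sum.elim (flux₁x P A lam θ) (flux₁y P A lam θ) K v)
      = (2 * lam * P.ν * (P.s v ^ 2)⁻¹) • energyFlux (P.prin A v) (P.grad v) (gradient θ v)
          (bigPhi P A lam v * θ v ^ 2) := by
  have hmulVec (g : Fin (q + 1) → ℝ) (k) :
      ∑ i, A i k v * g i = (coeffMatrix A v *ᵥ g) k :=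
    Finset.sum_congr rfl fun i _ => by rw [hAs i k]; rfl
  have hsne := hs.ne'
  funext K
  simp only [energyFlux, gradient_eq_vec, Params.grad, Params.vec_dotProduct_prin_mulVec_vec]
  simp only [Params.prin_mulVec_vec, Pi.smul_apply, Pi.sub_apply, smul_eq_mul]
  revert K
  refine forall_idx ?_ (fun r => ?_) fun k => ?_
  · simp only [Sum.elim_inl, flux₁x, Fin.cons_zero, vec_zero, bigPhi, P.dx_succ_psi, P.dy_psi,
      dotProduct_coeffMatrix_mulVec]
    simp only [dotProduct, sq (dx _ θ v)]
    field_simp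
    ring
  · simp only [Sum.elim_inl, flux₁x, Fin.cons_succ, vec_succ, P.dx_succ_psi, P.dy_psi,
      dotProduct_coeffMatrix_mulVec, Pi.smul_apply, smul_eq_mul]
    simp only [dotProduct, sq (dx _ θ v)]
    field_simp
    ring
  · simp only [Sum.elim_inr, flux₁y, vec_inr, P.dx_succ_psi, P.dy_psi,
      dotProduct_coeffMatrix_mulVec, hmulVec, Pi.neg_apply, Pi.smul_apply, smul_eq_mul]
    simp only [dotProduct, sq (dx _ θ v)]
    field_simp
    ring

theorem D₁_eq (hs : 0 < P.s z) (hψ : 0 < P.psi z) (hA : ∀ i j, DifferentiableAt ℝ (A i j) z)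
    (hAs : ∀ i j, A i j = A j i) {θ : Pt (p + 1) (q + 1) → ℝ} (hθ : ContDiffAt ℝ 2 θ z)
    {ξ : ℝ} {u : Fin p → ℝ} {v : Fin (q + 1) → ℝ} (huv : gradient θ z = vec ξ u v) :
    D₁ P A lam θ z = 2 * lam * P.ν
      * (2 * (P.s z ^ 2)⁻¹ * (P.grad z ⬝ᵥ P.prin A z *ᵥ gradient θ z)
          * (P.s z * P.L₀ A θ z + bigPhi P A lam z * θ z)
        - P.gradForm A z ξ u v - P.potForm A lam z * θ z ^ 2) := by
  have hC := P.hasPartials_prin hA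
  have hh := hasPartials_hessian hθ
  have hθ' := hasPartials_gradient (hθ.differentiableAt (by norm_num))
  obtain ⟨Φ', hΦ, hΦ_along⟩ := exists_hasPartials_bigPhi (lam := lam) hψ hA hAs
  obtain ⟨V', hV⟩ := hC.energyFlux (P.hasPartials_grad z) hh (hΦ.mul hθ'.sq)
  have hσ := (P.hasPartials_s z).comp (u := fun x => 2 * lam * P.ν * (x ^ 2)⁻¹)
    (((hasDerivAt_pow 2 (P.s z)).fun_inv (pow_pos hs 2).ne').const_mul (2 * lam * P.ν))
  have hflux := (eventually_s_pos hs).mono fun w hw => flux₁_eq (lam := lam) hw hAs θ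
  have hzero : energyFlux (P.prin A z) (P.grad z) (gradient θ z) (bigPhi P A lam z * θ z ^ 2)
      (.inl 0) = 2 * (P.grad z ⬝ᵥ P.prin A z *ᵥ gradient θ z) * ξ
        - (gradient θ z ⬝ᵥ P.prin A z *ᵥ gradient θ z - bigPhi P A lam z * θ z ^ 2) * P.δ := by
    simp only [energyFlux, huv, Params.grad, Pi.sub_apply, Pi.smul_apply, smul_eq_mul]
    simp only [Params.prin_mulVec_vec, vec_zero]
  rw [D₁, divergence_eq_divAlong, divAlong_congr hflux]
  refine (divAlong_smul hσ hV).trans ?_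
  rw [divAlong_energyFlux hC (P.hasPartials_grad z) hh hΦ hθ' (P.prin_isSymm hAs)
    (hessian_comm hθ), hΦ_along, P.sum_prin_mulVec_hessian A hs, P.divAlong_prin_grad hA hAs,
    sum_idx]
  simp only [vec_zero, vec_succ, vec_inr, Pi.zero_apply, mul_zero, zero_mul,
    Finset.sum_const_zero, hzero, Params.potForm]
  simp only [huv, Params.grad, P.sum_prinPartials_mulVec _ _ _ hAs,
    P.vec_dotProduct_prin_mulVec_vec, Params.vec_dotProduct_prinPartials_mulVec_vec,
    P.sum_sub_mul_prin_mulVec, P.sum_hessPsi_dotProduct_prin_mul_prin, Params.gradForm]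
  field_simp
  ring

end EnergyIdentity

/-! ### Conjugation by the weight -/

section Reduction

variable {P : Params p q} {A : Fin (q + 1) → Fin (q + 1) → Pt (p + 1) (q + 1) → ℝ}
  {lam : ℝ} {z : Pt (p + 1) (q + 1)}

/-- The coefficient of `θ²` in `D₂ θ / (2 λ ν)`. -/
noncomputable def Params.potForm₂ (P : Params p q) (lam α₁ β : ℝ) (z : Pt (p + 1) (q + 1)) : ℝ :=
  P.slope lam z * (3 * P.δ ^ 2 * (P.s z ^ 4)⁻¹ + (β - 1) * P.s z ^ 2 * p
      - 1 / 2 * P.δ * α₁ * P.s z * (q + 1))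
    - (P.ν + 1) * P.slope lam z / P.psi z * (-P.δ ^ 3 * (P.s z ^ 3)⁻¹
      + (β - 1) * P.s z ^ 2 * (P.gradX z ⬝ᵥ P.gradX z)
      - 1 / 2 * P.δ * α₁ * P.s z * (P.gradY z ⬝ᵥ P.gradY z))

theorem flux₂_eq (α₁ β : ℝ) (θ : Pt (p + 1) (q + 1) → ℝ) :
    (fun (w : Pt (p + 1) (q + 1)) K => Sum.elim
      (Fin.cons
        (fun w => -2 * lam ^ 2 * P.ν ^ 2 * P.δ ^ 2
          * ((P.s w ^ 3)⁻¹ * P.psi w ^ (-P.ν - 1) * θ w ^ 2))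
        (fun (r : Fin p) w => 2 * lam ^ 2 * P.ν ^ 2 * P.s w ^ 2 * (β - 1)
          * (dx r.succ P.psi w * P.psi w ^ (-P.ν - 1) * θ w ^ 2)) :
        Fin (p + 1) → Pt (p + 1) (q + 1) → ℝ)
      (fun k w => -lam ^ 2 * P.ν ^ 2 * P.δ * α₁
        * (P.s w * dy k P.psi w * P.psi w ^ (-P.ν - 1) * θ w ^ 2)) K w)
    = fun w => (P.slope lam w * θ w ^ 2) • vec (-(2 * lam * P.ν * P.δ ^ 2) * (P.s w ^ 3)⁻¹)
        ((2 * lam * P.ν * (β - 1) * P.s w ^ 2) • P.gradX w)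
        ((-(lam * P.ν * P.δ * α₁) * P.s w) • P.gradY w) := by
  funext w K
  simp only [Pi.smul_apply, Params.slope, smul_eq_mul]
  revert K
  refine forall_idx ?_ (fun r => ?_) fun k => ?_
  · simp only [Sum.elim_inl, Fin.cons_zero, vec_zero]; ring
  · simp only [Sum.elim_inl, Fin.cons_succ, vec_succ, P.dx_succ_psi, Pi.smul_apply, smul_eq_mul]
    ring
  · simp only [Sum.elim_inr, vec_inr, P.dy_psi, Pi.smul_apply, smul_eq_mul]; ring

theorem D₂_eq (hs : 0 < P.s z) (hψ : 0 < P.psi z) (α₁ β : ℝ)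
    {θ : Pt (p + 1) (q + 1) → ℝ} (hθ : DifferentiableAt ℝ θ z)
    {ξ : ℝ} {u : Fin p → ℝ} {v : Fin (q + 1) → ℝ} (huv : gradient θ z = vec ξ u v) :
    D₂ P lam α₁ β θ z = 2 * lam * P.ν *
      (P.potForm₂ lam α₁ β z * θ z ^ 2
      + 2 * P.slope lam z * θ z * (-P.δ ^ 2 * (P.s z ^ 3)⁻¹ * ξ
          + (β - 1) * P.s z ^ 2 * (P.gradX z ⬝ᵥ u)
          - 1 / 2 * P.δ * α₁ * P.s z * (P.gradY z ⬝ᵥ v))) := by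
  have hs' := P.hasPartials_s z
  have hV := (hs'.comp (u := fun x => -(2 * lam * P.ν * P.δ ^ 2) * (x ^ 3)⁻¹)
      (((hasDerivAt_pow 3 (P.s z)).fun_inv (pow_pos hs 3).ne').const_mul _)).vec
    (((HasPartials.const (2 * lam * P.ν * (β - 1))).mul hs'.sq).smul (P.hasPartials_gradX z))
    (((HasPartials.const (-(lam * P.ν * P.δ * α₁))).mul hs').smul (P.hasPartials_gradY z))
  rw [D₂, divergence_eq_divAlong, flux₂_eq,
    divAlong_smul_sq hV (hasPartials_gradient hθ) (P.hasPartials_slope hψ), hV.divAlong_eq, huv,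
    Params.grad, vec_dotProduct_vec, vec_dotProduct_vec, sum_idx, dotProduct_comm (P.gradX z) u,
    dotProduct_comm (P.gradY z) v]
  simp only [dir, vec_zero, vec_succ, vec_inr, Sum.elim_inl, Sum.elim_inr, Pi.zero_apply,
    Pi.add_apply, Pi.smul_apply, Pi.single_apply, Fin.succ_inj, Fin.succ_ne_zero, if_true, if_false,
    smul_eq_mul, mul_zero, zero_mul, mul_one, zero_add, add_zero, Finset.sum_const,
    Finset.card_univ, Fintype.card_fin, nsmul_eq_mul, dotProduct_smul, Params.potForm₂]
  push_cast
  field_simp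
  ring

/-- The coefficient of `(χ φ)²` in `-D₃ φ`. -/
noncomputable def Params.potForm₃ (P : Params p q)
    (A : Fin (q + 1) → Fin (q + 1) → Pt (p + 1) (q + 1) → ℝ) (lam : ℝ)
    (z : Pt (p + 1) (q + 1)) : ℝ :=
  1 / 2 * P.s z ^ 2 * (∑ k, ∑ j, dy k (dy j (A k j)) z)
    - P.slope lam z * P.s z ^ 2 * (P.gradY z ⬝ᵥ rowDiv A z)
    + P.slope lam z * (P.s z ^ 2 * (p - P.divCoeffGrad A z))
    - ((P.ν + 1) * P.slope lam z / P.psi z + 2 * P.slope lam z ^ 2) * P.symbol A z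

theorem flux₃_eq (φ : Pt (p + 1) (q + 1) → ℝ) :
    (fun (w : Pt (p + 1) (q + 1)) K => Sum.elim
      (Fin.cons
        (fun w => -((φ w * dx 0 φ w + lam * P.ν * P.δ * P.psi w ^ (-P.ν - 1) * φ w ^ 2)
          * P.chi lam w ^ 2))
        (fun (r : Fin p) w => -((φ w * dx r.succ φ w
            + lam * P.ν * dx r.succ P.psi w * P.psi w ^ (-P.ν - 1) * φ w ^ 2)
          * P.chi lam w ^ 2 * P.s w ^ 2)) : Fin (p + 1) → Pt (p + 1) (q + 1) → ℝ)
      (fun k w => (∑ j, (A k j w * (dy j φ w * φ w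
            + lam * P.ν * dy j P.psi w * P.psi w ^ (-P.ν - 1) * φ w ^ 2)
            - 1 / 2 * dy j (A k j) w * φ w ^ 2))
          * P.chi lam w ^ 2 * P.s w ^ 2) K w)
    = fun w => -multiplierFlux (P.prin A w) (vec 0 0 (-(P.s w ^ 2 • rowDiv A w))) (P.grad w)
        (gradient φ w) (P.slope lam w) (φ w) (P.chi lam w) := by
  funext w K
  have hsum (k) : ∑ j, (A k j w * (dy j φ w * φ w
        + lam * P.ν * dy j P.psi w * P.psi w ^ (-P.ν - 1) * φ w ^ 2)
        - 1 / 2 * dy j (A k j) w * φ w ^ 2)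
      = φ w * (coeffMatrix A w *ᵥ fun j => dy j φ w) k
        + P.slope lam w * φ w ^ 2 * (coeffMatrix A w *ᵥ P.gradY w) k
        - 1 / 2 * φ w ^ 2 * rowDiv A w k := by
    simp only [Matrix.mulVec, dotProduct, rowDiv, Finset.mul_sum, ← Finset.sum_add_distrib,
      ← Finset.sum_sub_distrib, P.dy_psi, coeffMatrix, Matrix.of_apply, Params.slope]
    exact Finset.sum_congr rfl fun j _ => by ring
  simp only [multiplierFlux, gradient_eq_vec, Params.grad]
  simp only [Params.prin_mulVec_vec, Pi.neg_apply, Pi.smul_apply, Pi.sub_apply, Pi.add_apply,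
    smul_eq_mul]
  revert K
  refine forall_idx ?_ (fun r => ?_) fun k => ?_
  · simp only [Sum.elim_inl, Fin.cons_zero, vec_zero, Params.slope]; ring
  · simp only [Sum.elim_inl, Fin.cons_succ, vec_succ, P.dx_succ_psi, Pi.smul_apply, Pi.zero_apply,
      smul_eq_mul, Params.slope]
    ring
  · simp only [Sum.elim_inr, vec_inr, hsum, Pi.neg_apply, Pi.smul_apply, smul_eq_mul]
    ring

theorem hasPartials_rowDiv (hA : ∀ i j, ContDiffAt ℝ 2 (A i j) z) :
    HasPartials dir (rowDiv A)
      (fun K k => ∑ j, fderiv ℝ (fun w => dy j (A k j) w) z (dir K)) z :=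
  HasPartials.pi_iff.mpr fun k => .sum fun j =>
    HasPartials.pi_iff.mp (hasPartials_hessian (hA k j)) (.inr j)

theorem D₃_eq (hs : 0 < P.s z) (hψ : 0 < P.psi z) (hA : ∀ i j, ContDiffAt ℝ 2 (A i j) z)
    (hAs : ∀ i j, A i j = A j i) {φ : Pt (p + 1) (q + 1) → ℝ} (hφ : ContDiffAt ℝ 2 φ z) :
    D₃ P A lam φ z
      = -(P.chi lam z ^ 2 * (φ z * (P.s z * P.L₀ A φ z)
          + gradient φ z ⬝ᵥ P.prin A z *ᵥ gradient φ z)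
        + P.potForm₃ A lam z * (P.chi lam z * φ z) ^ 2) := by
  have hA' : ∀ i j, DifferentiableAt ℝ (A i j) z := fun i j =>
    (hA i j).differentiableAt (by norm_num)
  have hC := P.hasPartials_prin hA'
  have hg := P.hasPartials_grad z
  have hu := hasPartials_hessian hφ
  have hφ' := hasPartials_gradient (hφ.differentiableAt (by norm_num))
  have hχ := P.hasPartials_chi (lam := lam) hψ
  have hw := P.hasPartials_slope (lam := lam) hψ
  have hc := (HasPartials.const (e := dir) (z := z) (0 : ℝ)).vec (.const (0 : Fin p → ℝ))
    ((P.hasPartials_s z).sq.smul (hasPartials_rowDiv hA)).neg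
  have hcC (h : Idx p q → ℝ) : vec 0 (0 : Fin p → ℝ) (-(P.s z ^ 2 • rowDiv A z)) ⬝ᵥ h
      = ∑ K, (P.prinPartials A z K *ᵥ h) K := by
    rw [eq_vec h, P.sum_prinPartials_mulVec _ _ _ hAs, vec_dotProduct_vec, zero_mul,
      zero_dotProduct, neg_dotProduct, smul_dotProduct, smul_eq_mul, dotProduct_comm (rowDiv A z)]
    ring
  have hdiv := divAlong_multiplierFlux hC hc hg hu hφ' hχ hw (P.prin_isSymm hAs) (hcC _)
  have hrowDiv : ∑ k, ∑ j, fderiv ℝ (fun w => dy j (A k j) w) z (dir (.inr k))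
      = ∑ k, ∑ j, dy k (dy j (A k j)) z := rfl
  rw [D₃, divergence_eq_divAlong, flux₃_eq, divAlong_neg, hdiv, P.sum_prin_mulVec_hessian A hs,
    P.divAlong_prin_grad hA' hAs, P.grad_dotProduct_prin_mulVec_grad, hc.divAlong_eq, sum_idx,
    Params.grad, vec_dotProduct_vec]
  simp only [vec_zero, vec_succ, vec_inr, Pi.zero_apply, Pi.neg_apply, Pi.add_apply,
    Pi.smul_apply, smul_eq_mul, mul_zero, zero_mul, zero_add, Finset.sum_const_zero,
    Finset.sum_neg_distrib, ← Finset.mul_sum, hrowDiv, dotProduct_neg, dotProduct_smul,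
    dotProduct_zero, Params.potForm₃]
  ring

theorem gradient_chi_mul (hψ : 0 < P.psi z) {φ : Pt (p + 1) (q + 1) → ℝ}
    (hφ : DifferentiableAt ℝ φ z) :
    gradient (fun w => P.chi lam w * φ w) z
      = P.chi lam z • (gradient φ z - (P.slope lam z * φ z) • P.grad z) := by
  funext K
  rw [gradient, ((P.hasPartials_chi hψ).mul (hasPartials_gradient hφ)).fderiv_apply]
  simp only [Pi.smul_apply, Pi.sub_apply, smul_eq_mul]
  ring

theorem gradient_chi_mul_eq_vec (hψ : 0 < P.psi z) {φ : Pt (p + 1) (q + 1) → ℝ}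
    (hφ : DifferentiableAt ℝ φ z) :
    gradient (fun w => P.chi lam w * φ w) z
      = vec (P.chi lam z * dx 0 φ z - P.slope lam z * (P.chi lam z * φ z) * P.δ)
        ((P.chi lam z • fun r => dx r.succ φ z)
          - (P.slope lam z * (P.chi lam z * φ z)) • P.gradX z)
        ((P.chi lam z • fun k => dy k φ z)
          - (P.slope lam z * (P.chi lam z * φ z)) • P.gradY z) := by
  rw [gradient_chi_mul hψ hφ, gradient_eq_vec, Params.grad]
  funext K
  revert K
  refine forall_idx ?_ (fun r => ?_) fun k => ?_ <;>
    simp only [Pi.smul_apply, Pi.sub_apply, smul_eq_mul, vec_zero, vec_succ, vec_inr] <;> ring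

theorem contDiffAt_chi (hψ : 0 < P.psi z) : ContDiffAt ℝ 2 (P.chi lam) z := by
  have hpsi : ContDiff ℝ 2 P.psi := by
    unfold Params.psi Params.psi₀
    fun_prop
  exact Real.contDiff_exp.contDiffAt.comp z
    (contDiffAt_const.mul (hpsi.contDiffAt.rpow_const_of_ne hψ.ne'))

theorem sum_prin_mulVec_hessian_chi_mul (hψ : 0 < P.psi z) {φ : Pt (p + 1) (q + 1) → ℝ}
    (hφ : ContDiffAt ℝ 2 φ z) :
    ∑ K, (P.prin A z *ᵥ hessian (fun w => P.chi lam w * φ w) z K) K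
      = P.chi lam z * ((∑ K, (P.prin A z *ᵥ hessian φ z K) K)
        - P.slope lam z * (P.grad z ⬝ᵥ P.prin A z *ᵥ gradient φ z)
        - P.slope lam z * (gradient φ z ⬝ᵥ P.prin A z *ᵥ P.grad z)
        + (P.slope lam z ^ 2 + (P.ν + 1) * P.slope lam z / P.psi z) * φ z * P.symbol A z
        - P.slope lam z * φ z * (P.s z ^ 2 * (p - (coeffMatrix A z).trace))) := by
  have hφ' := hasPartials_gradient (hφ.differentiableAt (by norm_num))
  have hgrad : gradient (fun w => P.chi lam w * φ w) =ᶠ[nhds z] fun w =>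
      P.chi lam w • (gradient φ w - (P.slope lam w * φ w) • P.grad w) := by
    filter_upwards [eventually_psi_pos hψ, hφ.eventually (by simp)] with w hw hφw
    exact gradient_chi_mul hw (hφw.differentiableAt (by norm_num))
  have hprod := (P.hasPartials_chi (lam := lam) hψ).smul ((hasPartials_hessian hφ).sub
    (((P.hasPartials_slope (lam := lam) hψ).mul hφ').smul (P.hasPartials_grad z)))
  have hhess (K : Idx p q) : hessian (fun w => P.chi lam w * φ w) z K
      = P.chi lam z • (hessian φ z K - (P.slope lam z * P.grad z K) • gradient φ z
        - (P.slope lam z * gradient φ z K) • P.grad z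
        + ((P.slope lam z ^ 2 + (P.ν + 1) * P.slope lam z / P.psi z) * φ z * P.grad z K)
          • P.grad z
        - (P.slope lam z * φ z) • hessPsi K) := by
    funext L
    have hgradL : (fun w => gradient (fun w => P.chi lam w * φ w) w L) =ᶠ[nhds z] fun w =>
        (P.chi lam w • (gradient φ w - (P.slope lam w * φ w) • P.grad w)) L :=
      hgrad.mono fun w hw => congrFun hw L
    rw [hessian, hgradL.fderiv_eq, (HasPartials.pi_iff.mp hprod L).fderiv_apply K]
    simp only [Pi.add_apply, Pi.sub_apply, Pi.smul_apply, smul_eq_mul]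
    ring
  simp only [hhess, Matrix.mulVec_smul, Matrix.mulVec_add, Matrix.mulVec_sub, Pi.smul_apply,
    Pi.add_apply, Pi.sub_apply, smul_eq_mul, mul_assoc, Finset.sum_add_distrib,
    Finset.sum_sub_distrib, ← Finset.mul_sum, P.sum_prin_mulVec_hessPsi]
  rw [← P.grad_dotProduct_prin_mulVec_grad]
  simp only [dotProduct]

theorem conjugate_L₀ (hs : 0 < P.s z) (hψ : 0 < P.psi z) (hAs : ∀ i j, A i j = A j i)
    {φ : Pt (p + 1) (q + 1) → ℝ} (hφ : ContDiffAt ℝ 2 φ z) :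
    P.s z * P.L₀ A (fun w => P.chi lam w * φ w) z
        + bigPhi P A lam z * (P.chi lam z * φ z)
        + 2 * P.slope lam z
          * (P.grad z ⬝ᵥ P.prin A z *ᵥ gradient (fun w => P.chi lam w * φ w) z)
      = P.chi lam z * (P.s z * P.L₀ A φ z) := by
  rw [← P.sum_prin_mulVec_hessian A hs, ← P.sum_prin_mulVec_hessian A hs,
    sum_prin_mulVec_hessian_chi_mul hψ hφ, bigPhi_eq, phi₁_eq hψ,
    gradient_chi_mul hψ (hφ.differentiableAt (by norm_num)), Matrix.mulVec_smul,
    Matrix.mulVec_sub, Matrix.mulVec_smul, dotProduct_smul, dotProduct_sub, dotProduct_smul,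
    P.grad_dotProduct_prin_mulVec_grad,
    dotProduct_mulVec_comm (P.prin_isSymm hAs) (gradient φ z), smul_eq_mul, smul_eq_mul]
  ring

theorem rpow_mul_slope (hψ : 0 < P.psi z) :
    P.psi z ^ (P.ν + 1) * P.slope lam z = lam * P.ν := by
  rw [Params.slope, mul_left_comm, ← Real.rpow_add hψ, show P.ν + 1 + (-P.ν - 1) = 0 by ring,
    Real.rpow_zero, mul_one]

theorem rpow_eq_slope_sq_div (hψ : 0 < P.psi z) :
    lam ^ 2 * P.ν ^ 2 * P.psi z ^ (-2 * P.ν - 3) = P.slope lam z ^ 2 / P.psi z := by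
  rw [Params.slope, show -2 * P.ν - 3 = (-P.ν - 1) * (2 : ℕ) - 1 by push_cast; ring,
    Real.rpow_sub_one hψ.ne', Real.rpow_mul_natCast hψ.le]
  ring

/-- The coefficient of `(χ φ)²` in the difference of the two sides of the Carleman estimate, up to
the factor `2 λ ν`. -/
noncomputable def Params.potTotal (P : Params p q)
    (A : Fin (q + 1) → Fin (q + 1) → Pt (p + 1) (q + 1) → ℝ) (lam α₁ β : ℝ)
    (z : Pt (p + 1) (q + 1)) : ℝ :=
  P.potForm A lam z - P.potForm₂ lam α₁ β z + β * P.potForm₃ A lam z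
    - P.slope lam z ^ 2 * (P.δ ^ 3 * (P.s z ^ 3)⁻¹
      - (β - 1) * P.s z ^ 2 * (P.gradX z ⬝ᵥ P.gradX z)
      + 1 / 2 * P.δ * α₁ * P.s z * (P.gradY z ⬝ᵥ P.gradY z)
      + 1 / 2 * P.ν * P.δ ^ 4 / P.psi z)

theorem four_mul_le_sq_L₀ (hs : 0 < P.s z) (hψ : 0 < P.psi z) (hAs : ∀ i j, A i j = A j i)
    {φ : Pt (p + 1) (q + 1) → ℝ} (hφ : ContDiffAt ℝ 2 φ z) :
    4 * lam * P.ν * (P.s z ^ 2)⁻¹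
        * (P.grad z ⬝ᵥ P.prin A z *ᵥ gradient (fun w => P.chi lam w * φ w) z)
        * (P.s z * P.L₀ A (fun w => P.chi lam w * φ w) z
          + bigPhi P A lam z * (P.chi lam z * φ z))
      ≤ P.psi z ^ (P.ν + 1) * P.L₀ A φ z ^ 2 * P.chi lam z ^ 2 := by
  have hconj := conjugate_L₀ (lam := lam) hs hψ hAs hφ
  have hslope := rpow_mul_slope (lam := lam) hψ
  set N := P.grad z ⬝ᵥ P.prin A z *ᵥ gradient (fun w => P.chi lam w * φ w) z
  set Z := P.s z * P.L₀ A (fun w => P.chi lam w * φ w) z + bigPhi P A lam z * (P.chi lam z * φ z)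
  have hsq : P.L₀ A φ z * P.chi lam z = (P.s z)⁻¹ * (Z + 2 * P.slope lam z * N) := by
    rw [hconj]; field_simp
  have hnonneg : 0 ≤ P.psi z ^ (P.ν + 1) * (P.s z ^ 2)⁻¹
      * (Z ^ 2 + 4 * P.slope lam z ^ 2 * N ^ 2) := by positivity
  rw [mul_assoc (P.psi z ^ _), ← mul_pow, hsq, mul_assoc 4 lam, ← hslope]
  linear_combination hnonneg

theorem carleman_of_nonneg (hs : 0 < P.s z) (hψ : 0 < P.psi z) (hν : 0 < P.ν) (hlam : 0 < lam)
    (hA : ∀ i j, ContDiffAt ℝ 2 (A i j) z) (hAs : ∀ i j, A i j = A j i)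
    {φ : Pt (p + 1) (q + 1) → ℝ} (hφ : ContDiffAt ℝ 2 φ z) {α₁ β : ℝ} (hβ : 0 ≤ β)
    (hgrad : ∀ ξ u v, 1 / 2 * P.δ * α₁ * P.s z * (v ⬝ᵥ v)
      ≤ P.gradForm A z ξ u v - P.δ * (P.s z ^ 3)⁻¹ * ξ ^ 2 + (β - 1) * P.s z ^ 2 * (u ⬝ᵥ u))
    (hmult : ∀ v, P.s z * (v ⬝ᵥ v) + β * P.s z ^ 2 * (v ⬝ᵥ coeffMatrix A z *ᵥ v)
      ≤ 1 / 2 * P.δ * α₁ * P.s z * (v ⬝ᵥ v))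
    (hpot : 0 ≤ P.potTotal A lam α₁ β z) :
    2 * lam * P.ν * P.δ * (P.s z ^ 3)⁻¹ * dx 0 φ z ^ 2 * P.chi lam z ^ 2
      + 2 * lam * P.ν * P.s z ^ 2 * (∑ i : Fin p, dx i.succ φ z ^ 2) * P.chi lam z ^ 2
      + 2 * lam * P.ν * P.s z * (∑ j, dy j φ z ^ 2) * P.chi lam z ^ 2
      + lam ^ 3 * P.ν ^ 4 * P.δ ^ 4 * P.psi z ^ (-2 * P.ν - 3) * φ z ^ 2 * P.chi lam z ^ 2
      + (D₁ P A lam (fun w => P.chi lam w * φ w) z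
        + D₂ P lam α₁ β (fun w => P.chi lam w * φ w) z + 2 * lam * P.ν * β * D₃ P A lam φ z)
    ≤ P.psi z ^ (P.ν + 1) * P.L₀ A φ z ^ 2 * P.chi lam z ^ 2
      - 2 * lam * P.ν * β * φ z * P.s z * P.L₀ A φ z * P.chi lam z ^ 2 := by
  have hφ' := hφ.differentiableAt (by norm_num)
  have hθ : ContDiffAt ℝ 2 (fun w => P.chi lam w * φ w) z := (contDiffAt_chi hψ).mul hφ
  have hgradient := gradient_chi_mul_eq_vec (lam := lam) hψ hφ'
  have hsquare := four_mul_le_sq_L₀ (lam := lam) hs hψ hAs hφ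
  have hpow : lam ^ 3 * P.ν ^ 4 * P.δ ^ 4 * P.psi z ^ (-2 * P.ν - 3)
      = lam * P.ν ^ 2 * P.δ ^ 4 * (P.slope lam z ^ 2 / P.psi z) := by
    rw [← rpow_eq_slope_sq_div hψ]; ring
  have hx : ∑ r : Fin p, dx r.succ φ z ^ 2
      = (fun r => dx r.succ φ z) ⬝ᵥ fun r : Fin p => dx r.succ φ z :=
    Finset.sum_congr rfl fun _ _ => sq _
  have hy : ∑ k, dy k φ z ^ 2 = (fun k => dy k φ z) ⬝ᵥ fun k => dy k φ z :=
    Finset.sum_congr rfl fun _ _ => sq _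
  rw [D₁_eq hs hψ (fun i j => (hA i j).differentiableAt (by norm_num)) hAs hθ hgradient,
    D₂_eq hs hψ α₁ β (hθ.differentiableAt (by norm_num)) hgradient, D₃_eq hs hψ hA hAs hφ,
    gradient_eq_vec φ, P.vec_dotProduct_prin_mulVec_vec, hpow, hx, hy]
  specialize hgrad (P.chi lam z * dx 0 φ z - P.slope lam z * (P.chi lam z * φ z) * P.δ)
    ((P.chi lam z • fun r => dx r.succ φ z)
      - (P.slope lam z * (P.chi lam z * φ z)) • P.gradX z)
    ((P.chi lam z • fun k => dy k φ z)
      - (P.slope lam z * (P.chi lam z * φ z)) • P.gradY z)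
  specialize hmult (P.chi lam z • fun k => dy k φ z)
  have hremainder := add_nonneg (add_nonneg (add_nonneg (sub_nonneg.mpr hgrad)
    (sub_nonneg.mpr hmult)) (mul_nonneg hβ (sq_nonneg (P.chi lam z * dx 0 φ z))))
    (mul_nonneg hpot (sq_nonneg (P.chi lam z * φ z)))
  have hln : 0 ≤ 2 * lam * P.ν := by positivity
  rw [Params.potTotal] at hremainder
  refine sub_nonneg.mp ((add_nonneg (mul_nonneg hln hremainder) (sub_nonneg.mpr hsquare)).trans_eq
    ?_)
  simp only [sub_dotProduct, dotProduct_sub, smul_dotProduct, dotProduct_smul, Matrix.mulVec_smul,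
    smul_eq_mul, dotProduct_comm _ (P.gradX z), dotProduct_comm _ (P.gradY z)]
  ring

end Reduction

/-! ### Elementary estimates -/

section Norm

variable {ι : Type*} [Fintype ι] {M : ℝ} {B : Matrix ι ι ℝ}

/-- The Euclidean norm of a vector that is not an element of a `EuclideanSpace`. -/
noncomputable def norm₂ (v : ι → ℝ) : ℝ := √(v ⬝ᵥ v)

theorem norm₂_nonneg (v : ι → ℝ) : 0 ≤ norm₂ v := Real.sqrt_nonneg _

theorem norm₂_sq (v : ι → ℝ) : norm₂ v ^ 2 = v ⬝ᵥ v :=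
  Real.sq_sqrt (Finset.sum_nonneg fun _ _ => mul_self_nonneg _)

theorem abs_dotProduct_le (v w : ι → ℝ) : |v ⬝ᵥ w| ≤ norm₂ v * norm₂ w := by
  refine abs_le_of_sq_le_sq ?_ (mul_nonneg (norm₂_nonneg v) (norm₂_nonneg w))
  rw [mul_pow, norm₂_sq, norm₂_sq]
  simpa only [dotProduct, sq] using Finset.sum_mul_sq_le_sq_mul_sq Finset.univ v w

theorem abs_le_norm₂ (v : ι → ℝ) (k : ι) : |v k| ≤ norm₂ v := by
  refine Real.abs_le_sqrt ?_
  rw [sq]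
  exact Finset.single_le_sum (f := fun k => v k * v k) (fun _ _ => mul_self_nonneg _)
    (Finset.mem_univ k)

theorem abs_sum_le_card_mul {f : ι → ℝ} {c : ℝ} (hf : ∀ k, |f k| ≤ c) :
    |∑ k, f k| ≤ Fintype.card ι * c :=
  (Finset.abs_sum_le_sum_abs _ _).trans
    ((Finset.sum_le_sum fun k _ => hf k).trans_eq (by simp [Finset.card_univ]))

theorem abs_mul_le_mul {a b c d : ℝ} (ha : |a| ≤ c) (hb : |b| ≤ d) : |a * b| ≤ c * d :=
  (abs_mul a b).trans_le (mul_le_mul ha hb (abs_nonneg _) ((abs_nonneg _).trans ha))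

theorem dotProduct_self_le_card_mul {v : ι → ℝ} {c : ℝ} (hv : ∀ k, |v k| ≤ c) :
    v ⬝ᵥ v ≤ Fintype.card ι * c ^ 2 := by
  refine (le_abs_self _).trans (abs_sum_le_card_mul fun k => ?_)
  rw [sq]
  exact abs_mul_le_mul (hv k) (hv k)

theorem norm₂_mulVec_le (hM : 0 ≤ M) (hB : ∀ i j, |B i j| ≤ M) (v : ι → ℝ) :
    norm₂ (B *ᵥ v) ≤ Fintype.card ι * M * norm₂ v := by
  have hrow (k : ι) : |(B *ᵥ v) k| ≤ √(Fintype.card ι * M ^ 2) * norm₂ v :=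
    (abs_dotProduct_le _ _).trans (mul_le_mul_of_nonneg_right
      (Real.sqrt_le_sqrt (dotProduct_self_le_card_mul (hB k))) (norm₂_nonneg v))
  have hnonneg := norm₂_nonneg v
  refine Real.sqrt_le_iff.mpr ⟨by positivity, (dotProduct_self_le_card_mul hrow).trans_eq ?_⟩
  rw [mul_pow, Real.sq_sqrt (by positivity)]
  ring

end Norm

section GradientBlocks

variable {K a b s ξ : ℝ}

theorem le_quadratic_of_sq_le {α D d e : ℝ} (hs : 0 < s) (he : α * s * a ^ 2 ≤ -e)
    (hd : d ^ 2 ≤ D * a ^ 2) (hD : s ^ 2 * D ≤ α / 4) :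
    1 / 4 * ((s ^ 3)⁻¹ * ξ ^ 2) + 2 / 3 * α * s * a ^ 2
      ≤ (s ^ 3)⁻¹ * ξ ^ 2 + 2 * ξ * d - e := by
  have hsquare : 0 ≤ 3 / 4 * (s ^ 3)⁻¹ * (ξ + 4 / 3 * s ^ 3 * d) ^ 2 := by positivity
  have hexpand : 3 / 4 * (s ^ 3)⁻¹ * (ξ + 4 / 3 * s ^ 3 * d) ^ 2
      = 3 / 4 * ((s ^ 3)⁻¹ * ξ ^ 2) + 2 * ξ * d + 4 / 3 * s ^ 3 * d ^ 2 := by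
    field_simp
    ring
  have hd' : 4 / 3 * s ^ 3 * d ^ 2 ≤ 1 / 3 * α * s * a ^ 2 := calc
    4 / 3 * s ^ 3 * d ^ 2 ≤ 4 / 3 * s ^ 3 * (D * a ^ 2) := by gcongr
    _ = 4 / 3 * s * a ^ 2 * (s ^ 2 * D) := by ring
    _ ≤ 4 / 3 * s * a ^ 2 * (α / 4) := by gcongr
    _ = _ := by ring
  linarith

theorem neg_mul_le_lower_order {c e : ℝ} (hs : 0 < s) (hs1 : s < 1) (hK : 0 ≤ K)
    (he : |e| ≤ K * a) (hc : |c| ≤ K) :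
    -(K * (2 * ((s ^ 3)⁻¹ * ξ ^ 2) + s * a ^ 2)) ≤ 2 * ξ * e + c * ξ ^ 2 := by
  have hs3 : s ^ 3 ≤ s := pow_le_of_le_one hs.le hs1.le three_ne_zero
  have hinv : 1 ≤ (s ^ 3)⁻¹ := (one_le_inv₀ (by positivity)).mpr (hs3.trans hs1.le)
  have hmixed : 2 * |ξ| * a ≤ (s ^ 3)⁻¹ * ξ ^ 2 + s * a ^ 2 := calc
    2 * |ξ| * a ≤ s⁻¹ * |ξ| ^ 2 + s * a ^ 2 := by
      have hsquare : 0 ≤ s⁻¹ * (|ξ| - s * a) ^ 2 := by positivity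
      have hexpand : s⁻¹ * (|ξ| - s * a) ^ 2 = s⁻¹ * |ξ| ^ 2 - 2 * |ξ| * a + s * a ^ 2 := by
        field_simp
        ring
      linarith
    _ ≤ _ := by rw [sq_abs]; gcongr
  have hξe : -(K * (2 * |ξ| * a)) ≤ 2 * ξ * e := by
    have := neg_le_of_abs_le (abs_mul_le_mul (le_refl |2 * ξ|) he)
    rw [abs_mul, abs_two] at this
    linarith
  have hcξ : -(K * ξ ^ 2) ≤ c * ξ ^ 2 := by
    have := mul_le_mul_of_nonneg_right (neg_le_of_abs_le hc) (sq_nonneg ξ)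
    linarith
  have hKmixed := mul_le_mul_of_nonneg_left hmixed hK
  have hKξ := mul_le_mul_of_nonneg_left (le_mul_of_one_le_left (sq_nonneg ξ) hinv) hK
  linarith

theorem neg_mul_sq_le_tangential_block {c d e f g T T' n β : ℝ} (hd : |d| ≤ K * a)
    (hf : |f| ≤ K * b) (hg : |g| ≤ K * a) (he : |e| ≤ K * a ^ 2) (hn : n ≤ K * a ^ 2)
    (hT : |T| ≤ K * (a * b + a ^ 2)) (hT' : |T'| ≤ 2 * K * a ^ 2) (hc : |c| ≤ K)
    (hβ : 1 ≤ β - 3 + c) :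
    -((4 * K ^ 4 + 7 * K ^ 2 + 6 * K) * a ^ 2)
      ≤ 2 * (f - g) * d - 2 * T - 2 * (b ^ 2 + n) + c * (b ^ 2 - e) + T' + (β - 1) * b ^ 2 := by
  have hfd : -(1 / 4 * b ^ 2 + 4 * K ^ 4 * a ^ 2) ≤ 2 * (f * d) := by
    linarith [neg_le_of_abs_le (abs_mul_le_mul hf hd), sq_nonneg (1 / 2 * b - 2 * K ^ 2 * a)]
  have hgd := le_of_abs_le (abs_mul_le_mul hg hd)
  have hT₁ : 2 * T ≤ 1 / 4 * b ^ 2 + 4 * K ^ 2 * a ^ 2 + 2 * K * a ^ 2 := by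
    linarith [le_of_abs_le hT, sq_nonneg (1 / 2 * b - 2 * K * a)]
  have hce := le_of_abs_le (abs_mul_le_mul hc he)
  have hb := mul_le_mul_of_nonneg_right hβ (sq_nonneg b)
  linarith [neg_le_of_abs_le hT', sq_nonneg b]

end GradientBlocks

section PotentialBlocks

variable {K δ ν s ψ Q : ℝ}

theorem symbol_mem_Icc {G : ℝ} (hs : 0 < s) (hs1 : s < 1) (hG : |G| ≤ K) (hδ : 1 + 4 * K ≤ δ)
    (hQ : Q = δ ^ 2 + s ^ 2 * G) : Q ∈ Set.Icc (3 / 4 * δ ^ 2) (2 * δ ^ 2) := by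
  have hK : 0 ≤ K := (abs_nonneg _).trans hG
  have hs2 : |s ^ 2| ≤ 1 := by
    rw [abs_of_nonneg (sq_nonneg s)]
    exact pow_le_one₀ hs.le hs1.le
  have hsG := abs_le.mp (abs_mul_le_mul hs2 hG)
  have hδ2 : δ ≤ δ ^ 2 := le_self_pow₀ (by linarith) two_ne_zero
  constructor <;> linarith

theorem pow_four_le_symbol_sq (hν : 0 < ν) (hs : 0 < s) (hs1 : s < 1) (hψ : 0 < ψ)
    (hψ1 : ψ < 1) (hQ : 3 / 4 * δ ^ 2 ≤ Q) :
    δ ^ 4 ≤ 2 * (ν + 1) * (s ^ 2)⁻¹ * ψ⁻¹ * Q ^ 2 - 1 / 2 * ν * δ ^ 4 * ψ⁻¹ := by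
  have hψi : 1 ≤ ψ⁻¹ := (one_le_inv₀ hψ).mpr hψ1.le
  have hsi : 1 ≤ (s ^ 2)⁻¹ := (one_le_inv₀ (by positivity)).mpr (pow_le_one₀ hs.le hs1.le)
  calc δ ^ 4 ≤ δ ^ 4 * ψ⁻¹ := le_mul_of_one_le_right (by positivity) hψi
    _ ≤ (9 / 8 + 5 / 8 * ν) * (δ ^ 4 * ψ⁻¹) := le_mul_of_one_le_left (by positivity) (by linarith)
    _ = 2 * (ν + 1) * 1 * ψ⁻¹ * (3 / 4 * δ ^ 2) ^ 2 - 1 / 2 * ν * δ ^ 4 * ψ⁻¹ := by ring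
    _ ≤ _ := by gcongr

theorem one_le_quadratic_potential {α₁ c β G a₁ B gx gy : ℝ} (hα : 0 < α₁) (hν : 0 < ν)
    (hs : 0 < s) (hs1 : s < 1) (hψ : 0 < ψ) (hψ1 : ψ < 1) (hG : |G| ≤ K) (ha₁ : |a₁| ≤ K)
    (hB : |B| ≤ K) (hc : |c + 2 * β| ≤ K) (hβ : 1 ≤ β) (hgx : 0 ≤ gx) (hgy : gy ≤ 1)
    (hδ : 1 + 4 * K + α₁ ≤ δ) (hQ : Q = δ ^ 2 + s ^ 2 * G) :
    1 ≤ (2 * δ * (s ^ 3)⁻¹ - (c + 2 * β)) * Q + 2 * (ν + 1) * (s ^ 2)⁻¹ * ψ⁻¹ * Q ^ 2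
      - (s ^ 2)⁻¹ * (δ * (2 * s * G - s ^ 2 * a₁) + s ^ 4 * B) - δ ^ 3 * (s ^ 3)⁻¹
      + (β - 1) * s ^ 2 * gx - 1 / 2 * δ * α₁ * s * gy - 1 / 2 * ν * δ ^ 4 * ψ⁻¹ := by
  have hK : 0 ≤ K := (abs_nonneg _).trans hG
  have hδ1 : 1 ≤ δ := by linarith
  obtain ⟨hQ₁, hQ₂⟩ := symbol_mem_Icc hs hs1 hG (by linarith) hQ
  have hcancel : 2 * δ * (s ^ 3)⁻¹ * Q
        - (s ^ 2)⁻¹ * (δ * (2 * s * G - s ^ 2 * a₁) + s ^ 4 * B) - δ ^ 3 * (s ^ 3)⁻¹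
      = δ ^ 3 * (s ^ 3)⁻¹ + δ * a₁ - s ^ 2 * B := by
    rw [hQ]
    field_simp
    ring
  have hcQ : (c + 2 * β) * Q ≤ K * (2 * δ ^ 2) :=
    le_of_abs_le (abs_mul_le_mul hc (abs_le.mpr ⟨by linarith [sq_nonneg δ], hQ₂⟩))
  have hδa₁ : -(δ * K) ≤ δ * a₁ := by
    have := mul_le_mul_of_nonneg_left (neg_le_of_abs_le ha₁) (by linarith : 0 ≤ δ)
    linarith
  have hs2 : s ^ 2 ≤ 1 := pow_le_one₀ hs.le hs1.le
  have hsB : s ^ 2 * B ≤ 1 * K :=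
    le_of_abs_le (abs_mul_le_mul (by rwa [abs_of_nonneg (by positivity)]) hB)
  have hgx' : 0 ≤ (β - 1) * s ^ 2 * gx := by
    have := sub_nonneg.mpr hβ
    positivity
  have hgy' : δ * α₁ * (s * gy) ≤ δ * α₁ * 1 := by
    have : s * gy ≤ 1 := (mul_le_of_le_one_right hs.le hgy).trans hs1.le
    gcongr
  have hδ3 : 0 ≤ δ ^ 3 * (s ^ 3)⁻¹ := by positivity
  have hδ4 : 1 + 2 * K * δ ^ 2 + δ * K + K + 1 / 2 * δ * α₁ ≤ δ ^ 4 := by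
    have hmul : (1 + 4 * K + α₁) * δ ^ 2 ≤ δ ^ 2 * δ ^ 2 := by
      gcongr
      exact hδ.trans (le_self_pow₀ hδ1 two_ne_zero)
    have hδδ : δ ≤ δ ^ 2 := le_self_pow₀ hδ1 two_ne_zero
    nlinarith
  linarith [pow_four_le_symbol_sq hν hs hs1 hψ hψ1 hQ₁]

end PotentialBlocks

/-! ### Bounds for the gradient form -/

variable {M : ℝ}

section Constants

/-- The constant `M m²`, which bounds the action of an `m × m` matrix with entries at most `M`. -/
def kappa (q : ℕ) (M : ℝ) : ℝ := M * ((q : ℝ) + 1) ^ 2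

/-- A constant that dominates all lower-order terms of the remainders. -/
def bigConst (p q : ℕ) (M : ℝ) : ℝ := 12 * ((p : ℝ) + 1) * (kappa q M + 1) ^ 2

theorem kappa_nonneg (hM : 0 ≤ M) : 0 ≤ kappa q M := by unfold kappa; positivity

theorem card_mul_le_kappa (hM : 0 ≤ M) : ((q : ℝ) + 1) * M ≤ kappa q M := by
  unfold kappa
  nlinarith [mul_nonneg hM (q.cast_nonneg : (0 : ℝ) ≤ q), mul_nonneg hM (sq_nonneg (q : ℝ))]

theorem le_bigConst {a : ℝ}
    (ha : a ≤ 12 * (1 + p + 2 * kappa q M + 2 * (p * kappa q M) + kappa q M ^ 2)) :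
    a ≤ bigConst p q M := by
  unfold bigConst
  have := mul_nonneg (p.cast_nonneg : (0 : ℝ) ≤ p) (sq_nonneg (kappa q M))
  linarith

end Constants

section EntryBounds

variable {C : ℝ} {B : Matrix (Fin (q + 1)) (Fin (q + 1)) ℝ}

theorem norm₂_mulVec_le_card_mul (hM : 0 ≤ M) (hB : ∀ i j, |B i j| ≤ M) (v : Fin (q + 1) → ℝ) :
    norm₂ (B *ᵥ v) ≤ ((q : ℝ) + 1) * M * norm₂ v := by
  simpa only [Fintype.card_fin, Nat.cast_add, Nat.cast_one] using norm₂_mulVec_le hM hB v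

theorem norm₂_mulVec_le_kappa (hM : 0 ≤ M) (hB : ∀ i j, |B i j| ≤ M) (v : Fin (q + 1) → ℝ) :
    norm₂ (B *ᵥ v) ≤ kappa q M * norm₂ v :=
  (norm₂_mulVec_le_card_mul hM hB v).trans
    (mul_le_mul_of_nonneg_right (card_mul_le_kappa hM) (norm₂_nonneg v))

theorem abs_dotProduct_mulVec_le_kappa (hM : 0 ≤ M) (hB : ∀ i j, |B i j| ≤ M)
    (v w : Fin (q + 1) → ℝ) : |v ⬝ᵥ B *ᵥ w| ≤ kappa q M * (norm₂ v * norm₂ w) := by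
  refine (abs_dotProduct_le _ _).trans ((mul_le_mul_of_nonneg_left (norm₂_mulVec_le_kappa hM hB w)
    (norm₂_nonneg v)).trans_eq (by ring))

theorem abs_trace_le_card_mul (hB : ∀ i j, |B i j| ≤ M) : |B.trace| ≤ ((q : ℝ) + 1) * M := by
  simpa only [Matrix.trace, Matrix.diag_apply, Fintype.card_fin, Nat.cast_add, Nat.cast_one] using
    abs_sum_le_card_mul fun i => hB i i

theorem abs_tangential_le (hM : 0 ≤ M) (hB : ∀ i j, |B i j| ≤ M) {c : Idx p q → ℝ}
    (hc : ∀ K, |c K| ≤ C) (f : Fin p → ℝ) (g : Fin (q + 1) → ℝ) :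
    |tangential B f g c| ≤ C * (p * norm₂ f + kappa q M * norm₂ g) := by
  have hy : |∑ k, c (.inr k) * (B *ᵥ g) k| ≤ C * (kappa q M * norm₂ g) := by
    refine (abs_sum_le_card_mul fun k => abs_mul_le_mul (hc _)
      ((abs_le_norm₂ _ k).trans (norm₂_mulVec_le_card_mul hM hB g))).trans_eq ?_
    rw [Fintype.card_fin, kappa]
    push_cast
    ring
  have hx : |∑ r : Fin p, c (.inl r.succ) * f r| ≤ C * (p * norm₂ f) := by
    refine (abs_sum_le_card_mul fun r => abs_mul_le_mul (hc _) (abs_le_norm₂ f r)).trans_eq ?_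
    rw [Fintype.card_fin]
    ring
  exact (abs_sub _ _).trans (by linarith)

end EntryBounds

/-- Pointwise bounds on the coefficients and on the weight, as they hold on `Ω_γ`. -/
structure PointBounds (P : Params p q) (A : Fin (q + 1) → Fin (q + 1) → Pt (p + 1) (q + 1) → ℝ)
    (M : ℝ) (z : Pt (p + 1) (q + 1)) : Prop where
  s_pos : 0 < P.s z
  s_lt_one : P.s z < 1
  psi_pos : 0 < P.psi z
  psi_lt_one : P.psi z < 1
  norm₂_gradX_le_one : norm₂ (P.gradX z) ≤ 1
  norm₂_gradY_le_one : norm₂ (P.gradY z) ≤ 1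
  abs_coeff_le : ∀ i j, |coeffMatrix A z i j| ≤ M
  abs_coeffPartials_le : ∀ K i j, |coeffPartials A z K i j| ≤ M
  abs_dy_dy_le : ∀ k j, |dy k (dy j (A k j)) z| ≤ M

namespace PointBounds

variable {P : Params p q} {A : Fin (q + 1) → Fin (q + 1) → Pt (p + 1) (q + 1) → ℝ}
  {z : Pt (p + 1) (q + 1)} (hb : PointBounds P A M z)

include hb

theorem nonneg : 0 ≤ M := (abs_nonneg _).trans (hb.abs_coeff_le 0 0)

theorem kappa_nonneg : 0 ≤ kappa q M := UltraCarleman.kappa_nonneg hb.nonneg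

theorem one_le_bigConst : 1 ≤ bigConst p q M := by
  refine le_bigConst ?_
  have := hb.kappa_nonneg
  have : 0 ≤ p * kappa q M := by positivity
  nlinarith [(p.cast_nonneg : (0 : ℝ) ≤ p)]

theorem abs_gradY_dotProduct_mulVec_le {B : Matrix (Fin (q + 1)) (Fin (q + 1)) ℝ}
    (hB : ∀ i j, |B i j| ≤ M) (v : Fin (q + 1) → ℝ) :
    |P.gradY z ⬝ᵥ B *ᵥ v| ≤ kappa q M * norm₂ v :=
  (abs_dotProduct_mulVec_le_kappa hb.nonneg hB _ v).trans (mul_le_mul_of_nonneg_left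
    (mul_le_of_le_one_left (norm₂_nonneg v) hb.norm₂_gradY_le_one) hb.kappa_nonneg)

theorem abs_gradY_dotProduct_mulVec_gradY_le {B : Matrix (Fin (q + 1)) (Fin (q + 1)) ℝ}
    (hB : ∀ i j, |B i j| ≤ M) : |P.gradY z ⬝ᵥ B *ᵥ P.gradY z| ≤ kappa q M :=
  (hb.abs_gradY_dotProduct_mulVec_le hB _).trans
    (mul_le_of_le_one_right hb.kappa_nonneg hb.norm₂_gradY_le_one)

theorem abs_tangential_grad_le {C : ℝ} {c : Idx p q → ℝ} (hc : ∀ K, |c K| ≤ C) :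
    |tangential (coeffMatrix A z) (P.gradX z) (P.gradY z) c| ≤ C * (p + kappa q M) := by
  have hC : 0 ≤ C := (abs_nonneg _).trans (hc (.inl 0))
  refine (abs_tangential_le hb.nonneg hb.abs_coeff_le hc _ _).trans
    (mul_le_mul_of_nonneg_left (add_le_add ?_ ?_) hC)
  · exact mul_le_of_le_one_right p.cast_nonneg hb.norm₂_gradX_le_one
  · exact mul_le_of_le_one_right hb.kappa_nonneg hb.norm₂_gradY_le_one

theorem rowDiv_dotProduct_self_le :
    rowDiv A z ⬝ᵥ rowDiv A z ≤ M ^ 2 * ((q : ℝ) + 1) ^ 3 := by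
  refine (dotProduct_self_le_card_mul fun k => abs_sum_le_card_mul fun j =>
    hb.abs_coeffPartials_le (.inr j) k j).trans_eq ?_
  rw [Fintype.card_fin]
  push_cast
  ring

theorem sq_dotProduct_rowDiv_le (v : Fin (q + 1) → ℝ) :
    (v ⬝ᵥ rowDiv A z) ^ 2 ≤ M ^ 2 * ((q : ℝ) + 1) ^ 3 * norm₂ v ^ 2 := calc
  (v ⬝ᵥ rowDiv A z) ^ 2 ≤ (norm₂ v * norm₂ (rowDiv A z)) ^ 2 :=
    sq_le_sq.mpr ((abs_dotProduct_le _ _).trans (le_abs_self _))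
  _ = rowDiv A z ⬝ᵥ rowDiv A z * norm₂ v ^ 2 := by rw [mul_pow, norm₂_sq (rowDiv A z), mul_comm]
  _ ≤ _ := mul_le_mul_of_nonneg_right hb.rowDiv_dotProduct_self_le (sq_nonneg _)

theorem abs_dotProduct_rowDiv_le (v : Fin (q + 1) → ℝ) :
    |v ⬝ᵥ rowDiv A z| ≤ kappa q M * norm₂ v := by
  have hv := norm₂_nonneg v
  have hκ := hb.kappa_nonneg
  refine abs_le_of_sq_le_sq ((hb.sq_dotProduct_rowDiv_le v).trans ?_) (by positivity)
  rw [mul_pow, kappa, mul_pow, ← pow_mul]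
  gcongr <;> norm_num

theorem abs_divCoeffGrad_le :
    |P.divCoeffGrad A z| ≤ ((q : ℝ) + 1) * M + kappa q M := by
  refine (abs_add_le _ _).trans (add_le_add (abs_trace_le_card_mul hb.abs_coeff_le) ?_)
  exact (hb.abs_dotProduct_rowDiv_le _).trans
    (mul_le_of_le_one_right hb.kappa_nonneg hb.norm₂_gradY_le_one)

theorem abs_sub_divCoeffGrad_le : |p - P.divCoeffGrad A z| ≤ p + 2 * kappa q M := by
  refine (abs_sub _ _).trans ?_
  rw [Nat.abs_cast]
  linarith [hb.abs_divCoeffGrad_le, card_mul_le_kappa (q := q) hb.nonneg]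

theorem neg_mul_sq_le_tangential_part {β : ℝ} (hβ : 1 ≤ β - 3 + (p - P.divCoeffGrad A z))
    (u : Fin p → ℝ) (v : Fin (q + 1) → ℝ) :
    -((4 * bigConst p q M ^ 4 + 7 * bigConst p q M ^ 2 + 6 * bigConst p q M) * norm₂ v ^ 2)
      ≤ 2 * (P.gradX z ⬝ᵥ u - P.gradY z ⬝ᵥ coeffMatrix A z *ᵥ v) * (v ⬝ᵥ rowDiv A z)
        - 2 * tangential (coeffMatrix A z) u v (fun K => P.gradY z ⬝ᵥ coeffPartials A z K *ᵥ v)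
        - 2 * (norm₂ u ^ 2 + norm₂ (coeffMatrix A z *ᵥ v) ^ 2)
        + (p - P.divCoeffGrad A z) * (norm₂ u ^ 2 - v ⬝ᵥ coeffMatrix A z *ᵥ v)
        + tangential (coeffMatrix A z) (P.gradX z) (P.gradY z)
          (fun K => v ⬝ᵥ coeffPartials A z K *ᵥ v)
        + (β - 1) * norm₂ u ^ 2 := by
  have hκ := hb.kappa_nonneg
  have hp : (0 : ℝ) ≤ p := p.cast_nonneg
  have hpκ := mul_nonneg hp hκ
  have hu := norm₂_nonneg u
  have hv := norm₂_nonneg v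
  have hK {a : ℝ} (ha : a ≤ 1 + p + 2 * kappa q M + 2 * (p * kappa q M) + kappa q M ^ 2) :
      a ≤ bigConst p q M := le_bigConst (by nlinarith)
  have hκK : kappa q M ≤ bigConst p q M := hK (by nlinarith)
  have hform {B : Matrix (Fin (q + 1)) (Fin (q + 1)) ℝ} (hB : ∀ i j, |B i j| ≤ M) :
      |v ⬝ᵥ B *ᵥ v| ≤ kappa q M * norm₂ v ^ 2 := by
    rw [sq]
    exact abs_dotProduct_mulVec_le_kappa hb.nonneg hB v v
  refine neg_mul_sq_le_tangential_block
    ((hb.abs_dotProduct_rowDiv_le v).trans (by gcongr))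
    ((abs_dotProduct_le _ _).trans
      (by gcongr; exact hb.norm₂_gradX_le_one.trans hb.one_le_bigConst))
    ((hb.abs_gradY_dotProduct_mulVec_le hb.abs_coeff_le v).trans (by gcongr))
    ((hform hb.abs_coeff_le).trans (by gcongr)) ?_ ?_ ?_ ?_ hβ
  · refine (pow_le_pow_left₀ (norm₂_nonneg _)
      (norm₂_mulVec_le_kappa hb.nonneg hb.abs_coeff_le v) 2).trans ?_
    rw [mul_pow]
    gcongr
    exact hK (by nlinarith)
  · refine (abs_tangential_le hb.nonneg hb.abs_coeff_le (fun K =>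
      hb.abs_gradY_dotProduct_mulVec_le (hb.abs_coeffPartials_le K) v) u v).trans ?_
    have h₁ : p * kappa q M * (norm₂ v * norm₂ u) ≤ bigConst p q M * (norm₂ v * norm₂ u) := by
      gcongr
      exact hK (by nlinarith)
    have h₂ : kappa q M ^ 2 * norm₂ v ^ 2 ≤ bigConst p q M * norm₂ v ^ 2 := by
      gcongr
      exact hK (by nlinarith)
    linarith
  · refine (hb.abs_tangential_grad_le fun K => hform (hb.abs_coeffPartials_le K)).trans ?_
    have : (kappa q M * (p + kappa q M)) * norm₂ v ^ 2 ≤ bigConst p q M * norm₂ v ^ 2 := by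
      gcongr
      exact hK (by nlinarith)
    nlinarith [hb.one_le_bigConst, sq_nonneg (norm₂ v)]
  · exact hb.abs_sub_divCoeffGrad_le.trans (hK (by nlinarith))

theorem mul_norm₂_sq_le_gradForm {α₁ β : ℝ}
    (hcoer : ∀ v, α₁ * P.s z * (v ⬝ᵥ v) ≤ -(v ⬝ᵥ coeffPartials A z (.inl 0) *ᵥ v))
    (hsmall : P.s z ^ 2 * (M ^ 2 * ((q : ℝ) + 1) ^ 3) ≤ α₁ / 4)
    (hβ : 1 ≤ β - 3 + (p - P.divCoeffGrad A z)) (hδ : 8 * bigConst p q M ≤ P.δ)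
    (hδα : 6 * (4 * bigConst p q M ^ 4 + 7 * bigConst p q M ^ 2 + 7 * bigConst p q M) ≤ P.δ * α₁)
    (ξ : ℝ) (u : Fin p → ℝ) (v : Fin (q + 1) → ℝ) :
    1 / 2 * P.δ * α₁ * P.s z * (v ⬝ᵥ v)
      ≤ P.gradForm A z ξ u v - P.δ * (P.s z ^ 3)⁻¹ * ξ ^ 2 + (β - 1) * P.s z ^ 2 * (u ⬝ᵥ u) := by
  have hs := hb.s_pos
  have hK : 0 ≤ bigConst p q M := zero_le_one.trans hb.one_le_bigConst
  have hκK : kappa q M ≤ bigConst p q M := le_bigConst (by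
    nlinarith [hb.kappa_nonneg, mul_nonneg (p.cast_nonneg : (0 : ℝ) ≤ p) hb.kappa_nonneg,
      (p.cast_nonneg : (0 : ℝ) ≤ p)])
  have hcoer' := hcoer v
  rw [← norm₂_sq] at hcoer'
  have hmain := mul_le_mul_of_nonneg_left (le_quadratic_of_sq_le (ξ := ξ) hs hcoer'
    (hb.sq_dotProduct_rowDiv_le v) hsmall) (by linarith : 0 ≤ P.δ)
  have hlower := neg_mul_le_lower_order (ξ := ξ) hs hb.s_lt_one hK
    ((hb.abs_gradY_dotProduct_mulVec_le (hb.abs_coeffPartials_le (.inl 0)) v).trans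
      (mul_le_mul_of_nonneg_right hκK (norm₂_nonneg v)))
    (hb.abs_sub_divCoeffGrad_le.trans (le_bigConst (by
      nlinarith [hb.kappa_nonneg, mul_nonneg (p.cast_nonneg : (0 : ℝ) ≤ p) hb.kappa_nonneg])))
  have htangential := mul_le_mul_of_nonneg_left (hb.neg_mul_sq_le_tangential_part hβ u v)
    (sq_nonneg (P.s z))
  have hs2 : P.s z ^ 2 * ((4 * bigConst p q M ^ 4 + 7 * bigConst p q M ^ 2 + 6 * bigConst p q M)
      * norm₂ v ^ 2) ≤ P.s z * ((4 * bigConst p q M ^ 4 + 7 * bigConst p q M ^ 2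
      + 6 * bigConst p q M) * norm₂ v ^ 2) := by
    gcongr
    exact pow_le_of_le_one hs.le hb.s_lt_one.le two_ne_zero
  have hδξ : 8 * bigConst p q M * ((P.s z ^ 3)⁻¹ * ξ ^ 2) ≤ P.δ * ((P.s z ^ 3)⁻¹ * ξ ^ 2) := by
    gcongr
  have hδv := mul_le_mul_of_nonneg_right hδα (mul_nonneg hs.le (sq_nonneg (norm₂ v)))
  rw [Params.gradForm, ← norm₂_sq v, ← norm₂_sq u, ← norm₂_sq (coeffMatrix A z *ᵥ v)]
  linarith

end PointBounds

/-! ### Bounds for the potential -/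

section LinearPart

/-- The coefficient of `λ ν ψ^{-ν-1}` in `Params.potTotal`, as a polynomial in
`σ = s⁻¹`, `ρ = ψ⁻¹`, the symbol `Q`, its derivative `Q'`, `τ = s² (n - 1 - tr A)`, its derivative
`τ'`, the divergences `c` and `d`, and the squares `gx`, `gy` of the gradients of `ψ`. -/
noncomputable def linPot (p m δ ν α₁ β s σ ρ Q Q' τ τ' c d gx gy : ℝ) : ℝ :=
  -((-2 * δ * σ ^ 3 + c) * (-(ν + 1) * ρ * Q + τ)
      + σ ^ 2 * ((ν + 1) * (ν + 2) * ρ ^ 2 * Q ^ 2 - (ν + 1) * ρ * Q' - (ν + 1) * ρ * τ * Q + τ'))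
    - (3 * δ ^ 2 * σ ^ 4 + (β - 1) * s ^ 2 * p - 1 / 2 * δ * α₁ * s * m)
    + (ν + 1) * ρ * (-δ ^ 3 * σ ^ 3 + (β - 1) * s ^ 2 * gx - 1 / 2 * δ * α₁ * s * gy)
    + β * (-s ^ 2 * d + s ^ 2 * c - (ν + 1) * ρ * Q)

theorem exists_abs_linPot_le (p m δ ν α₁ β R : ℝ) :
    ∃ L, ∀ v : Fin 11 → ℝ, (∀ i, |v i| ≤ R) →
      |linPot p m δ ν α₁ β (v 0) (v 1) (v 2) (v 3) (v 4) (v 5) (v 6) (v 7) (v 8) (v 9) (v 10)|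
        ≤ L := by
  have hcompact : IsCompact (Set.univ.pi fun _ : Fin 11 => Set.Icc (-R) R) :=
    isCompact_univ_pi fun _ => isCompact_Icc
  obtain ⟨L, hL⟩ := hcompact.exists_bound_of_continuousOn (f := fun v : Fin 11 → ℝ =>
    linPot p m δ ν α₁ β (v 0) (v 1) (v 2) (v 3) (v 4) (v 5) (v 6) (v 7) (v 8) (v 9) (v 10))
    (by unfold linPot; fun_prop)
  exact ⟨L, fun v hv => hL v fun i _ => abs_le.mp (hv i)⟩

end LinearPart

section Potential

variable (P : Params p q) (A : Fin (q + 1) → Fin (q + 1) → Pt (p + 1) (q + 1) → ℝ)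
  (z : Pt (p + 1) (q + 1))

/-- `linPot` at the values of its arguments at the point `z`. -/
noncomputable def Params.linPotAt (α₁ β : ℝ) : ℝ :=
  linPot p (q + 1) P.δ P.ν α₁ β (P.s z) (P.s z)⁻¹ (P.psi z)⁻¹ (P.symbol A z) (P.symbolDeriv A z)
    (P.s z ^ 2 * (p - (coeffMatrix A z).trace)) (P.traceDeriv A z) (p - P.divCoeffGrad A z)
    (P.gradY z ⬝ᵥ rowDiv A z) (P.gradX z ⬝ᵥ P.gradX z) (P.gradY z ⬝ᵥ P.gradY z)

theorem Params.potTotal_eq {lam : ℝ} (hψ : 0 < P.psi z) (α₁ β : ℝ) :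
    P.potTotal A lam α₁ β z
      = P.slope lam z ^ 2
        * ((2 * P.δ * (P.s z ^ 3)⁻¹ - (p - P.divCoeffGrad A z + 2 * β)) * P.symbol A z
          + 2 * (P.ν + 1) * (P.s z ^ 2)⁻¹ * (P.psi z)⁻¹ * P.symbol A z ^ 2
          - (P.s z ^ 2)⁻¹ * P.symbolDeriv A z - P.δ ^ 3 * (P.s z ^ 3)⁻¹
          + (β - 1) * P.s z ^ 2 * (P.gradX z ⬝ᵥ P.gradX z)
          - 1 / 2 * P.δ * α₁ * P.s z * (P.gradY z ⬝ᵥ P.gradY z)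
          - 1 / 2 * P.ν * P.δ ^ 4 * (P.psi z)⁻¹)
      + P.slope lam z * P.linPotAt A z α₁ β
      + 1 / 2 * β * P.s z ^ 2 * ∑ k, ∑ j, dy k (dy j (A k j)) z := by
  rw [Params.potTotal, Params.potForm, Params.potForm₂, Params.potForm₃, bigPhi_eq, phi₁_eq hψ,
    Params.linPotAt, linPot]
  ring

theorem Params.symbolDeriv_eq :
    P.symbolDeriv A z = P.δ
      * (2 * P.s z * (P.gradX z ⬝ᵥ P.gradX z - P.gradY z ⬝ᵥ coeffMatrix A z *ᵥ P.gradY z)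
        - P.s z ^ 2 * (P.gradY z ⬝ᵥ coeffPartials A z (.inl 0) *ᵥ P.gradY z))
      + P.s z ^ 4 * (2 * (P.gradX z ⬝ᵥ P.gradX z
          + (coeffMatrix A z *ᵥ P.gradY z) ⬝ᵥ (coeffMatrix A z *ᵥ P.gradY z))
        + tangential (coeffMatrix A z) (P.gradX z) (P.gradY z)
          (fun K => P.gradY z ⬝ᵥ coeffPartials A z K *ᵥ P.gradY z)) := by
  rw [Params.symbolDeriv]
  ring

end Potential

namespace PointBounds

variable {P : Params p q} {A : Fin (q + 1) → Fin (q + 1) → Pt (p + 1) (q + 1) → ℝ}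
  {z : Pt (p + 1) (q + 1)} (hb : PointBounds P A M z)

include hb

theorem abs_s_pow_le_one (k : ℕ) : |P.s z ^ k| ≤ 1 := by
  rw [abs_of_pos (pow_pos hb.s_pos k)]
  exact pow_le_one₀ hb.s_pos.le hb.s_lt_one.le

theorem abs_gradX_dotProduct_self_le_one : |P.gradX z ⬝ᵥ P.gradX z| ≤ 1 := by
  rw [← norm₂_sq, abs_of_nonneg (sq_nonneg _)]
  exact pow_le_one₀ (norm₂_nonneg _) hb.norm₂_gradX_le_one

theorem abs_gradY_dotProduct_self_le_one : |P.gradY z ⬝ᵥ P.gradY z| ≤ 1 := by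
  rw [← norm₂_sq, abs_of_nonneg (sq_nonneg _)]
  exact pow_le_one₀ (norm₂_nonneg _) hb.norm₂_gradY_le_one

theorem abs_tangentialSymbol_le :
    |P.gradX z ⬝ᵥ P.gradX z - P.gradY z ⬝ᵥ coeffMatrix A z *ᵥ P.gradY z| ≤ 1 + kappa q M :=
  (abs_sub _ _).trans (add_le_add hb.abs_gradX_dotProduct_self_le_one
    (hb.abs_gradY_dotProduct_mulVec_gradY_le hb.abs_coeff_le))

theorem abs_tangentialSymbolDeriv_le :
    |2 * (P.gradX z ⬝ᵥ P.gradX z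
        + (coeffMatrix A z *ᵥ P.gradY z) ⬝ᵥ (coeffMatrix A z *ᵥ P.gradY z))
      + tangential (coeffMatrix A z) (P.gradX z) (P.gradY z)
        (fun K => P.gradY z ⬝ᵥ coeffPartials A z K *ᵥ P.gradY z)|
      ≤ 2 * (1 + kappa q M ^ 2) + kappa q M * (p + kappa q M) := by
  refine (abs_add_le _ _).trans (add_le_add ?_ (hb.abs_tangential_grad_le fun K =>
    hb.abs_gradY_dotProduct_mulVec_gradY_le (hb.abs_coeffPartials_le K)))
  rw [← norm₂_sq (coeffMatrix A z *ᵥ P.gradY z)]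
  refine abs_mul_le_mul abs_two.le ((abs_add_le _ _).trans
    (add_le_add hb.abs_gradX_dotProduct_self_le_one ?_))
  rw [abs_of_nonneg (sq_nonneg _)]
  exact pow_le_pow_left₀ (norm₂_nonneg _) ((norm₂_mulVec_le_kappa hb.nonneg hb.abs_coeff_le _).trans
    (mul_le_of_le_one_right hb.kappa_nonneg hb.norm₂_gradY_le_one)) 2

theorem abs_trace_le_kappa {B : Matrix (Fin (q + 1)) (Fin (q + 1)) ℝ} (hB : ∀ i j, |B i j| ≤ M) :
    |B.trace| ≤ kappa q M :=
  (abs_trace_le_card_mul hB).trans (card_mul_le_kappa hb.nonneg)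

theorem abs_sub_trace_le : |p - (coeffMatrix A z).trace| ≤ p + kappa q M := by
  refine (abs_sub _ _).trans ?_
  rw [Nat.abs_cast]
  exact add_le_add_right (hb.abs_trace_le_kappa hb.abs_coeff_le) _

theorem abs_symbol_le : |P.symbol A z| ≤ P.δ ^ 2 + (1 + kappa q M) := by
  refine (abs_add_le _ _).trans (add_le_add (abs_of_nonneg (sq_nonneg _)).le ?_)
  exact (abs_mul_le_mul (hb.abs_s_pow_le_one 2) hb.abs_tangentialSymbol_le).trans_eq (one_mul _)

theorem abs_normalDeriv_le {G a C₁ C₂ : ℝ} (hδ : 0 ≤ P.δ) (hG : |G| ≤ C₁) (ha : |a| ≤ C₂) :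
    |(2 * P.s z * G - P.s z ^ 2 * a) * P.δ| ≤ (2 * C₁ + C₂) * P.δ := by
  refine abs_mul_le_mul ((abs_sub _ _).trans (add_le_add ?_ ?_)) (abs_of_nonneg hδ).le
  · rw [mul_assoc]
    refine abs_mul_le_mul abs_two.le ((abs_mul_le_mul ?_ hG).trans_eq (one_mul _))
    simpa only [pow_one] using hb.abs_s_pow_le_one 1
  · exact (abs_mul_le_mul (hb.abs_s_pow_le_one 2) ha).trans_eq (one_mul _)

theorem abs_symbolDeriv_le (hδ : 0 ≤ P.δ) :
    |P.symbolDeriv A z| ≤ (2 * (1 + kappa q M) + kappa q M) * P.δ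
      + (2 * (1 + kappa q M ^ 2) + kappa q M * (p + kappa q M)) := by
  rw [P.symbolDeriv_eq A z, mul_comm P.δ]
  exact (abs_add_le _ _).trans (add_le_add
    (hb.abs_normalDeriv_le hδ hb.abs_tangentialSymbol_le
      (hb.abs_gradY_dotProduct_mulVec_gradY_le (hb.abs_coeffPartials_le _)))
    ((abs_mul_le_mul (hb.abs_s_pow_le_one 4) hb.abs_tangentialSymbolDeriv_le).trans_eq
      (one_mul _)))

theorem abs_traceDeriv_le (hδ : 0 ≤ P.δ) :
    |P.traceDeriv A z| ≤ (2 * (p + kappa q M) + kappa q M) * P.δ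
      + kappa q M * (p + kappa q M) :=
  (abs_add_le _ _).trans (add_le_add
    (hb.abs_normalDeriv_le hδ hb.abs_sub_trace_le
      (hb.abs_trace_le_kappa (hb.abs_coeffPartials_le _)))
    ((abs_mul_le_mul (hb.abs_s_pow_le_one 4) (hb.abs_tangential_grad_le fun K =>
      hb.abs_trace_le_kappa (hb.abs_coeffPartials_le K))).trans_eq (one_mul _)))

theorem abs_sum_dy_dy_le : |∑ k, ∑ j, dy k (dy j (A k j)) z| ≤ kappa q M := by
  refine (abs_sum_le_card_mul fun k => abs_sum_le_card_mul fun j => hb.abs_dy_dy_le k j).trans_eq ?_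
  rw [Fintype.card_fin, kappa]
  push_cast
  ring

theorem abs_linPotAt_le {α₁ β R L : ℝ} (hδ : 0 ≤ P.δ)
    (hR : bigConst p q M + bigConst p q M * P.δ + P.δ ^ 2 ≤ R) (hs : (P.s z)⁻¹ ≤ R)
    (hψ : (P.psi z)⁻¹ ≤ R)
    (hL : ∀ v : Fin 11 → ℝ, (∀ i, |v i| ≤ R) → |linPot p (q + 1) P.δ P.ν α₁ β (v 0) (v 1) (v 2)
      (v 3) (v 4) (v 5) (v 6) (v 7) (v 8) (v 9) (v 10)| ≤ L) :
    |P.linPotAt A z α₁ β| ≤ L := by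
  have hκ := hb.kappa_nonneg
  have hp : (0 : ℝ) ≤ p := p.cast_nonneg
  have hpκ := mul_nonneg hp hκ
  have hκ2 := sq_nonneg (kappa q M)
  have hK {a : ℝ} (ha : a ≤ 12 * (1 + p + 2 * kappa q M + 2 * (p * kappa q M) + kappa q M ^ 2)) :
      a ≤ bigConst p q M := le_bigConst ha
  have hKδ {a b : ℝ}
      (ha : a ≤ 12 * (1 + p + 2 * kappa q M + 2 * (p * kappa q M) + kappa q M ^ 2))
      (hab : b ≤ 12 * (1 + p + 2 * kappa q M + 2 * (p * kappa q M) + kappa q M ^ 2)) :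
      a * P.δ + b ≤ R := by
    linarith [mul_le_mul_of_nonneg_right (hK ha) hδ, hK hab, sq_nonneg P.δ]
  have hKR {a : ℝ} (ha : a ≤ 12 * (1 + p + 2 * kappa q M + 2 * (p * kappa q M) + kappa q M ^ 2)) :
      a ≤ R := by
    simpa only [zero_mul, zero_add] using hKδ (a := 0) (by linarith) ha
  refine hL ![P.s z, (P.s z)⁻¹, (P.psi z)⁻¹, P.symbol A z, P.symbolDeriv A z,
    P.s z ^ 2 * (p - (coeffMatrix A z).trace), P.traceDeriv A z, p - P.divCoeffGrad A z,
    P.gradY z ⬝ᵥ rowDiv A z, P.gradX z ⬝ᵥ P.gradX z, P.gradY z ⬝ᵥ P.gradY z] fun i => ?_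
  fin_cases i
  · exact (abs_of_pos hb.s_pos).le.trans (hKR (by linarith [hb.s_lt_one]))
  · exact (abs_of_pos (inv_pos.mpr hb.s_pos)).le.trans hs
  · exact (abs_of_pos (inv_pos.mpr hb.psi_pos)).le.trans hψ
  · refine hb.abs_symbol_le.trans ?_
    linarith [hK (a := 1 + kappa q M) (by linarith), mul_nonneg (hK (a := 0) (by linarith)) hδ]
  · exact (hb.abs_symbolDeriv_le hδ).trans (hKδ (by linarith) (by linarith))
  · exact (abs_mul_le_mul (hb.abs_s_pow_le_one 2) hb.abs_sub_trace_le).trans (hKR (by linarith))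
  · exact (hb.abs_traceDeriv_le hδ).trans (hKδ (by linarith) (by linarith))
  · exact hb.abs_sub_divCoeffGrad_le.trans (hKR (by linarith))
  · exact (hb.abs_dotProduct_rowDiv_le _).trans ((mul_le_of_le_one_right hκ
      hb.norm₂_gradY_le_one).trans (hKR (by linarith)))
  · exact hb.abs_gradX_dotProduct_self_le_one.trans (hKR (by linarith))
  · exact hb.abs_gradY_dotProduct_self_le_one.trans (hKR (by linarith))

theorem one_le_quadPot {α₁ β : ℝ} (hα : 0 < α₁) (hν : 0 < P.ν) (hβ : 1 ≤ β)
    (hβ' : β ≤ p + 3 + 5 * kappa q M) (hδ : 1 + 4 * bigConst p q M + α₁ ≤ P.δ) :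
    1 ≤ (2 * P.δ * (P.s z ^ 3)⁻¹ - (p - P.divCoeffGrad A z + 2 * β)) * P.symbol A z
      + 2 * (P.ν + 1) * (P.s z ^ 2)⁻¹ * (P.psi z)⁻¹ * P.symbol A z ^ 2
      - (P.s z ^ 2)⁻¹ * P.symbolDeriv A z - P.δ ^ 3 * (P.s z ^ 3)⁻¹
      + (β - 1) * P.s z ^ 2 * (P.gradX z ⬝ᵥ P.gradX z)
      - 1 / 2 * P.δ * α₁ * P.s z * (P.gradY z ⬝ᵥ P.gradY z)
      - 1 / 2 * P.ν * P.δ ^ 4 * (P.psi z)⁻¹ := by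
  have hκ := hb.kappa_nonneg
  have hp : (0 : ℝ) ≤ p := p.cast_nonneg
  have hpκ := mul_nonneg hp hκ
  have hκ2 := sq_nonneg (kappa q M)
  rw [P.symbolDeriv_eq A z]
  refine one_le_quadratic_potential hα hν hb.s_pos hb.s_lt_one hb.psi_pos hb.psi_lt_one
    (hb.abs_tangentialSymbol_le.trans (le_bigConst (by linarith)))
    ((hb.abs_gradY_dotProduct_mulVec_gradY_le (hb.abs_coeffPartials_le _)).trans
      (le_bigConst (by linarith)))
    (hb.abs_tangentialSymbolDeriv_le.trans (le_bigConst (by linarith))) ?_ hβ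
    (norm₂_sq (P.gradX z) ▸ sq_nonneg _) (le_of_abs_le hb.abs_gradY_dotProduct_self_le_one) hδ rfl
  refine (abs_add_le _ _).trans ((add_le_add hb.abs_sub_divCoeffGrad_le
    (abs_of_nonneg (by linarith)).le).trans (le_bigConst (by linarith)))

theorem potTotal_nonneg {lam α₁ β L : ℝ} (hα : 0 < α₁) (hν : 0 < P.ν) (hβ : 1 ≤ β)
    (hβ' : β ≤ p + 3 + 5 * kappa q M) (hδ : 1 + 4 * bigConst p q M + α₁ ≤ P.δ)
    (hL : |P.linPotAt A z α₁ β| ≤ L)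
    (hlam : 1 + L + bigConst p q M * kappa q M ≤ P.slope lam z) :
    0 ≤ P.potTotal A lam α₁ β z := by
  have hκ := hb.kappa_nonneg
  have hp : (0 : ℝ) ≤ p := p.cast_nonneg
  have hpκ := mul_nonneg hp hκ
  have hκ2 := sq_nonneg (kappa q M)
  have hzero : -(bigConst p q M * kappa q M)
      ≤ 1 / 2 * β * P.s z ^ 2 * ∑ k, ∑ j, dy k (dy j (A k j)) z := by
    refine neg_le_of_abs_le (abs_mul_le_mul ((abs_mul_le_mul (abs_of_nonneg (by linarith)).le
      (hb.abs_s_pow_le_one 2)).trans (le_bigConst (by linarith))) hb.abs_sum_dy_dy_le)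
  have hKκ := mul_nonneg (zero_le_one.trans hb.one_le_bigConst) hκ
  have hw : 1 ≤ P.slope lam z := by linarith [(abs_nonneg _).trans hL]
  have hquad := mul_le_mul_of_nonneg_left (hb.one_le_quadPot hα hν hβ hβ' hδ)
    (sq_nonneg (P.slope lam z))
  have hlin := mul_le_mul_of_nonneg_left (neg_le_of_abs_le hL) (zero_le_one.trans hw)
  have hslope := mul_le_mul_of_nonneg_left hlam (zero_le_one.trans hw)
  rw [P.potTotal_eq A z hb.psi_pos]
  linarith [mul_le_mul_of_nonneg_right hw hKκ]

end PointBounds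

/-! ### The coefficients on `Ω_γ` -/

section Symmetrization

variable {n m : ℕ} {κ : Type*}

/-- The symmetric part of a matrix of coefficients, in the original variables. -/
noncomputable def symmetrize (a : κ → κ → Pt n m → ℝ) (i j : κ) (v : Pt n m) : ℝ :=
  (a i j v + a j i v) / 2

variable {a : κ → κ → Pt n m → ℝ} {U : Set (Pt n m)} {v : Pt n m}

theorem symmetrize_comm (a : κ → κ → Pt n m → ℝ) (i j : κ) :
    symmetrize a i j = symmetrize a j i := by
  funext v
  simp only [symmetrize, add_comm]

theorem abs_symmetrize_le (h : ∀ i j, |a i j v| ≤ M) (i j : κ) : |symmetrize a i j v| ≤ M := by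
  have hij := abs_le.mp (h i j)
  have hji := abs_le.mp (h j i)
  exact abs_le.mpr ⟨by unfold symmetrize; linarith, by unfold symmetrize; linarith⟩

theorem sum_symmetrize_mul [Fintype κ] {H : κ → κ → ℝ} (hH : ∀ i j, H i j = H j i) :
    ∑ i, ∑ j, symmetrize a i j v * H i j = ∑ i, ∑ j, a i j v * H i j := by
  have hswap : ∑ i, ∑ j, a j i v * H i j = ∑ i, ∑ j, a i j v * H i j := by
    rw [Finset.sum_comm]
    simp only [hH]
  have hsplit : ∑ i, ∑ j, symmetrize a i j v * H i j
      = ((∑ i, ∑ j, a i j v * H i j) + ∑ i, ∑ j, a j i v * H i j) / 2 := by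
    simp only [symmetrize, ← Finset.sum_add_distrib, Finset.sum_div, add_mul, div_mul_eq_mul_div]
  rw [hsplit, hswap, add_self_div_two]

theorem contDiffOn_symmetrize {k : WithTop ℕ∞} (ha : ∀ i j, ContDiffOn ℝ k (a i j) U) (i j : κ) :
    ContDiffOn ℝ k (symmetrize a i j) U :=
  ((ha i j).add (ha j i)).div_const 2

theorem fderiv_symmetrize {i j : κ} (hij : DifferentiableAt ℝ (a i j) v)
    (hji : DifferentiableAt ℝ (a j i) v) (d : Pt n m) :
    fderiv ℝ (symmetrize a i j) v d = symmetrize (fun i j w => fderiv ℝ (a i j) w d) i j v := by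
  have h := (hij.hasFDerivAt.add hji.hasFDerivAt).mul_const (2⁻¹ : ℝ)
  rw [HasFDerivAt.fderiv (f := symmetrize a i j) h, symmetrize]
  simp only [FunLike.coe_smul, FunLike.coe_add, Pi.smul_apply, Pi.add_apply, smul_eq_mul]
  ring

theorem fderiv_fderiv_symmetrize {i j : κ} (hij : ContDiffAt ℝ 2 (a i j) v)
    (hji : ContDiffAt ℝ 2 (a j i) v) (d d' : Pt n m) :
    fderiv ℝ (fun w => fderiv ℝ (symmetrize a i j) w d) v d'
      = symmetrize (fun i j w => fderiv ℝ (fun w => fderiv ℝ (a i j) w d) w d') i j v := by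
  have hev : (fun w => fderiv ℝ (symmetrize a i j) w d)
      =ᶠ[nhds v] symmetrize (fun i j w => fderiv ℝ (a i j) w d) i j := by
    filter_upwards [hij.eventually (by simp), hji.eventually (by simp)] with w hij' hji'
    exact fderiv_symmetrize (hij'.differentiableAt two_ne_zero)
      (hji'.differentiableAt two_ne_zero) d
  rw [hev.fderiv_eq]
  exact fderiv_symmetrize (differentiableAt_fderiv_apply hij d)
    (differentiableAt_fderiv_apply hji d) d'

theorem C2NormLE.symmetrize (hU : IsOpen U) (ha : ∀ i j, ContDiffOn ℝ 2 (a i j) U)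
    (haM : ∀ i j, C2NormLE U (a i j) M) (i j : κ) :
    C2NormLE U (UltraCarleman.symmetrize a i j) M := by
  intro v hv
  have hc : ∀ i j, ContDiffAt ℝ 2 (a i j) v := fun i j => (ha i j).contDiffAt (hU.mem_nhds hv)
  have hd : ∀ i j, DifferentiableAt ℝ (a i j) v := fun i j =>
    (hc i j).differentiableAt two_ne_zero
  have first (d : Pt n m) (h : ∀ i j, |fderiv ℝ (a i j) v d| ≤ M) :
      |fderiv ℝ (UltraCarleman.symmetrize a i j) v d| ≤ M := by
    rw [fderiv_symmetrize (hd i j) (hd j i)]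
    exact abs_symmetrize_le h i j
  have second (d d' : Pt n m) (h : ∀ i j, |fderiv ℝ (fun w => fderiv ℝ (a i j) w d) v d'| ≤ M) :
      |fderiv ℝ (fun w => fderiv ℝ (UltraCarleman.symmetrize a i j) w d) v d'| ≤ M := by
    rw [fderiv_fderiv_symmetrize (hc i j) (hc j i)]
    exact abs_symmetrize_le h i j
  exact ⟨abs_symmetrize_le (fun i j => (haM i j v hv).1) i j,
    fun k => first _ fun i j => (haM i j v hv).2.1 k,
    fun k => first _ fun i j => (haM i j v hv).2.2.1 k,
    fun k l => second _ _ fun i j => (haM i j v hv).2.2.2.1 k l,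
    fun k l => second _ _ fun i j => (haM i j v hv).2.2.2.2.1 k l,
    fun k l => second _ _ fun i j => (haM i j v hv).2.2.2.2.2 k l⟩

theorem sum_fderiv_symmetrize_mul_mul [Fintype κ] (ha : ∀ i j, DifferentiableAt ℝ (a i j) v)
    (d : Pt n m) (ξ : κ → ℝ) :
    ∑ i, ∑ j, fderiv ℝ (symmetrize a i j) v d * ξ i * ξ j
      = ∑ i, ∑ j, fderiv ℝ (a i j) v d * ξ i * ξ j := by
  simp only [fderiv_symmetrize (ha _ _) (ha _ _), mul_assoc]
  exact sum_symmetrize_mul (a := fun i j w => fderiv ℝ (a i j) w d) fun i j => mul_comm _ _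

end Symmetrization

section Coefficients

variable {P : Params p q} {z : Pt (p + 1) (q + 1)}

theorem symPart_tilde (P : Params p q) (a : Fin (q + 1) → Fin (q + 1) → Pt (p + 1) q → ℝ) :
    symPart (P.tilde a) = P.tilde (symmetrize a) :=
  rfl

theorem L₀_tilde_symmetrize {a : Fin (q + 1) → Fin (q + 1) → Pt (p + 1) q → ℝ}
    {φ : Pt (p + 1) (q + 1) → ℝ} (hφ : ContDiffAt ℝ 2 φ z) :
    P.L₀ (P.tilde (symmetrize a)) φ z = P.L₀ (P.tilde a) φ z := by
  unfold Params.L₀ Params.tilde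
  rw [sum_symmetrize_mul (H := fun i j => dy i (dy j φ) z)
    fun i j => fderiv_fderiv_comm hφ _ _]

section Orig

theorem contDiff_orig : ContDiff ℝ 2 P.orig := by
  have hs : ContDiff ℝ 2 P.s := by unfold Params.s; fun_prop
  refine ContDiff.prodMk (contDiff_pi.mpr fun i => ?_) (contDiff_pi.mpr fun j => ?_)
  · refine Fin.cases ?_ (fun r => ?_) i
    · simp only [Function.update_self]; fun_prop
    · simp only [Function.update_of_ne (Fin.succ_ne_zero r)]; fun_prop
  · simp only [Fin.init]; fun_prop

theorem hasPartials_orig :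
    HasPartials dir P.orig
      (fun K => (Function.update (dir K).1 0 (P.s z * (dir K).1 0), Fin.init (dir K).2)) z := by
  refine HasPartials.prodMk (HasPartials.pi_iff.mpr fun i => ?_)
    (HasPartials.pi_iff.mpr fun j => HasPartials.pi_iff.mp hasPartials_snd j.castSucc)
  refine Fin.cases ?_ (fun r => ?_) i
  · simp only [Function.update_self]
    refine ((HasPartials.const (1 / 2)).mul (P.hasPartials_s z).sq).congr_partials
      (forall_idx ?_ (fun r => ?_) fun k => ?_) <;> simp [dir]
  · simp only [Function.update_of_ne (Fin.succ_ne_zero r)]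
    exact HasPartials.pi_iff.mp hasPartials_fst r.succ

variable {b : Pt (p + 1) q → ℝ}

theorem dx_zero_comp_orig (hb : DifferentiableAt ℝ b (P.orig z)) :
    dx 0 (fun w => b (P.orig w)) z = P.s z * dx 0 b (P.orig z) := by
  refine (hasPartials_orig.fderiv_comp hb (.inl 0)).trans ?_
  refine (congrArg _ (Prod.ext ?_ ?_)).trans (map_smul (fderiv ℝ b (P.orig z)) (P.s z) _)
  · ext i
    cases i using Fin.cases <;> simp [dir]
  · ext j
    simp [dir, Fin.init]

theorem dx_succ_comp_orig (hb : DifferentiableAt ℝ b (P.orig z)) (r : Fin p) :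
    dx r.succ (fun w => b (P.orig w)) z = dx r.succ b (P.orig z) := by
  refine (hasPartials_orig.fderiv_comp hb (.inl r.succ)).trans (congrArg _ (Prod.ext ?_ rfl))
  simp [dir]

theorem dy_castSucc_comp_orig (hb : DifferentiableAt ℝ b (P.orig z)) (k : Fin q) :
    dy k.castSucc (fun w => b (P.orig w)) z = dy k b (P.orig z) := by
  refine (hasPartials_orig.fderiv_comp hb (.inr k.castSucc)).trans (congrArg _ (Prod.ext ?_ ?_))
  · simp [dir]
  · ext j
    simp [dir, Fin.init, Pi.single_apply]

theorem dy_last_comp_orig (hb : DifferentiableAt ℝ b (P.orig z)) :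
    dy (Fin.last q) (fun w => b (P.orig w)) z = 0 := by
  refine (hasPartials_orig.fderiv_comp hb (.inr (Fin.last q))).trans
    ((congrArg _ (Prod.ext ?_ ?_)).trans (map_zero _))
  · simp [dir]
  · ext j
    simp [dir, Fin.init, (Fin.castSucc_lt_last j).ne]

theorem abs_fderiv_comp_orig_le (hM : 0 ≤ M) (hs : |P.s z| ≤ 1)
    (hb : DifferentiableAt ℝ b (P.orig z)) (hx : ∀ i, |dx i b (P.orig z)| ≤ M)
    (hy : ∀ j, |dy j b (P.orig z)| ≤ M) (K : Idx p q) :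
    |fderiv ℝ (fun w => b (P.orig w)) z (dir K)| ≤ M := by
  refine forall_idx (C := fun K => |fderiv ℝ (fun w => b (P.orig w)) z (dir K)| ≤ M)
    ?_ (fun r => ?_) (Fin.lastCases ?_ fun k => ?_) K
  · refine (abs_eq_abs.mpr (.inl (dx_zero_comp_orig hb))).trans_le ?_
    rw [abs_mul]
    exact (mul_le_of_le_one_left (abs_nonneg _) hs).trans (hx 0)
  · exact (abs_eq_abs.mpr (.inl (dx_succ_comp_orig hb r))).trans_le (hx r.succ)
  · exact (abs_eq_abs.mpr (.inl (dy_last_comp_orig hb))).trans_le (abs_zero.trans_le hM)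
  · exact (abs_eq_abs.mpr (.inl (dy_castSucc_comp_orig hb k))).trans_le (hy k)

theorem abs_dy_dy_comp_orig_le (hM : 0 ≤ M) (hs : |P.s z| ≤ 1) (hb : ContDiffAt ℝ 2 b (P.orig z))
    (hxy : ∀ i j, |dx i (dy j b) (P.orig z)| ≤ M) (hyy : ∀ k j, |dy k (dy j b) (P.orig z)| ≤ M)
    (k j : Fin (q + 1)) : |dy k (dy j (fun w => b (P.orig w))) z| ≤ M := by
  have hdiff : ∀ᶠ w in nhds z, DifferentiableAt ℝ b (P.orig w) :=
    (contDiff_orig (P := P)).continuous.continuousAt.eventually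
      ((hb.eventually (by simp)).mono fun v hv => hv.differentiableAt two_ne_zero)
  refine Fin.lastCases ?_ (fun j => ?_) j
  · rw [dy, Filter.EventuallyEq.fderiv_eq (hdiff.mono fun w hw => dy_last_comp_orig hw)]
    simpa using hM
  · rw [dy, Filter.EventuallyEq.fderiv_eq (hdiff.mono fun w hw => dy_castSucc_comp_orig hw j)]
    exact abs_fderiv_comp_orig_le hM hs (differentiableAt_fderiv_apply hb _)
      (fun i => hxy i j) (fun k => hyy k j) (.inr k)

end Orig

section Domain

theorem isOpen_omega (P : Params p q) : IsOpen P.omega := by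
  have hψ₀ : Continuous P.psi₀ := by unfold Params.psi₀; fun_prop
  have hx₁ : Continuous fun z : Pt (p + 1) (q + 1) => z.1 0 := by fun_prop
  exact (isOpen_lt continuous_const hx₁).inter
    ((isOpen_lt continuous_const hψ₀).inter (isOpen_lt hψ₀ continuous_const))

variable (hz : z ∈ P.omega)

include hz

theorem grad_sq_add_lt_of_mem_omega :
    P.δ * z.1 0 + 1 / 2 * (norm₂ (P.gradX z) ^ 2 + norm₂ (P.gradY z) ^ 2) < P.γ := by
  have hψ := P.psi_eq z
  rw [norm₂_sq, norm₂_sq]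
  linarith [hz.2.2, show P.psi z = P.psi₀ z + P.α₀ from rfl]

theorem norm₂_grad_le_one_of_mem_omega (hδ : 0 ≤ P.δ) (hγ : P.γ ≤ 1 / 2) :
    norm₂ (P.gradX z) ≤ 1 ∧ norm₂ (P.gradY z) ≤ 1 := by
  have h := grad_sq_add_lt_of_mem_omega hz
  have hx := mul_nonneg hδ hz.1.le
  constructor <;> refine le_of_sq_le_sq ?_ zero_le_one <;>
    nlinarith [sq_nonneg (norm₂ (P.gradX z)), sq_nonneg (norm₂ (P.gradY z))]

theorem s_le_of_mem_omega (hδ : 4 ≤ P.δ) : P.s z ≤ 3 / 4 * P.γ := by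
  have h := grad_sq_add_lt_of_mem_omega hz
  have hx := mul_le_mul_of_nonneg_right hδ hz.1.le
  have hη : P.eta₀ ≤ P.γ / 2 := by
    unfold Params.eta₀
    linarith [min_le_right P.α₀ P.γ]
  unfold Params.s
  linarith [sq_nonneg (norm₂ (P.gradX z)), sq_nonneg (norm₂ (P.gradY z))]

theorem eta₀_le_s_of_mem_omega : P.eta₀ ≤ P.s z :=
  le_add_of_nonneg_left hz.1.le

theorem α₀_le_psi_of_mem_omega : P.α₀ ≤ P.psi z :=
  le_add_of_nonneg_left hz.2.1.le

theorem psi_lt_of_mem_omega : P.psi z < P.γ + P.α₀ :=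
  add_lt_add_left hz.2.2 _

end Domain

section Tilde

variable {U : Set (Pt (p + 1) q)} {b : Fin (q + 1) → Fin (q + 1) → Pt (p + 1) q → ℝ}

theorem contDiffAt_tilde {i j : Fin (q + 1)} (hb : ContDiffAt ℝ 2 (b i j) (P.orig z)) :
    ContDiffAt ℝ 2 (P.tilde b i j) z :=
  hb.comp z contDiff_orig.contDiffAt

theorem eta₀_pos (hα₀ : 0 < P.α₀) (hγ : 0 < P.γ) : 0 < P.eta₀ :=
  half_pos (lt_min hα₀ hγ)

theorem pointBounds_tilde (hb : ∀ i j, ContDiffAt ℝ 2 (b i j) (P.orig z))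
    (hbM : ∀ i j, C2NormLE U (b i j) M) (hδ : 4 ≤ P.δ) (hα₀ : 0 < P.α₀) (hγ : 0 < P.γ)
    (hγ' : P.γ ≤ 1 / 2) (hγα : P.γ + P.α₀ < 1) (hz : z ∈ P.omega) (hzU : P.orig z ∈ U) :
    PointBounds P (P.tilde b) M z := by
  have hM : 0 ≤ M := (abs_nonneg _).trans (hbM 0 0 _ hzU).1
  have hs : 0 < P.s z := (eta₀_pos hα₀ hγ).trans_le (eta₀_le_s_of_mem_omega hz)
  have hs' : P.s z < 1 := by linarith [s_le_of_mem_omega hz hδ]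
  have hsabs : |P.s z| ≤ 1 := abs_le.mpr ⟨by linarith, hs'.le⟩
  have hgrad := norm₂_grad_le_one_of_mem_omega hz (by linarith) hγ'
  exact
    { s_pos := hs
      s_lt_one := hs'
      psi_pos := hα₀.trans_le (α₀_le_psi_of_mem_omega hz)
      psi_lt_one := (psi_lt_of_mem_omega hz).trans hγα
      norm₂_gradX_le_one := hgrad.1
      norm₂_gradY_le_one := hgrad.2
      abs_coeff_le := fun i j => (hbM i j _ hzU).1
      abs_coeffPartials_le := fun K i j => abs_fderiv_comp_orig_le hM hsabs
        ((hb i j).differentiableAt two_ne_zero) (hbM i j _ hzU).2.1 (hbM i j _ hzU).2.2.1 K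
      abs_dy_dy_le := fun k j => abs_dy_dy_comp_orig_le hM hsabs (hb k j)
        (hbM k j _ hzU).2.2.2.2.1 (hbM k j _ hzU).2.2.2.2.2 k j }

theorem mul_le_neg_coeffPartials_tilde {α₁ : ℝ}
    (hb : ∀ i j, DifferentiableAt ℝ (b i j) (P.orig z)) (hs : 0 ≤ P.s z)
    (hcoer : ∀ ξ : Fin (q + 1) → ℝ,
      α₁ * ∑ i, ξ i ^ 2 ≤ -∑ i, ∑ j, dx 0 (b i j) (P.orig z) * ξ i * ξ j)
    (v : Fin (q + 1) → ℝ) :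
    α₁ * P.s z * (v ⬝ᵥ v) ≤ -(v ⬝ᵥ coeffPartials (P.tilde b) z (.inl 0) *ᵥ v) := by
  have hform : v ⬝ᵥ coeffPartials (P.tilde b) z (.inl 0) *ᵥ v
      = P.s z * ∑ i, ∑ j, dx 0 (b i j) (P.orig z) * v i * v j := by
    simp only [dotProduct, Matrix.mulVec, Finset.mul_sum, coeffPartials, Matrix.of_apply]
    refine Finset.sum_congr rfl fun i _ => Finset.sum_congr rfl fun j _ => ?_
    rw [show fderiv ℝ (P.tilde b i j) z (dir (.inl 0)) = _ from dx_zero_comp_orig (hb i j)]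
    ring
  rw [hform]
  have h := mul_le_mul_of_nonneg_left (hcoer v) hs
  simp only [dotProduct, ← sq]
  linarith

end Tilde

end Coefficients

section SmallGamma

theorem sq_mul_lt_of_lt_rpow {c γ X : ℝ} (hγ : 0 ≤ γ) (hX : 0 < X)
    (h : γ < c * X ^ (-(1 / 2) : ℝ)) : γ ^ 2 * X < c ^ 2 := by
  have hsq : (X ^ (-(1 / 2) : ℝ)) ^ 2 = X⁻¹ := by
    rw [← Real.rpow_mul_natCast hX.le]; norm_num [Real.rpow_neg_one]
  calc γ ^ 2 * X < (c * X ^ (-(1 / 2) : ℝ)) ^ 2 * X := by gcongr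
    _ = c ^ 2 := by rw [mul_pow, hsq, mul_assoc, inv_mul_cancel₀ hX.ne', mul_one]

theorem sq_mul_le_of_lt_rpow {α₁ M m ε₀ γ : ℝ} (hM : 0 < M) (hm : 0 < m)
    (hε : 0 < ε₀) (hε' : ε₀ < α₁ / (4 * m)) (hγ : 0 ≤ γ)
    (h : γ < 4 / 3 * (M * (M * m ^ 2 * ε₀⁻¹ + m ^ 2 + m * (m + 1))) ^ (-(1 / 2) : ℝ)) :
    (3 / 4 * γ) ^ 2 * (M ^ 2 * m ^ 3) ≤ α₁ / 4 := by
  have hsq := sq_mul_lt_of_lt_rpow hγ (by positivity) h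
  have hεm : ε₀ * (4 * m) ≤ α₁ := ((lt_div_iff₀ (by positivity)).mp hε').le
  have hdrop : γ ^ 2 * (M ^ 2 * m ^ 2 * ε₀⁻¹)
      ≤ γ ^ 2 * (M * (M * m ^ 2 * ε₀⁻¹ + m ^ 2 + m * (m + 1))) := by
    have : 0 ≤ M * (m ^ 2 + m * (m + 1)) := by positivity
    exact mul_le_mul_of_nonneg_left (by linarith) (sq_nonneg γ)
  calc (3 / 4 * γ) ^ 2 * (M ^ 2 * m ^ 3)
      = 9 / 64 * (γ ^ 2 * (M ^ 2 * m ^ 2 * ε₀⁻¹)) * (ε₀ * (4 * m)) := by field_simp; ring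
    _ ≤ 9 / 64 * (4 / 3) ^ 2 * α₁ := by gcongr; exact hdrop.trans hsq.le
    _ = α₁ / 4 := by ring

end SmallGamma

/-! ### The thresholds for `δ` and `λ` -/

variable {α₁ β γ : ℝ}

section Beta

theorem beta₀_eq (p q : ℕ) (M γ : ℝ) :
    beta₀ (p + 1) (q + 1) M γ
      = p + 3 + ((q : ℝ) + 1) * M + kappa q M * (1 + 3 * √(2 * γ)) := by
  rw [beta₀, kappa]
  push_cast
  ring

theorem le_beta₀ (hM : 0 ≤ M) (γ : ℝ) :
    p + 3 + ((q : ℝ) + 1) * M + kappa q M ≤ beta₀ (p + 1) (q + 1) M γ := by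
  rw [beta₀_eq]
  linarith [mul_nonneg (kappa_nonneg (q := q) hM) (Real.sqrt_nonneg (2 * γ))]

theorem beta₀_le (hM : 0 ≤ M) (hγ : γ ≤ 1 / 2) :
    beta₀ (p + 1) (q + 1) M γ ≤ p + 3 + 5 * kappa q M := by
  have hsqrt : √(2 * γ) ≤ 1 := by rw [Real.sqrt_le_one]; linarith
  rw [beta₀_eq]
  linarith [mul_le_mul_of_nonneg_left hsqrt (kappa_nonneg (q := q) hM),
    card_mul_le_kappa (q := q) hM]

theorem one_le_beta₀ (hM : 0 ≤ M) (γ : ℝ) : 1 ≤ beta₀ (p + 1) (q + 1) M γ := by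
  have := le_beta₀ (p := p) (q := q) hM γ
  have : (0 : ℝ) ≤ p := p.cast_nonneg
  have : 0 ≤ ((q : ℝ) + 1) * M := by positivity
  linarith [kappa_nonneg (q := q) hM]

theorem beta₀_le_bigConst (hM : 0 ≤ M) (hγ : γ ≤ 1 / 2) :
    beta₀ (p + 1) (q + 1) M γ ≤ bigConst p q M := by
  have hκ := kappa_nonneg (q := q) hM
  have hp : (0 : ℝ) ≤ p := p.cast_nonneg
  have hpκ := mul_nonneg hp hκ
  exact le_bigConst (by linarith [beta₀_le (p := p) (q := q) hM hγ, sq_nonneg (kappa q M)])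

end Beta

section Delta

/-- The threshold `δ_*`: beyond it, the terms produced by `∂a/∂x₁` and by `δ⁴ s⁻²` dominate all
other terms of the energy identity. -/
noncomputable def deltaStar (p q : ℕ) (α₁ M : ℝ) : ℝ :=
  5 + α₁ + 12 * bigConst p q M + (6 * (4 * bigConst p q M ^ 4 + 7 * bigConst p q M ^ 2
    + 7 * bigConst p q M) + 2 * (1 + bigConst p q M * kappa q M)) / α₁

theorem bigConst_nonneg (p q : ℕ) (M : ℝ) : 0 ≤ bigConst p q M := by
  unfold bigConst
  positivity

theorem add_le_of_deltaStar_lt (hα₁ : 0 < α₁) (hM : 0 ≤ M) {δ : ℝ}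
    (hδ : deltaStar p q α₁ M < δ) : 5 + α₁ + 12 * bigConst p q M ≤ δ := by
  have hK := bigConst_nonneg p q M
  have hκ := kappa_nonneg (q := q) hM
  refine le_trans (le_add_of_nonneg_right ?_) hδ.le
  positivity

theorem add_le_mul_of_deltaStar_lt (hα₁ : 0 < α₁) {δ : ℝ} (hδ : deltaStar p q α₁ M < δ) :
    6 * (4 * bigConst p q M ^ 4 + 7 * bigConst p q M ^ 2 + 7 * bigConst p q M)
      + 2 * (1 + bigConst p q M * kappa q M) ≤ δ * α₁ := by
  have hK := bigConst_nonneg p q M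
  refine (div_le_iff₀ hα₁).mp (le_trans (le_add_of_nonneg_left ?_) hδ.le)
  positivity

theorem deltaStar_pos (hα₁ : 0 < α₁) (hM : 0 ≤ M) : 0 < deltaStar p q α₁ M := by
  have hK := bigConst_nonneg p q M
  have hκ := kappa_nonneg (q := q) hM
  unfold deltaStar
  positivity

end Delta

section PointBounds

variable {P : Params p q} {A : Fin (q + 1) → Fin (q + 1) → Pt (p + 1) (q + 1) → ℝ}
  {z : Pt (p + 1) (q + 1)} (hb : PointBounds P A M z)

include hb

theorem PointBounds.mul_dotProduct_add_le (hβ : 0 ≤ β) (hβK : β ≤ bigConst p q M)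
    (hδα : 2 * (1 + bigConst p q M * kappa q M) ≤ P.δ * α₁) (v : Fin (q + 1) → ℝ) :
    P.s z * (v ⬝ᵥ v) + β * P.s z ^ 2 * (v ⬝ᵥ coeffMatrix A z *ᵥ v)
      ≤ 1 / 2 * P.δ * α₁ * P.s z * (v ⬝ᵥ v) := by
  have hs := hb.s_pos
  have hK := bigConst_nonneg p q M
  have hκ := hb.kappa_nonneg
  have hform : v ⬝ᵥ coeffMatrix A z *ᵥ v ≤ kappa q M * (v ⬝ᵥ v) := by
    rw [← norm₂_sq, sq]
    exact le_of_abs_le (abs_dotProduct_mulVec_le_kappa hb.nonneg hb.abs_coeff_le v v)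
  have hs2 : P.s z ^ 2 ≤ P.s z := pow_le_of_le_one hs.le hb.s_lt_one.le two_ne_zero
  have hv : 0 ≤ v ⬝ᵥ v := norm₂_sq v ▸ sq_nonneg _
  calc P.s z * (v ⬝ᵥ v) + β * P.s z ^ 2 * (v ⬝ᵥ coeffMatrix A z *ᵥ v)
      ≤ P.s z * (v ⬝ᵥ v) + β * P.s z ^ 2 * (kappa q M * (v ⬝ᵥ v)) := by gcongr
    _ ≤ P.s z * (v ⬝ᵥ v) + bigConst p q M * P.s z * (kappa q M * (v ⬝ᵥ v)) := by gcongr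
    _ = 2 * (1 + bigConst p q M * kappa q M) * (P.s z * (v ⬝ᵥ v)) / 2 := by ring
    _ ≤ P.δ * α₁ * (P.s z * (v ⬝ᵥ v)) / 2 := by gcongr
    _ = 1 / 2 * P.δ * α₁ * P.s z * (v ⬝ᵥ v) := by ring

theorem PointBounds.mul_le_slope {lam : ℝ} (hlam : 0 ≤ lam) (hν : 0 < P.ν) :
    lam * P.ν ≤ P.slope lam z :=
  le_mul_of_one_le_right (mul_nonneg hlam hν.le)
    (Real.one_le_rpow_of_pos_of_le_one_of_nonpos hb.psi_pos hb.psi_lt_one.le (by linarith))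

end PointBounds

theorem exists_forall_potTotal_nonneg {α₀ δ ν : ℝ} (hα₁ : 0 < α₁) (hν : 0 < ν) (hM : 0 ≤ M)
    (hα₀ : 0 < α₀) (hγ : 0 < γ) (hβ : 1 ≤ β) (hβ' : β ≤ p + 3 + 5 * kappa q M)
    (hδ : 1 + 4 * bigConst p q M + α₁ ≤ δ) :
    ∃ lamstar : ℝ, 0 < lamstar ∧ ∀ x₀ y₀, ∀ P : Params p q, P = ⟨γ, α₀, δ, ν, x₀, y₀⟩ →
      ∀ A, ∀ z ∈ P.omega, PointBounds P A M z → ∀ lam, lamstar < lam →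
        0 ≤ P.potTotal A lam α₁ β z := by
  have hK := bigConst_nonneg p q M
  have hκ := kappa_nonneg (q := q) hM
  have hδ0 : 0 ≤ δ := by linarith
  have hη : 0 < min α₀ γ / 2 := half_pos (lt_min hα₀ hγ)
  obtain ⟨R, hR⟩ : ∃ R, R = bigConst p q M + bigConst p q M * δ + δ ^ 2 + (min α₀ γ / 2)⁻¹
    + α₀⁻¹ := ⟨_, rfl⟩
  have hKδ : 0 ≤ bigConst p q M + bigConst p q M * δ + δ ^ 2 := by positivity
  have hη' := inv_pos.mpr hη
  have hα₀' := inv_pos.mpr hα₀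
  obtain ⟨L, hL⟩ := exists_abs_linPot_le p (q + 1) δ ν α₁ β R
  refine ⟨(1 + |L| + bigConst p q M * kappa q M) / ν, by positivity, ?_⟩
  rintro x₀ y₀ P rfl A z hz hb lam hlam
  refine hb.potTotal_nonneg hα₁ hν hβ hβ' hδ ((hb.abs_linPotAt_le (R := R) hδ0 ?_ ?_ ?_ hL).trans
    (le_abs_self L)) ?_
  · linarith
  · exact (inv_anti₀ hη (eta₀_le_s_of_mem_omega hz)).trans (by linarith)
  · exact (inv_anti₀ hα₀ (α₀_le_psi_of_mem_omega hz)).trans (by linarith)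
  · have hlam0 : 0 ≤ lam := le_trans (by positivity) hlam.le
    exact ((div_le_iff₀ hν).mp hlam.le).trans (hb.mul_le_slope hlam0 hν)

theorem carleman_tilde {P : Params p q} {b : Fin (q + 1) → Fin (q + 1) → Pt (p + 1) q → ℝ}
    {lam : ℝ} {φ : Pt (p + 1) (q + 1) → ℝ} {z : Pt (p + 1) (q + 1)} (hp : 1 ≤ p) (hα₁ : 0 < α₁)
    (hν : 0 < P.ν) (hγ : P.γ ≤ 1 / 2)
    (hγM : (3 / 4 * P.γ) ^ 2 * (M ^ 2 * ((q : ℝ) + 1) ^ 3) ≤ α₁ / 4)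
    (hδ : deltaStar p q α₁ M < P.δ) (hb : ∀ i j, ContDiffAt ℝ 2 (b i j) (P.orig z))
    (hbs : ∀ i j, b i j = b j i)
    (hcoer : ∀ ξ : Fin (q + 1) → ℝ,
      α₁ * ∑ i, ξ i ^ 2 ≤ -∑ i, ∑ j, dx 0 (b i j) (P.orig z) * ξ i * ξ j)
    (hz : z ∈ P.omega) (hbounds : PointBounds P (P.tilde b) M z) (hφ : ContDiffAt ℝ 2 φ z)
    (hlam : 0 < lam) (hpot : 0 ≤ P.potTotal (P.tilde b) lam α₁ (beta₀ (p + 1) (q + 1) M P.γ) z) :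
    2 * lam * P.ν * P.δ * (P.s z ^ 3)⁻¹ * dx 0 φ z ^ 2 * P.chi lam z ^ 2
      + 2 * lam * P.ν * P.s z ^ 2 * (∑ i : Fin p, dx i.succ φ z ^ 2) * P.chi lam z ^ 2
      + 2 * lam * P.ν * P.s z * (∑ j, dy j φ z ^ 2) * P.chi lam z ^ 2
      + lam ^ 3 * P.ν ^ 4 * P.δ ^ 4 * P.psi z ^ (-2 * P.ν - 3) * φ z ^ 2 * P.chi lam z ^ 2
      + (D₁ P (P.tilde b) lam (fun w => P.chi lam w * φ w) z
        + D₂ P lam α₁ (beta₀ (p + 1) (q + 1) M P.γ) (fun w => P.chi lam w * φ w) z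
        + 2 * lam * P.ν * beta₀ (p + 1) (q + 1) M P.γ * D₃ P (P.tilde b) lam φ z)
    ≤ P.psi z ^ (P.ν + 1) * P.L₀ (P.tilde b) φ z ^ 2 * P.chi lam z ^ 2
      - 2 * lam * P.ν * beta₀ (p + 1) (q + 1) M P.γ * φ z * P.s z * P.L₀ (P.tilde b) φ z
        * P.chi lam z ^ 2 := by
  have hM := hbounds.nonneg
  have hs := hbounds.s_pos
  have hK := bigConst_nonneg p q M
  have hKκ := mul_nonneg hK hbounds.kappa_nonneg
  have hδ' := add_le_of_deltaStar_lt hα₁ hM hδ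
  have hδα := add_le_mul_of_deltaStar_lt hα₁ hδ
  have hβ := one_le_beta₀ (p := p) (q := q) hM P.γ
  have hsmall : P.s z ^ 2 * (M ^ 2 * ((q : ℝ) + 1) ^ 3) ≤ α₁ / 4 := by
    refine le_trans ?_ hγM
    gcongr
    exact s_le_of_mem_omega hz (by linarith)
  have hdiv : 1 ≤ beta₀ (p + 1) (q + 1) M P.γ - 3 + (p - P.divCoeffGrad (P.tilde b) z) := by
    have : (1 : ℝ) ≤ p := by exact_mod_cast hp
    linarith [le_of_abs_le hbounds.abs_divCoeffGrad_le, le_beta₀ (p := p) (q := q) hM P.γ]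
  refine carleman_of_nonneg hs hbounds.psi_pos hν hlam (fun i j => contDiffAt_tilde (hb i j))
    (fun i j => funext fun w => congrFun (hbs i j) _) hφ (by linarith) ?_ ?_ hpot
  · exact hbounds.mul_norm₂_sq_le_gradForm (mul_le_neg_coeffPartials_tilde
      (fun i j => (hb i j).differentiableAt two_ne_zero) hs.le hcoer) hsmall hdiv
      (by linarith) (by linarith)
  · exact hbounds.mul_dotProduct_add_le (by linarith) (beta₀_le_bigConst hM hγ)
      (hδα.trans' (le_add_of_nonneg_left (by positivity)))

end UltraCarleman

theorem lemma1_general (p q : ℕ) (hp : 1 ≤ p) (α₁ M ν : ℝ) (hα₁ : 0 < α₁) (hM : 0 ≤ M)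
    (hν : 0 < ν) :
    ∃ δstar : ℝ, 0 < δstar ∧
      ∀ γ α₀ : ℝ, 0 < γ → γ ≤ 1 / 2 →
      (3 / 4 * γ) ^ 2 * (M ^ 2 * ((q + 1 : ℕ) : ℝ) ^ 3) ≤ α₁ / 4 →
      0 < α₀ → γ + α₀ < 1 →
      ∀ δ : ℝ, δstar < δ →
      ∃ lamstar : ℝ, 0 < lamstar ∧
        ∀ (U : Set (Pt (p + 1) q)) (x₀ : Fin p → ℝ) (y₀ : Fin q → ℝ)
          (a : Fin (q + 1) → Fin (q + 1) → Pt (p + 1) q → ℝ),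
        IsOpen U →
        (∀ i j, ContDiffOn ℝ 2 (a i j) U) →
        (∀ i j, C2NormLE U (a i j) M) →
        (∀ z ∈ U, ∀ ξ : Fin (q + 1) → ℝ,
          α₁ * ∑ i, ξ i ^ 2 ≤ -∑ i, ∑ j, dx 0 (a i j) z * ξ i * ξ j) →
        ∀ P : Params p q, P = ⟨γ, α₀, δ, ν, x₀, y₀⟩ →
        (∀ z ∈ P.omega, P.orig z ∈ U) →
        ∀ φ : Pt (p + 1) (q + 1) → ℝ, ContDiffOn ℝ 2 φ P.omega →
        ∀ lam : ℝ, lamstar < lam →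
        ∀ z ∈ P.omega,
          2 * lam * ν * δ * (P.s z ^ 3)⁻¹ * dx 0 φ z ^ 2 * P.chi lam z ^ 2
            + 2 * lam * ν * P.s z ^ 2 * (∑ i : Fin p, dx i.succ φ z ^ 2) * P.chi lam z ^ 2
            + 2 * lam * ν * P.s z * (∑ j, dy j φ z ^ 2) * P.chi lam z ^ 2
            + lam ^ 3 * ν ^ 4 * δ ^ 4 * P.psi z ^ (-2 * ν - 3) * φ z ^ 2 * P.chi lam z ^ 2
            + divTerm P (P.tilde a) lam α₁ (beta₀ (p + 1) (q + 1) M γ) φ z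
          ≤ P.psi z ^ (ν + 1) * P.L₀ (P.tilde a) φ z ^ 2 * P.chi lam z ^ 2
            - 2 * lam * ν * beta₀ (p + 1) (q + 1) M γ * φ z * P.s z * P.L₀ (P.tilde a) φ z
              * P.chi lam z ^ 2 := by
  refine ⟨deltaStar p q α₁ M, deltaStar_pos hα₁ hM, fun γ α₀ hγ hγ' hγM hα₀ hγα δ hδ => ?_⟩
  rw [Nat.cast_add_one] at hγM
  have hδ' := add_le_of_deltaStar_lt hα₁ hM hδ
  have hK := bigConst_nonneg p q M
  obtain ⟨lamstar, hlamstar, hpot⟩ := exists_forall_potTotal_nonneg hα₁ hν hM hα₀ hγ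
    (one_le_beta₀ (p := p) hM γ) (beta₀_le hM hγ') (by linarith : 1 + 4 * bigConst p q M + α₁ ≤ δ)
  refine ⟨lamstar, hlamstar, ?_⟩
  rintro U x₀ y₀ a hU ha haM hcoer P rfl hPU φ hφ lam hlam z hz
  have hzU := hPU z hz
  have hφz : ContDiffAt ℝ 2 φ z := hφ.contDiffAt ((isOpen_omega _).mem_nhds hz)
  have haz (i j) : ContDiffAt ℝ 2 (a i j) (Params.orig _ z) :=
    (ha i j).contDiffAt (hU.mem_nhds hzU)
  have hbz (i j) := (contDiffOn_symmetrize ha i j).contDiffAt (hU.mem_nhds hzU)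
  have hcoer' (ξ : Fin (q + 1) → ℝ) := (hcoer _ hzU ξ).trans_eq <| congrArg Neg.neg
    (sum_fderiv_symmetrize_mul_mul (fun i j => (haz i j).differentiableAt two_ne_zero) _ ξ).symm
  have hbounds := pointBounds_tilde hbz (C2NormLE.symmetrize hU ha haM) (by linarith) hα₀ hγ hγ'
    hγα hz hzU
  rw [← L₀_tilde_symmetrize hφz, divTerm, symPart_tilde]
  simpa only using carleman_tilde hp hα₁ hν hγ' hγM hδ hbz (symmetrize_comm a) hcoer' hz hbounds hφz
    (hlamstar.trans hlam) (hpot x₀ y₀ _ rfl _ z hz hbounds lam hlam)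

theorem lemma1 (p q : ℕ) (hp : 2 ≤ p + 1) (hq : 2 ≤ q + 1)
    (α₁ M ν : ℝ) (hα₁ : 0 < α₁) (hM : 0 < M) (hν : 0 < ν) :
    ∃ δstar : ℝ, 0 < δstar ∧
      ∀ ε₀ γ α₀ : ℝ, 0 < ε₀ → ε₀ < α₁ / (4 * ((q + 1 : ℕ) : ℝ)) →
      0 < γ →
      γ < min (1 / 2) (4 / 3 * (M * (M * ((q + 1 : ℕ) : ℝ) ^ 2 * ε₀⁻¹ + ((q + 1 : ℕ) : ℝ) ^ 2
        + ((q + 1 : ℕ) : ℝ) * (((q + 1 : ℕ) : ℝ) + 1))) ^ (-(1 / 2) : ℝ)) →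
      0 < α₀ → γ + α₀ < 1 →
      ∀ δ : ℝ, δstar < δ →
      ∃ lamstar : ℝ, 0 < lamstar ∧
        ∀ (D : Set (Fin (p + 1) → ℝ)) (G' : Set (Fin q → ℝ)) (x₀ : Fin p → ℝ) (y₀ : Fin q → ℝ)
          (a : Fin (q + 1) → Fin (q + 1) → Pt (p + 1) q → ℝ),
        IsOpen D → IsOpen G' →
        (∀ i j, IsC2Closure (D ×ˢ G') (a i j)) →
        (∀ i j, C2NormLE (D ×ˢ G') (a i j) M) →
        (∀ z ∈ D ×ˢ G', ∀ ξ : Fin (q + 1) → ℝ,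
          α₁ * ∑ i, ξ i ^ 2 ≤ -∑ i, ∑ j, dx 0 (a i j) z * ξ i * ξ j) →
        ∀ P : Params p q, P = ⟨γ, α₀, δ, ν, x₀, y₀⟩ →
        (∀ z ∈ P.omega, P.orig z ∈ D ×ˢ G') →
        ∀ φ : Pt (p + 1) (q + 1) → ℝ, IsC2Closure P.omega φ →
        ∀ lam : ℝ, lamstar < lam →
        ∀ z ∈ P.omega,
          2 * lam * ν * δ * (P.s z ^ 3)⁻¹ * dx 0 φ z ^ 2 * P.chi lam z ^ 2
            + 2 * lam * ν * P.s z ^ 2 * (∑ i : Fin p, dx i.succ φ z ^ 2) * P.chi lam z ^ 2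
            + 2 * lam * ν * P.s z * (∑ j, dy j φ z ^ 2) * P.chi lam z ^ 2
            + lam ^ 3 * ν ^ 4 * δ ^ 4 * P.psi z ^ (-2 * ν - 3) * φ z ^ 2 * P.chi lam z ^ 2
            + divTerm P (P.tilde a) lam α₁ (beta₀ (p + 1) (q + 1) M γ) φ z
          ≤ P.psi z ^ (ν + 1) * P.L₀ (P.tilde a) φ z ^ 2 * P.chi lam z ^ 2
            - 2 * lam * ν * beta₀ (p + 1) (q + 1) M γ * φ z * P.s z * P.L₀ (P.tilde a) φ z
              * P.chi lam z ^ 2 := by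
  obtain ⟨δstar, hδstar, h⟩ := lemma1_general p q (by lia) α₁ M ν hα₁ hM.le hν
  refine ⟨δstar, hδstar, fun ε₀ γ α₀ hε hε' hγ hγ' hα₀ hγα δ hδ => ?_⟩
  obtain ⟨hγ_half, hγ_rpow⟩ := lt_min_iff.mp hγ'
  obtain ⟨lamstar, hlamstar, h⟩ := h γ α₀ hγ hγ_half.le
    (sq_mul_le_of_lt_rpow hM (by positivity) hε hε' hγ.le hγ_rpow) hα₀ hγα δ hδ
  exact ⟨lamstar, hlamstar, fun D G' x₀ y₀ a hD hG ha haM hcoer P hP hPU φ hφ =>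
    h (D ×ˢ G') x₀ y₀ a (hD.prod hG) (fun i j => (ha i j).1) haM hcoer P hP hPU φ hφ.1⟩
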